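/- **Setting.** Let $M$ be a connected Riemann surface and $\underline{\mathbb C}^n=M\times\mathbb C^n$. For a holomorphic subbundle $E\subseteq\underline{\mathbb C}^n$ and $i\ge 0$, $E^{(i)}$ is the subbundle spanned by the local holomorphic sections of $E$ and their derivatives up to order $i$ (holes filled in on a discrete set), $E^{(-i)}$ is the subbundle spanned by the local holomorphic sections of $E$ whose derivatives up to order $i$ are again sections of $E$, and $g_E=\operatorname{rank}E^{(1)}-\operatorname{rank}E$. For a subbundle $B$ and meromorphic sections $s_j$, $B+\mathrm{Span}\{s_j\}$ is the subbundle they span, again with holes filled in. Let $\xi\in\mathfrak u(n)$ with $\exp(2\pi\xi)=1$, $\gamma_\xi(\lambda)=\exp(-\sqrt{-1}\ln(\lambda)\,\xi)$, and $\Omega_\xi=\{g\gamma_\xi g^{-1}: g\in U(n)\}$. Let $H_+$ be the space of functions in $L^2(S^1,\mathbb C^n)$ with vanishing negative Fourier coefficients and $p_i(\sum_j\lambda^ja_j)=a_i$. For a loop $\gamma$ put $A_i(\gamma)=p_i(\gamma H_+\cap\lambda^iH_+)$ and $A_i^\xi=A_i(\gamma_\xi)$, so that $$\{0\}=A^\xi_{-r-1}\subsetneq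 A^\xi_{-r}\subseteq\dots\subseteq A^\xi_{k-1}\subsetneq A^\xi_k=\mathbb C^n$$ for certain integers $r,k$. Let $d_i=\dim A_i^\xi$ and $h_i=d_{i+1}-d_i\ge 0$. Flags below are continued by $A_i=\{0\}$ for $i<-r$ and $A_i=\underline{\mathbb C}^n$ for $i\ge k$. **Single step.** Let $T\subseteq E$ be holomorphic subbundles and $i,j,g,d\geq 0$ integers with $$(\ast)\quad g\ge\max\{g_T,g_E\},\qquad T^{(j)}\subseteq E^{(-i)},\qquad \operatorname{rank}T^{(j)}\le d\le\operatorname{rank}E^{(-i)}.$$ A bundle $F$ is *found from $(T,E,j,i,g,d)$* if $T^{(j)}\subseteq F$ and: * if $g>0$ and $\operatorname{rank}T^{(j)}\neq d$: with $k_0=\max\{k\ge 0: d-kg>\operatorname{rank}T^{(j-k)}\}$ there are bundles $F_{-k_0},\dots,F_{-1},F_0=F$ such that $F_{-k_0}=T^{(j-k_0)}+\mathrm{Span}\{\dots\}$ has rank $d-k_0g$, the span being that of $d-k_0g-\operatorname{rank}T^{(j-k_0)}$ linearly independent meromorphic sections of $E^{(-i-k_0)}$, and, for $1\le l\le k_0$,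 $F_{-k_0+l}=F_{-k_0+l-1}^{(1)}+\mathrm{Span}\{\dots\}$ has rank $d-(k_0-l)g$, the span being that of $d-(k_0-l)g-\operatorname{rank}F_{-k_0+l-1}^{(1)}$ linearly independent meromorphic sections of $E^{(-i-k_0+l)}$; * if $g>0$ and $\operatorname{rank}T^{(j)}=d$: $F=T^{(j)}$; * if $g=0$: $F\subseteq E^{(-i)}$ is a constant subspace of dimension $d$. **Algorithm.** Start with the range of indices $-r-2<i<k$, with $A_{-r-2}=\{0\}$ and $A_k=\underline{\mathbb C}^n$. For a non-empty range $a<i<b$ with $A_a$ and $A_b$ already found, let $l=\min_{a<i<b}h_i$, let $m$ be the largest index in the range with $h_m=l$, find $A_m$ from $(T,E,j,i,g,d)=(A_a,A_b,m-a,b-m,l,d_m)$, and continue with the ranges $a<i<m$ and $m<i<b$. **Theorem.** 1. A family $(A_i)$ is a super-horizontal flag $\{0\}=A_{-r-1}\subsetneq A_{-r}\subseteq\dots\subseteq A_{k-1}\subsetneq A_k=\underline{\mathbb C}^n$ of holomorphic subbundles (that is, $z$-derivatives of local sections of $A_i$ are in $A_{i+1}$) with $\operatorname{rank}A_i=d_i$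 if and only if it arises from the algorithm. 2. The algorithm never gets stuck: whatever bundles have been found before, at each step $T\subseteq E$ are holomorphic subbundles, $(\ast)$ holds, and some $F$ can be found. 3. This yields all $S^1$-invariant extended solutions with values in $\Omega_\xi$: if $\Phi:M\to\Omega_\xi$ is an extended solution, i.e. is smooth with $\Phi_\lambda^{-1}d\Phi_\lambda=\frac{1-\lambda^{-1}}2\alpha'+\frac{1-\lambda}2\alpha''$ for all $\lambda\in S^1$, where $\alpha',\alpha''$ are of type $(1,0)$, $(0,1)$ and do not depend on $\lambda$, then the flag $p\mapsto A_i(\Phi(p))$ arises from the algorithm; and every flag which arises from the algorithm is the flag of exactly one extended solution $\Phi:M\to\Omega_\xi$. -/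

import Mathlib

open Filter Topology MeasureTheory
open scoped Manifold ContDiff

noncomputable section

namespace SuperHorizontal

/-- The Hermitian space `ℂⁿ`. -/
abbrev Cn (n : ℕ) := EuclideanSpace ℂ (Fin n)

/-- Complex `n × n` matrices, as operators on `ℂⁿ`; `star` is the conjugate transpose. -/
abbrev Op (n : ℕ) := Cn n →L[ℂ] Cn n

/-- A family of subspaces of `ℂⁿ` parametrised by `M`; inclusion, sum, `⊥` and `⊤` are
fibrewise. -/
abbrev Fam (n : ℕ) (M : Type*) := M → Submodule ℂ (Cn n)

/-! ### Holomorphic subbundles of the trivial bundle over a Riemann surface -/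

section Bundles

variable {n : ℕ} {M : Type*} [TopologicalSpace M] [ChartedSpace ℂ M]

/-- `s` is holomorphic on a neighbourhood of `p`. -/
def HolNear (s : M → Cn n) (p : M) : Prop :=
  ∀ᶠ q in 𝓝 p, MDifferentiableAt 𝓘(ℂ, ℂ) 𝓘(ℂ, Cn n) s q

/-- `s` is a holomorphic section of `E` on a neighbourhood of `p`. -/
def IsHolSectionNear (E : Fam n M) (s : M → Cn n) (p : M) : Prop :=
  HolNear s p ∧ ∀ᶠ q in 𝓝 p, s q ∈ E q

/-- `E` is a holomorphic subbundle of rank `d` of the trivial bundle `M × ℂⁿ`: near every point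
it has a frame of `d` holomorphic sections. -/
def IsHolSubbundle (E : Fam n M) (d : ℕ) : Prop :=
  ∀ p : M, ∃ s : Fin d → M → Cn n,
    (∀ j, HolNear (s j) p) ∧
    ∀ᶠ q in 𝓝 p, LinearIndependent ℂ (fun j => s j q) ∧
      Submodule.span ℂ (Set.range fun j => s j q) = E q

/-- The (constant) rank of a subbundle. -/
def rk (E : Fam n M) : ℕ := ⨆ p : M, Module.finrank ℂ (E p)

/-- The `l`-th derivative `∂ˡs/∂zˡ` at `p`, in the preferred complex coordinate `z` at `p`.
Below, derivatives of all orders up to some bound always occur together with `s` itself, and then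
the choice of the coordinate is irrelevant. -/
def zDeriv (l : ℕ) (s : M → Cn n) (p : M) : Cn n :=
  iteratedDeriv l (s ∘ (chartAt ℂ p).symm) (chartAt ℂ p p)

/-- Filling in holes. If `S` is a holomorphic subbundle off a discrete set, `fill S` is its
extension to all of `M`: its fibre at `p` consists of the values at `p` of the holomorphic
`t` near `p` which are sections of `S` on a punctured neighbourhood of `p`. -/
def fill (S : Fam n M) : Fam n M := fun p =>
  Submodule.span ℂ {v | ∃ t : M → Cn n, HolNear t p ∧ (∀ᶠ q in 𝓝[≠] p, t q ∈ S q) ∧ v = t p}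

/-- The pointwise span of the local holomorphic sections of `E` and their derivatives up to
order `i`. -/
def derivSpan (E : Fam n M) (i : ℕ) : Fam n M := fun p =>
  Submodule.span ℂ {v | ∃ s : M → Cn n, IsHolSectionNear E s p ∧ ∃ l ≤ i, v = zDeriv l s p}

/-- The bundle spanned by the local holomorphic sections of `E` whose derivatives up to order `i`
are local sections of `E` as well. -/
def derivKer (E : Fam n M) (i : ℕ) : Fam n M := fun p =>
  Submodule.span ℂ {v | ∃ s : M → Cn n,
    IsHolSectionNear E s p ∧ (∀ᶠ q in 𝓝 p, ∀ l ≤ i, zDeriv l s q ∈ E q) ∧ v = s p}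

/-- The `i`-th osculating bundle `E⁽ⁱ⁾`, for `i` of any sign. -/
def osc (E : Fam n M) (i : ℤ) : Fam n M :=
  if 0 ≤ i then fill (derivSpan E i.toNat) else derivKer E (-i).toNat

/-- `g_E = rank E⁽¹⁾ - rank E`. -/
def gap (E : Fam n M) : ℕ := rk (osc E 1) - rk E

/-- `s` is a global meromorphic section of `E`. Values at poles, and more generally on a discrete
set, are irrelevant. -/
def IsMeroSection (E : Fam n M) (s : M → Cn n) : Prop :=
  (∀ p : M, MeromorphicAt (s ∘ (chartAt ℂ p).symm) (chartAt ℂ p p)) ∧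
  ∀ p : M, ∀ᶠ q in 𝓝[≠] p, s q ∈ E q

/-- The bundle `B + Span{s₁, …, s_r}`, for meromorphic sections `s₁, …, s_r`. -/
def addSpan (B : Fam n M) {r : ℕ} (s : Fin r → M → Cn n) : Fam n M :=
  fill fun q => B q ⊔ Submodule.span ℂ (Set.range fun j => s j q)

/-! ### The algebraic construction of a single bundle -/

/-- `F = B + Span{s₁, …, s_r}` has rank `e`, where the `sⱼ` are `r = e - rank B` linearly
independent meromorphic sections of `E`. -/
def AddSections (B E : Fam n M) (e : ℕ) (F : Fam n M) : Prop :=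
  ∃ (r : ℕ) (s : Fin r → M → Cn n),
    r + rk B = e ∧
    (∀ j, IsMeroSection E (s j)) ∧
    (∀ p : M, ∀ᶠ q in 𝓝[≠] p, LinearIndependent ℂ (fun j => s j q)) ∧
    F = addSpan B s ∧ IsHolSubbundle F e

/-- The chain construction, for `g > 0` and `rank T⁽ʲ⁾ < d`. With
`k₀ = max {k | d - k g > rank T⁽ʲ⁻ᵏ⁾}`, one chooses successively `G 0, …, G k₀ = F`
(`G l` is `F_{-k₀+l}`):
* `G 0 = T⁽ʲ⁻ᵏ⁰⁾ + Span{…}` of rank `d - k₀ g`, with sections of `E⁽⁻ⁱ⁻ᵏ⁰⁾`;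
* `G (l+1) = (G l)⁽¹⁾ + Span{…}` of rank `d - (k₀ - (l+1)) g`, with sections of
  `E⁽⁻ⁱ⁻ᵏ⁰⁺ˡ⁺¹⁾`.
The subtractions of naturals do not truncate, by the choice of `k₀` and since `l < k₀`. -/
def ChainConstruction (T E : Fam n M) (j i : ℤ) (g d : ℕ) (F : Fam n M) : Prop :=
  ∃ k₀ : ℕ, IsGreatest {k : ℕ | rk (osc T (j - k)) + k * g < d} k₀ ∧
    ∃ G : ℕ → Fam n M,
      AddSections (osc T (j - k₀)) (osc E (-i - k₀)) (d - k₀ * g) (G 0) ∧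
      (∀ l < k₀, AddSections (osc (G l) 1) (osc E (-i - k₀ + (l + 1)))
        (d - (k₀ - (l + 1)) * g) (G (l + 1))) ∧
      G k₀ = F

/-- `F`, with `T⁽ʲ⁾ ⊆ F`, is found from `T`, `E`, `d`, `g`: by the chain construction in the main
case `g > 0`, `rank T⁽ʲ⁾ ≠ d`; when `rank T⁽ʲ⁾ = d` there is no choice, `F = T⁽ʲ⁾`; when
`g = 0`, `F` is a constant `d`-dimensional subspace inside `E⁽⁻ⁱ⁾`. -/
def AlgStep (T E : Fam n M) (j i : ℤ) (g d : ℕ) (F : Fam n M) : Prop :=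
  osc T j ≤ F ∧
    if g = 0 then
      F ≤ osc E (-i) ∧ ∃ L : Submodule ℂ (Cn n), Module.finrank ℂ L = d ∧ F = fun _ => L
    else if rk (osc T j) = d then F = osc T j
    else ChainConstruction T E j i g d F

/-- The data to which `AlgStep` is applied satisfy its requirements: `T ⊆ E` are holomorphic
subbundles, `g ≥ max {g_T, g_E}`, `T⁽ʲ⁾ ⊆ E⁽⁻ⁱ⁾` and `rank T⁽ʲ⁾ ≤ d ≤ rank E⁽⁻ⁱ⁾`. -/
def Admissible (T E : Fam n M) (j i : ℤ) (g d : ℕ) : Prop :=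
  (∃ e, IsHolSubbundle T e) ∧ (∃ e, IsHolSubbundle E e) ∧ T ≤ E ∧ 0 ≤ j ∧ 0 ≤ i ∧
    gap T ≤ g ∧ gap E ≤ g ∧ osc T j ≤ osc E (-i) ∧
    rk (osc T j) ≤ d ∧ d ≤ rk (osc E (-i))

/-! ### The recursive algorithm -/

/-- `h_i = d_{i+1} - d_i`, for an increasing sequence `d`. -/
def jump (d : ℤ → ℕ) (i : ℤ) : ℕ := d (i + 1) - d i

/-- `m` is the largest index at which `h` attains its minimum over `a < i < b`. -/
def IsLastMin (d : ℤ → ℕ) (a b m : ℤ) : Prop :=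
  a < m ∧ m < b ∧ (∀ i, a < i → i < b → jump d m ≤ jump d i) ∧
    ∀ i, m < i → i < b → jump d m < jump d i

/-- `AlgStep` for the index `m`, lying between the indices `a < b` already treated. -/
def StepAt (d : ℤ → ℕ) (A : ℤ → Fam n M) (a b m : ℤ) (F : Fam n M) : Prop :=
  AlgStep (A a) (A b) (m - a) (b - m) (jump d m) (d m) F

/-- `Stage d r k A a b`: the recursion reaches the open interval `(a, b)` of indices, `A a` and
`A b` (and the bundles on which they depend) having been found by the algorithm. It starts with
all indices `-r-1, …, k-1`, `T = A_{-r-2} = {0}` and `E = A_k = ℂⁿ`; after `A m` has been found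
it continues with the indices on the left of `m` and those on the right of `m`. -/
inductive Stage (d : ℤ → ℕ) (r k : ℤ) (A : ℤ → Fam n M) : ℤ → ℤ → Prop
  | init : Stage d r k A (-r - 2) k
  | left {a b m : ℤ} : Stage d r k A a b → IsLastMin d a b m →
      StepAt d A a b m (A m) → Stage d r k A a m
  | right {a b m : ℤ} : Stage d r k A a b → IsLastMin d a b m →
      StepAt d A a b m (A m) → Stage d r k A m b

/-- The ends of a flag `{0} = A_{-r-1} ⊆ … ⊆ A_k = ℂⁿ`, continued by `{0}` and `ℂⁿ`. -/
def HasEnds (r k : ℤ) (A : ℤ → Fam n M) : Prop :=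
  (∀ i < -r, A i = ⊥) ∧ ∀ i ≥ k, A i = ⊤

/-- `A` arises from the algorithm. -/
def Produced (d : ℤ → ℕ) (r k : ℤ) (A : ℤ → Fam n M) : Prop :=
  HasEnds r k A ∧
    ∀ a b m, Stage d r k A a b → IsLastMin d a b m → StepAt d A a b m (A m)

/-- `A` is a super-horizontal flag `{0} = A_{-r-1} ⊆ … ⊆ A_k = ℂⁿ` of holomorphic subbundles with
`rank A_i = d_i`: the `z`-derivative of a local section of `A_i` is in `A_{i+1}`. -/
def IsSuperHorizontalFlag (d : ℤ → ℕ) (r k : ℤ) (A : ℤ → Fam n M) : Prop :=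
  HasEnds r k A ∧ (∀ i, IsHolSubbundle (A i) (d i)) ∧ (∀ i, A i ≤ A (i + 1)) ∧
    ∀ (i : ℤ) (p : M) (s : M → Cn n), IsHolSectionNear (A i) s p → zDeriv 1 s p ∈ A (i + 1) p

end Bundles

/-! ### Loops in `U(n)` and the Grassmannian model -/

section Loops

variable {n : ℕ}

/-- `ξ` belongs to the integer lattice of `U(n)`. -/
def IsIntegral (ξ : Op n) : Prop :=
  star ξ = -ξ ∧ NormedSpace.exp ((2 * Real.pi : ℂ) • ξ) = 1

/-- The homomorphism `γ_ξ(w) = exp(-√-1 ln(w) ξ)`. -/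
def gammaLoop (ξ : Op n) (w : Circle) : Op n :=
  NormedSpace.exp ((-Complex.I * Complex.log (w : ℂ)) • ξ)

/-- `Ω_ξ`, the `U(n)`-conjugacy class of `γ_ξ`. -/
def OmegaXi (ξ : Op n) : Set (Circle → Op n) :=
  {γ | ∃ g ∈ unitary (Op n), γ = fun w => g * gammaLoop ξ w * star g}

/-- The `i`-th Fourier coefficient `a_i` of `f = ∑ λⁱ a_i`. -/
def fourierCoef (f : Circle → Cn n) (i : ℤ) : Cn n :=
  (2 * Real.pi : ℂ)⁻¹ • ∫ θ in (0 : ℝ)..(2 * Real.pi),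
    ((Circle.exp θ : ℂ) ^ (-i)) • f (Circle.exp θ)

/-- `λⁱ H₊`: the square integrable functions whose Fourier coefficients of index `< i` vanish. -/
def Hplus (n : ℕ) (i : ℤ) : Set (Circle → Cn n) :=
  {f | MemLp (fun θ : ℝ => f (Circle.exp θ)) 2 (volume.restrict (Set.Ioc 0 (2 * Real.pi))) ∧
    ∀ m < i, fourierCoef f m = 0}

/-- `W = γ H₊`. -/
def grassmannian (γ : Circle → Op n) : Set (Circle → Cn n) :=
  {f | ∃ h ∈ Hplus n 0, f = fun w => γ w (h w)}

/-- The subspace `A_i = p_i(W ∩ λⁱ H₊)` of `ℂⁿ`, where `W = γ H₊` and `p_i` takes the `i`-th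
Fourier coefficient (the spanning set is already a subspace). -/
def loopFlag (γ : Circle → Op n) (i : ℤ) : Submodule ℂ (Cn n) :=
  Submodule.span ℂ {a | ∃ f ∈ grassmannian γ, f ∈ Hplus n i ∧ fourierCoef f i = a}

/-- The dimensions `d_i = dim A^ξ_i`. -/
def flagDim (ξ : Op n) (i : ℤ) : ℕ := Module.finrank ℂ (loopFlag (gammaLoop ξ) i)

/-- `-r` and `k` are the indices in
`{0} = A^ξ_{-r-1} ⊊ A^ξ_{-r} ⊆ … ⊆ A^ξ_{k-1} ⊊ A^ξ_k = ℂⁿ`. -/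
def FlagBounds (ξ : Op n) (r k : ℤ) : Prop :=
  loopFlag (gammaLoop ξ) (-r - 1) = ⊥ ∧ loopFlag (gammaLoop ξ) (-r) ≠ ⊥ ∧
    loopFlag (gammaLoop ξ) (k - 1) ≠ ⊤ ∧ loopFlag (gammaLoop ξ) k = ⊤

variable {M : Type*} [TopologicalSpace M] [ChartedSpace ℂ M]

/-- `∂u/∂z` at `p`, in the preferred coordinate at `p`. -/
def dz (u : M → Op n) (p : M) : Op n :=
  let D := fderiv ℝ (u ∘ (chartAt ℂ p).symm) (chartAt ℂ p p)
  (1 / 2 : ℂ) • (D 1 - Complex.I • D Complex.I)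

/-- `∂u/∂z̄` at `p`, in the preferred coordinate at `p`. -/
def dzbar (u : M → Op n) (p : M) : Op n :=
  let D := fderiv ℝ (u ∘ (chartAt ℂ p).symm) (chartAt ℂ p p)
  (1 / 2 : ℂ) • (D 1 + Complex.I • D Complex.I)

/-- `Φ : M → Ω U(n)` is an extended solution:
`Φ_w⁻¹ dΦ_w = (1 - w⁻¹)/2 α' + (1 - w)/2 α''` for all `w ∈ S¹`, with `α'` of type `(1,0)` and
`α''` of type `(0,1)` (evaluation at `w = -1` shows that `α' + α'' = Φ_{-1}⁻¹ dΦ_{-1}`). -/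
def IsExtendedSolution (Φ : M → Circle → Op n) : Prop :=
  (∀ p w, Φ p w ∈ unitary (Op n)) ∧ (∀ p, Φ p 1 = 1) ∧
  (∀ w, ContMDiff 𝓘(ℝ, ℂ) 𝓘(ℝ, Op n) ∞ fun p => Φ p w) ∧
  ∀ p, ∃ a b : Op n, ∀ w : Circle,
    star (Φ p w) * dz (fun q => Φ q w) p = ((1 - (w : ℂ)⁻¹) / 2) • a ∧
    star (Φ p w) * dzbar (fun q => Φ q w) p = ((1 - (w : ℂ)) / 2) • b

end Loops

end SuperHorizontal

end

open SuperHorizontal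

namespace SuperHorizontal

/-! ### Analyticity of operator-valued expressions -/

section AnalyticOperators

variable {E F G : Type*} [NormedAddCommGroup E] [NormedSpace ℂ E] [NormedAddCommGroup F]
  [NormedSpace ℂ F] [NormedAddCommGroup G] [NormedSpace ℂ G] {z₀ : ℂ}

/-! Bundles. Locally a holomorphic subbundle is the range of an analytic family `Q` of idempotents
(`HolAt`), and holes are filled by dividing an analytic vector or functional by a power of `z - z₀`
(`IdemAt.exists_sup`, `IdemAt.exists_inf`). A section satisfies `s' = Q's + Qs'`, and `QQ'Q = 0`;
hence, off a discrete set, `E⁽¹⁾ = E ⊕ Q'E` and `E⁽⁻¹⁾ = E ∩ ker Q'`. Rank-nullity gives rank `E⁽¹⁾`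
+ rank `E⁽⁻¹⁾` = 2 rank `E` (`rk_osc_one_add`). Together with the adjunction between `E ↦ E⁽¹⁾` and
`F ↦ F⁽⁻¹⁾` (`osc_one_le_iff_le`) this controls all ranks and gaps. Every vector of a bundle is a
value of a global meromorphic section (`Hol.exists_isMeroSection`), so adding sections of `E` to `B`
reaches every bundle between `B` and `E` (`addSections_iff`).

Single step. Under (∗) the bundles found from `(T, E, j, i, g, d)` are exactly the bundles `F` of
rank `d` with `T⁽ʲ⁾ ⊆ F ⊆ E⁽⁻ⁱ⁾` and `g_F ≤ g`. In a chain whose ranks grow by `g` the gaps are at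
most `g`, the maximality of `k₀` taking care of the first member (`AlgStep.spec`). Conversely a
chain is built downwards from `F`, each new member being chosen of rank smaller by `g` inside
`F⁽⁻¹⁾` (`exists_chain`, `algStep_of_between`).

Recursion. A super-horizontal flag has `A_a⁽ᵐ⁻ᵃ⁾ ⊆ A_m ⊆ A_b⁽ᵐ⁻ᵇ⁾` and gap of `A_m` at most `h_m`,
so each of its bundles is found by the step. Conversely the recursion preserves `A_a⁽ᵇ⁻ᵃ⁾ ⊆ A_b`,
which is super-horizontality once `b = a + 1`. It never gets stuck: minimality of `h_m` gives the
rank inequalities in (∗), and `m` being the last minimum makes the gap of the left bundle either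
zero or strictly smaller than the later `h_i`. That strictness is the room needed to lower the rank
one by one from `E⁽⁻ⁱ⁾` without exceeding the gap `g` (`exists_between_of_gap_lt`).

Loops. Elements of `Ω_ξ` are diagonal in an orthonormal basis with fixed weights, and `A_i` is
spanned by the basis vectors of weight at most `i` (`IsDiag.loopFlag_eq`). With `π_i` the orthogonal
projection onto `A_i`, `γ(w) = wᵏ - Σ (wⁱ⁺¹ - wⁱ) π_i`, so the loop and the flag determine each
other. Conversely `π_i` is a weighted mean of `γ(w)` over roots of unity. Applied to an extended
solution, this mean shows that `∂π_i` maps into `A_{i+1}` and `∂̄π_i` into `A_i`, that is, the flag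
is holomorphic and super-horizontal. Conversely these properties put `∂π_i` in `A_{i+1} ⊖ A_i` and
`∂̄π_i` in `A_i ⊖ A_{i-1}`, where `γ(w)` is scalar, and the equation of an extended solution follows
by differentiating the formula (`isExtendedSolution_of_proj`). -/

theorem _root_.AnalyticAt.clm_apply {f : ℂ → E →L[ℂ] F} {x : ℂ → E} (hf : AnalyticAt ℂ f z₀)
    (hx : AnalyticAt ℂ x z₀) : AnalyticAt ℂ (fun z => f z (x z)) z₀ :=
  ((ContinuousLinearMap.id ℂ (E →L[ℂ] F)).analyticAt_bilinear (f z₀, x z₀)).comp₂ hf hx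

theorem _root_.AnalyticAt.clm_comp {f : ℂ → F →L[ℂ] G} {g : ℂ → E →L[ℂ] F}
    (hf : AnalyticAt ℂ f z₀) (hg : AnalyticAt ℂ g z₀) :
    AnalyticAt ℂ (fun z => (f z).comp (g z)) z₀ :=
  ((ContinuousLinearMap.compL ℂ E F G).analyticAt_bilinear (f z₀, g z₀)).comp₂ hf hg

theorem _root_.ContinuousLinearMap.comp_analyticAt (l : E →L[ℂ] F) {x : ℂ → E}
    (hx : AnalyticAt ℂ x z₀) : AnalyticAt ℂ (fun z => l (x z)) z₀ :=
  (l.analyticAt _).comp hx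

theorem _root_.AnalyticAt.clm_smulRight {f : ℂ → E →L[ℂ] ℂ} {x : ℂ → F}
    (hf : AnalyticAt ℂ f z₀) (hx : AnalyticAt ℂ x z₀) :
    AnalyticAt ℂ (fun z => (f z).smulRight (x z)) z₀ :=
  ((ContinuousLinearMap.smulRightL ℂ E F).analyticAt_bilinear (f z₀, x z₀)).comp₂ hf hx

end AnalyticOperators

/-! ### Analytic families of idempotents -/

section LocalTheory

variable {n : ℕ}

/-- The range of an operator, as a subspace of `ℂⁿ`. -/
def ran (A : Op n) : Submodule ℂ (Cn n) := LinearMap.range (A : Cn n →ₗ[ℂ] Cn n)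

theorem apply_mem_ran (A : Op n) (v : Cn n) : A v ∈ ran A := ⟨v, rfl⟩

theorem mem_ran_of_idem {A : Op n} (h : A * A = A) {v : Cn n} : v ∈ ran A ↔ A v = v := by
  refine ⟨?_, fun hv => ⟨v, hv⟩⟩
  rintro ⟨w, rfl⟩
  exact congrArg (fun B : Op n => B w) h

/-- `Q` is an analytic family of idempotents near `z₀`. -/
structure IdemAt (Q : ℂ → Op n) (z₀ : ℂ) : Prop where
  an : AnalyticAt ℂ Q z₀
  idem : ∀ᶠ z in 𝓝 z₀, Q z * Q z = Q z

/-- Near `z₀`, `S` is the range of an analytic family of idempotents. -/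
def HolAt (S : Fam n ℂ) (z₀ : ℂ) : Prop :=
  ∃ Q, IdemAt Q z₀ ∧ ∀ᶠ z in 𝓝 z₀, ran (Q z) = S z

/-- On a punctured neighbourhood of `z₀`, `S` is the range of a family of idempotents which is
analytic at `z₀` as well. -/
def GenHolAt (S : Fam n ℂ) (z₀ : ℂ) : Prop :=
  ∃ Q, IdemAt Q z₀ ∧ ∀ᶠ z in 𝓝[≠] z₀, ran (Q z) = S z

/-- Modulo `ran Q` the vector `x` may be replaced by `x - Qx`, which is either identically zero or
`(z - z₀) ^ k • u` with `u z₀ ≠ 0`. The direction of `u` extends the line across `z₀`. -/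
theorem IdemAt.exists_sup {Q : ℂ → Op n} {z₀ : ℂ} (hQ : IdemAt Q z₀) {x : ℂ → Cn n}
    (hx : AnalyticAt ℂ x z₀) :
    ∃ Q', IdemAt Q' z₀ ∧ ∀ᶠ z in 𝓝[≠] z₀, ran (Q' z) = ran (Q z) ⊔ Submodule.span ℂ {x z} := by
  have hy : AnalyticAt ℂ (fun z => x z - Q z (x z)) z₀ := hx.sub (hQ.an.clm_apply hx)
  by_cases h0 : ∀ᶠ z in 𝓝 z₀, x z - Q z (x z) = 0
  · refine ⟨Q, hQ, ?_⟩
    filter_upwards [eventually_nhdsWithin_of_eventually_nhds h0] with z hz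
    rw [eq_comm, sup_eq_left, Submodule.span_singleton_le_iff_mem]
    exact ⟨x z, (sub_eq_zero.1 hz).symm⟩
  obtain ⟨k, u, hu, hu0, hxu⟩ := hy.exists_eventuallyEq_pow_smul_nonzero_iff.2 h0
  have hQu' : ∀ᶠ z in 𝓝[≠] z₀, Q z (u z) = 0 := by
    filter_upwards [eventually_nhdsWithin_of_eventually_nhds hxu,
      eventually_nhdsWithin_of_eventually_nhds hQ.idem, self_mem_nhdsWithin] with z h1 h2 h3
    have h4 : (z - z₀) ^ k ≠ 0 := pow_ne_zero _ (sub_ne_zero.2 h3)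
    have h5 : Q z (Q z (x z)) = Q z (x z) := congrArg (fun B : Op n => B (x z)) h2
    have h6 : (z - z₀) ^ k • Q z (u z) = 0 := by
      rw [← map_smul, ← h1, map_sub, h5, sub_self]
    exact (smul_eq_zero.1 h6).resolve_left h4
  have hQu : ∀ᶠ z in 𝓝 z₀, Q z (u z) = 0 :=
    (hQ.an.clm_apply hu).frequently_zero_iff_eventually_zero.1 hQu'.frequently
  obtain ⟨l, hl⟩ : ∃ l : Cn n →L[ℂ] ℂ, l (u z₀) ≠ 0 := by
    refine ⟨innerSL ℂ (u z₀), ?_⟩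
    simpa using hu0
  have hlu : AnalyticAt ℂ (fun z => l (u z)) z₀ := l.comp_analyticAt hu
  -- Since `Q u = 0`, this is the rank-one projection onto the line of `u` that vanishes on `ran Q`;
  -- `l` only normalises it near `z₀`.
  let R : ℂ → Op n := fun z =>
    (l (u z))⁻¹ • (l.comp (1 - Q z)).smulRight (u z)
  have hR : AnalyticAt ℂ R z₀ := by
    exact (hlu.inv hl).smul ((analyticAt_const.clm_comp (analyticAt_const.sub hQ.an)).clm_smulRight hu)
  have hRa : ∀ z v, R z v = ((l (u z))⁻¹ * l (v - Q z v)) • u z := by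
    intro z v
    simp [R, mul_smul, sub_smul]
  refine ⟨fun z => Q z + R z, ⟨hQ.an.add hR, ?_⟩, ?_⟩
  · filter_upwards [hQ.idem, hQu, hlu.continuousAt.eventually_ne hl] with z h1 h2 h3
    ext1 v
    have h5 : ∀ v, Q z (Q z v) = Q z v := fun v => congrArg (fun B : Op n => B v) h1
    have h6 : Q z (Q z v + R z v) = Q z v := by simp [hRa, h2, h5]
    change Q z (Q z v + R z v) + R z (Q z v + R z v) = Q z v + R z v
    rw [hRa z (Q z v + R z v), h6, add_sub_cancel_left, hRa z v, map_smul, smul_eq_mul]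
    congr 2
    field_simp
  · filter_upwards [eventually_nhdsWithin_of_eventually_nhds hxu,
      eventually_nhdsWithin_of_eventually_nhds hQ.idem, self_mem_nhdsWithin, hQu',
      eventually_nhdsWithin_of_eventually_nhds (hlu.continuousAt.eventually_ne hl)]
      with z h1 h2 h3 h4 h6
    have h7 : (z - z₀) ^ k ≠ 0 := pow_ne_zero _ (sub_ne_zero.2 h3)
    have h5 : ∀ v, Q z (Q z v) = Q z v := fun v => congrArg (fun B : Op n => B v) h2
    have hu : u z ∈ ran (Q z) ⊔ Submodule.span ℂ {x z} := by
      have : u z = ((z - z₀) ^ k)⁻¹ • (x z - Q z (x z)) := by rw [h1, inv_smul_smul₀ h7]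
      rw [this]
      refine Submodule.smul_mem _ _ (Submodule.sub_mem _ ?_ ?_)
      · exact Submodule.mem_sup_right (Submodule.mem_span_singleton_self _)
      · exact Submodule.mem_sup_left (apply_mem_ran _ _)
    have hQR : ∀ v, Q z v ∈ ran (Q z + R z) := fun v => ⟨Q z v, by
      simp [hRa, h5]⟩
    have huR : u z ∈ ran (Q z + R z) := ⟨u z, by simp [hRa, h4, h6]⟩
    apply le_antisymm
    · rintro _ ⟨v, rfl⟩
      change Q z v + R z v ∈ _
      rw [hRa]
      exact Submodule.add_mem _ (Submodule.mem_sup_left (apply_mem_ran _ _))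
        (Submodule.smul_mem _ _ hu)
    · refine sup_le ?_ ?_
      · rintro _ ⟨v, rfl⟩
        exact hQR v
      · rw [Submodule.span_singleton_le_iff_mem]
        have : x z = Q z (x z) + (z - z₀) ^ k • u z := by rw [← h1]; abel
        rw [this]
        exact Submodule.add_mem _ (hQR _) (Submodule.smul_mem _ _ huR)

/-- Dual to `IdemAt.exists_sup`: the restricted functional `f ∘ Q` is divided by its power of `z -
z₀`, and the quotient `u` cuts out the same subspace of `ran Q` off `z₀` without vanishing at `z₀`.
-/
theorem IdemAt.exists_inf {Q : ℂ → Op n} {z₀ : ℂ} (hQ : IdemAt Q z₀) {f : ℂ → Cn n →L[ℂ] ℂ}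
    (hf : AnalyticAt ℂ f z₀) :
    ∃ Q', IdemAt Q' z₀ ∧
      ∀ᶠ z in 𝓝[≠] z₀, ∀ v, v ∈ ran (Q' z) ↔ v ∈ ran (Q z) ∧ f z v = 0 := by
  have hy : AnalyticAt ℂ (fun z => (f z).comp (Q z)) z₀ := hf.clm_comp hQ.an
  by_cases h0 : ∀ᶠ z in 𝓝 z₀, (f z).comp (Q z) = 0
  · refine ⟨Q, hQ, ?_⟩
    filter_upwards [eventually_nhdsWithin_of_eventually_nhds h0] with z hz v
    refine ⟨fun hv => ⟨hv, ?_⟩, fun hv => hv.1⟩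
    obtain ⟨w, rfl⟩ := hv
    exact congrArg (fun g : Cn n →L[ℂ] ℂ => g w) hz
  obtain ⟨k, u, hu, hu0, hxu⟩ := hy.exists_eventuallyEq_pow_smul_nonzero_iff.2 h0
  have hQu' : ∀ᶠ z in 𝓝[≠] z₀, (u z).comp (Q z) - u z = 0 := by
    filter_upwards [eventually_nhdsWithin_of_eventually_nhds hxu,
      eventually_nhdsWithin_of_eventually_nhds hQ.idem, self_mem_nhdsWithin] with z h1 h2 h3
    have h4 : (z - z₀) ^ k ≠ 0 := pow_ne_zero _ (sub_ne_zero.2 h3)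
    have h6 : (z - z₀) ^ k • ((u z).comp (Q z) - u z) = 0 := by
      rw [smul_sub, ← ContinuousLinearMap.smul_comp, ← h1, ContinuousLinearMap.comp_assoc]
      exact sub_eq_zero.2 (congrArg (f z).comp h2)
    exact (smul_eq_zero.1 h6).resolve_left h4
  have hQu : ∀ᶠ z in 𝓝 z₀, (u z).comp (Q z) - u z = 0 :=
    ((hu.clm_comp hQ.an).sub hu).frequently_zero_iff_eventually_zero.1 hQu'.frequently
  obtain ⟨e, he⟩ : ∃ e, u z₀ e ≠ 0 := by
    by_contra! h
    exact hu0 (ContinuousLinearMap.ext h)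
  have hue : AnalyticAt ℂ (fun z => u z e) z₀ := hu.clm_apply analyticAt_const
  -- The projection onto the line of `Q e` along the kernel of `u`. Since `u ∘ Q = u`, subtracting
  -- it from `Q` leaves a projection onto `ran Q ∩ ker u`.
  let R : ℂ → Op n := fun z =>
    (u z e)⁻¹ • (u z).smulRight (Q z e)
  have hR : AnalyticAt ℂ R z₀ := by
    exact (hue.inv he).smul (hu.clm_smulRight (hQ.an.clm_apply analyticAt_const))
  have hRa : ∀ z v, R z v = ((u z e)⁻¹ * u z v) • Q z e := by
    intro z v
    simp [R, mul_smul]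
  have key : ∀ z, Q z * Q z = Q z → (u z).comp (Q z) - u z = 0 → u z e ≠ 0 →
      (∀ v, Q z (Q z v) = Q z v) ∧ (∀ v, u z (Q z v) = u z v) ∧
      ∀ v, u z ((Q z - R z) v) = 0 := by
    intro z h1 h2 h3
    have h5 : ∀ v, Q z (Q z v) = Q z v := fun v => congrArg (fun B : Op n => B v) h1
    have h6 : ∀ v, u z (Q z v) = u z v := fun v =>
      congrArg (fun g : Cn n →L[ℂ] ℂ => g v) (sub_eq_zero.1 h2)
    refine ⟨h5, h6, fun v => ?_⟩
    simp only [sub_apply, map_sub, hRa, map_smul, h6, smul_eq_mul]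
    field_simp
    ring
  refine ⟨fun z => Q z - R z, ⟨hQ.an.sub hR, ?_⟩, ?_⟩
  · filter_upwards [hQ.idem, hQu, hue.continuousAt.eventually_ne he] with z h1 h2 h3
    obtain ⟨h5, h6, h7⟩ := key z h1 h2 h3
    ext1 v
    change Q z ((Q z - R z) v) - R z ((Q z - R z) v) = (Q z - R z) v
    rw [hRa z ((Q z - R z) v), h7]
    simp [hRa, h5]
  · filter_upwards [eventually_nhdsWithin_of_eventually_nhds hxu,
      eventually_nhdsWithin_of_eventually_nhds hQ.idem, self_mem_nhdsWithin,
      eventually_nhdsWithin_of_eventually_nhds hQu,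
      eventually_nhdsWithin_of_eventually_nhds (hue.continuousAt.eventually_ne he)]
      with z h1 h2 h3 h4 h8 v
    obtain ⟨h5, h6, h7⟩ := key z h2 h4 h8
    have h9 : (z - z₀) ^ k ≠ 0 := pow_ne_zero _ (sub_ne_zero.2 h3)
    have hfQ : ∀ v, f z (Q z v) = (z - z₀) ^ k * u z v := fun v =>
      congrArg (fun g : Cn n →L[ℂ] ℂ => g v) h1
    constructor
    · rintro ⟨w, rfl⟩
      have hm : Q z ((Q z - R z) w) = (Q z - R z) w := by simp [hRa, h5]
      refine ⟨⟨_, hm⟩, ?_⟩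
      change f z ((Q z - R z) w) = 0
      rw [← hm, hfQ, h7, mul_zero]
    · rintro ⟨⟨w, rfl⟩, hw⟩
      have : u z w = 0 := (mul_eq_zero.1 ((hfQ w).symm.trans hw)).resolve_left h9
      exact ⟨Q z w, by simp [hRa, h5, h6, this]⟩

end LocalTheory

/-! ### Holomorphic subbundles over open subsets of ℂ -/

section LocalBundles

variable {n : ℕ} {z₀ : ℂ}

theorem eventually_punctured_of_punctured {X : Type*} [TopologicalSpace X] [T1Space X] {a : X}
    {P : X → Prop} (h : ∀ᶠ x in 𝓝[≠] a, P x) : ∀ᶠ y in 𝓝 a, ∀ᶠ x in 𝓝[≠] y, P x := by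
  have h1 := eventually_nhdsNE_eventually_nhds_iff.2 h
  rw [eventually_nhdsWithin_iff] at h1
  filter_upwards [h1] with y hy
  by_cases hya : y = a
  · exact hya ▸ h
  · exact eventually_nhdsWithin_of_eventually_nhds (hy hya)

theorem holNear_iff_analyticAt {s : ℂ → Cn n} : HolNear s z₀ ↔ AnalyticAt ℂ s z₀ := by
  rw [Complex.analyticAt_iff_eventually_differentiableAt]
  exact eventually_congr (Eventually.of_forall fun z => mdifferentiableAt_iff_differentiableAt)

theorem zDeriv_eq_iteratedDeriv (l : ℕ) (s : ℂ → Cn n) (z : ℂ) :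
    zDeriv l s z = iteratedDeriv l s z := by
  simp only [zDeriv, chartAt_self_eq]
  rfl

theorem IdemAt.eventually {Q : ℂ → Op n} (hQ : IdemAt Q z₀) : ∀ᶠ z in 𝓝 z₀, IdemAt Q z := by
  filter_upwards [hQ.an.eventually_analyticAt, hQ.idem.eventually_nhds] with z h1 h2 using ⟨h1, h2⟩

theorem IdemAt.mem_iff {Q : ℂ → Op n} (hQ : IdemAt Q z₀) {v : Cn n} :
    v ∈ ran (Q z₀) ↔ Q z₀ v = v :=
  mem_ran_of_idem hQ.idem.self_of_nhds

theorem IdemAt.apply_apply {Q : ℂ → Op n} (hQ : IdemAt Q z₀) (v : Cn n) :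
    Q z₀ (Q z₀ v) = Q z₀ v :=
  hQ.mem_iff.1 (apply_mem_ran _ _)

/-- The identity theorem for `Q s - s`; membership at points accumulating at `z₀` is enough. -/
theorem IdemAt.mem_of_punctured {Q : ℂ → Op n} (hQ : IdemAt Q z₀) {s : ℂ → Cn n}
    (hs : AnalyticAt ℂ s z₀) (h : ∃ᶠ z in 𝓝[≠] z₀, s z ∈ ran (Q z)) :
    ∀ᶠ z in 𝓝 z₀, s z ∈ ran (Q z) := by
  have hf : AnalyticAt ℂ (fun z => Q z (s z) - s z) z₀ := (hQ.an.clm_apply hs).sub hs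
  have h0 : ∃ᶠ z in 𝓝[≠] z₀, Q z (s z) - s z = 0 := by
    refine (h.and_eventually (eventually_nhdsWithin_of_eventually_nhds hQ.eventually)).mono ?_
    rintro z ⟨h1, h2⟩
    exact sub_eq_zero.2 (h2.mem_iff.1 h1)
  filter_upwards [hf.frequently_zero_iff_eventually_zero.1 h0, hQ.eventually] with z h1 h2
  exact h2.mem_iff.2 (sub_eq_zero.1 h1)

theorem finrank_ran_eq_trace {A : Op n} (h : A * A = A) :
    LinearMap.trace ℂ (Cn n) (A : Cn n →ₗ[ℂ] Cn n) = (Module.finrank ℂ (ran A) : ℂ) := by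
  refine LinearMap.IsProj.trace (p := ran A) ⟨fun x => apply_mem_ran A x, fun x hx => ?_⟩
  exact (mem_ran_of_idem h).1 hx

/-- The rank of an idempotent is its trace, which is continuous and takes integer values. -/
theorem IdemAt.finrank_eq {Q : ℂ → Op n} (hQ : IdemAt Q z₀) :
    ∀ᶠ z in 𝓝 z₀, Module.finrank ℂ (ran (Q z)) = Module.finrank ℂ (ran (Q z₀)) := by
  let tr : Op n →ₗ[ℂ] ℂ :=
    LinearMap.trace ℂ (Cn n) ∘ₗ (ContinuousLinearMap.coeLM ℂ : Op n →ₗ[ℂ] Cn n →ₗ[ℂ] Cn n)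
  have htr : Continuous tr := tr.continuous_of_finiteDimensional
  have h1 : ContinuousAt (fun z => tr (Q z)) z₀ := htr.continuousAt.comp hQ.an.continuousAt
  have h2 := Metric.continuousAt_iff'.1 h1 1 one_pos
  filter_upwards [h2, hQ.idem] with z h3 h4
  have e1 : tr (Q z) = (Module.finrank ℂ (ran (Q z)) : ℂ) := finrank_ran_eq_trace h4
  have e2 : tr (Q z₀) = (Module.finrank ℂ (ran (Q z₀)) : ℂ) :=
    finrank_ran_eq_trace hQ.idem.self_of_nhds
  rw [e1, e2, dist_eq_norm] at h3
  have h5 : ((Module.finrank ℂ (ran (Q z)) : ℂ) - (Module.finrank ℂ (ran (Q z₀)) : ℂ)) =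
    (((Module.finrank ℂ (ran (Q z)) : ℤ) - (Module.finrank ℂ (ran (Q z₀)) : ℤ) : ℤ) : ℂ) := by
    push_cast; rfl
  rw [h5, Complex.norm_intCast] at h3
  have h6 : |(Module.finrank ℂ (ran (Q z)) : ℤ) - (Module.finrank ℂ (ran (Q z₀)) : ℤ)| < 1 := by
    exact_mod_cast h3
  rw [Int.abs_lt_one_iff] at h6
  omega

/-- This justifies the definition of `fill`: the filled fibre does not depend on the choice of the
extension `Q`. -/
theorem IdemAt.fill_eq {Q : ℂ → Op n} (hQ : IdemAt Q z₀) {S : Fam n ℂ}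
    (h : ∀ᶠ z in 𝓝[≠] z₀, ran (Q z) = S z) : fill S z₀ = ran (Q z₀) := by
  apply le_antisymm
  · refine Submodule.span_le.2 ?_
    rintro _ ⟨t, ht, htS, rfl⟩
    refine (hQ.mem_of_punctured (holNear_iff_analyticAt.1 ht) ?_).self_of_nhds
    exact ((htS.and h).mono fun z hz => hz.2 ▸ hz.1).frequently
  · rintro _ ⟨v, rfl⟩
    refine Submodule.subset_span ⟨fun z => Q z v,
      holNear_iff_analyticAt.2 (hQ.an.clm_apply analyticAt_const), ?_, rfl⟩
    filter_upwards [h] with z hz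
    exact hz ▸ apply_mem_ran _ _

theorem IdemAt.eventually_fill_eq {Q : ℂ → Op n} (hQ : IdemAt Q z₀) {S : Fam n ℂ}
    (h : ∀ᶠ z in 𝓝[≠] z₀, ran (Q z) = S z) : ∀ᶠ z in 𝓝 z₀, fill S z = ran (Q z) := by
  filter_upwards [hQ.eventually, eventually_punctured_of_punctured h] with z h1 h2
  exact h1.fill_eq h2

theorem GenHolAt.holAt_fill {S : Fam n ℂ} (h : GenHolAt S z₀) : HolAt (fill S) z₀ := by
  obtain ⟨Q, hQ, hS⟩ := h
  exact ⟨Q, hQ, (hQ.eventually_fill_eq hS).mono fun _ h => h.symm⟩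

theorem GenHolAt.fill_eq {S : Fam n ℂ} (h : GenHolAt S z₀) :
    ∀ᶠ z in 𝓝[≠] z₀, fill S z = S z := by
  obtain ⟨Q, hQ, hS⟩ := h
  filter_upwards [hS, eventually_nhdsWithin_of_eventually_nhds (hQ.eventually_fill_eq hS)]
    with z h1 h2
  rw [h2, h1]

theorem HolAt.genHolAt {S : Fam n ℂ} (h : HolAt S z₀) : GenHolAt S z₀ := by
  obtain ⟨Q, hQ, hS⟩ := h
  exact ⟨Q, hQ, eventually_nhdsWithin_of_eventually_nhds hS⟩

theorem HolAt.fill_eq {S : Fam n ℂ} (h : HolAt S z₀) : fill S z₀ = S z₀ := by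
  obtain ⟨Q, hQ, hS⟩ := h
  rw [hQ.fill_eq (eventually_nhdsWithin_of_eventually_nhds hS), hS.self_of_nhds]

theorem GenHolAt.congr {S S' : Fam n ℂ} (h : GenHolAt S z₀)
    (hS : ∀ᶠ z in 𝓝[≠] z₀, S z = S' z) : GenHolAt S' z₀ := by
  obtain ⟨Q, hQ, hS'⟩ := h
  exact ⟨Q, hQ, (hS'.and hS).mono fun z hz => hz.1.trans hz.2⟩

theorem GenHolAt.sup_span {S : Fam n ℂ} (h : GenHolAt S z₀) {ι : Type*} [Finite ι]
    {x : ι → ℂ → Cn n} (hx : ∀ i, AnalyticAt ℂ (x i) z₀) :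
    GenHolAt (fun z => S z ⊔ Submodule.span ℂ (Set.range fun i => x i z)) z₀ := by
  classical
  have := Fintype.ofFinite ι
  have key : ∀ t : Finset ι,
      GenHolAt (fun z => S z ⊔ Submodule.span ℂ ((fun i => x i z) '' (t : Set ι))) z₀ := by
    intro t
    induction t using Finset.induction_on with
    | empty => simpa using h
    | insert a t _ ih =>
      obtain ⟨Q, hQ, hS⟩ := ih
      obtain ⟨Q', hQ', hS'⟩ := hQ.exists_sup (hx a)
      refine ⟨Q', hQ', ?_⟩
      filter_upwards [hS, hS'] with z h1 h2
      rw [h2, h1, sup_assoc, ← Submodule.span_union, Finset.coe_insert, Set.image_insert_eq,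
        Set.union_comm, Set.singleton_union]
  simpa using key Finset.univ

theorem genHolAt_bot : GenHolAt (⊥ : Fam n ℂ) z₀ := by
  refine ⟨0, ⟨analyticAt_const, by simp⟩, ?_⟩
  refine Eventually.of_forall fun z => ?_
  rw [eq_comm, Pi.bot_apply, eq_comm, eq_bot_iff]
  rintro _ ⟨v, rfl⟩
  simp

theorem genHolAt_span {ι : Type*} [Finite ι] {x : ι → ℂ → Cn n}
    (hx : ∀ i, AnalyticAt ℂ (x i) z₀) :
    GenHolAt (fun z => Submodule.span ℂ (Set.range fun i => x i z)) z₀ := by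
  simpa using genHolAt_bot.sup_span hx

theorem GenHolAt.inf_ker {S : Fam n ℂ} (h : GenHolAt S z₀) {A : ℂ → Op n}
    (hA : AnalyticAt ℂ A z₀) :
    GenHolAt (fun z => S z ⊓ LinearMap.ker (A z : Cn n →ₗ[ℂ] Cn n)) z₀ := by
  classical
  have key : ∀ t : Finset (Fin n), ∃ Q, IdemAt Q z₀ ∧ ∀ᶠ z in 𝓝[≠] z₀, ∀ v,
      v ∈ ran (Q z) ↔ v ∈ S z ∧ ∀ j ∈ t, A z v j = 0 := by
    intro t
    induction t using Finset.induction_on with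
    | empty =>
      obtain ⟨Q, hQ, hS⟩ := h
      exact ⟨Q, hQ, hS.mono fun z hz v => by simp [hz]⟩
    | insert a t _ ih =>
      obtain ⟨Q, hQ, hS⟩ := ih
      obtain ⟨Q', hQ', hS'⟩ := hQ.exists_inf (f := fun z => (EuclideanSpace.proj a).comp (A z))
        (analyticAt_const.clm_comp hA)
      refine ⟨Q', hQ', ?_⟩
      filter_upwards [hS, hS'] with z h1 h2 v
      rw [h2, h1]
      have : ((EuclideanSpace.proj a : Cn n →L[ℂ] ℂ).comp (A z)) v = A z v a := rfl
      rw [this, Finset.forall_mem_insert]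
      tauto
  obtain ⟨Q, hQ, hS⟩ := key Finset.univ
  refine ⟨Q, hQ, hS.mono fun z hz => ?_⟩
  ext v
  rw [hz v, Submodule.mem_inf, LinearMap.mem_ker]
  refine and_congr_right fun _ => ⟨fun hv => ?_, fun hv j _ => ?_⟩
  · ext j
    exact hv j (Finset.mem_univ j)
  · exact congrArg (fun w : Cn n => w j) hv

theorem HolAt.eventually {S : Fam n ℂ} (h : HolAt S z₀) : ∀ᶠ z in 𝓝 z₀, HolAt S z := by
  obtain ⟨Q, hQ, hS⟩ := h
  filter_upwards [hQ.eventually, hS.eventually_nhds] with z h1 h2 using ⟨Q, h1, h2⟩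

theorem HolAt.mem_of_punctured {S : Fam n ℂ} (h : HolAt S z₀) {s : ℂ → Cn n}
    (hs : AnalyticAt ℂ s z₀) (hsS : ∃ᶠ z in 𝓝[≠] z₀, s z ∈ S z) : ∀ᶠ z in 𝓝 z₀, s z ∈ S z := by
  obtain ⟨Q, hQ, hS⟩ := h
  have := hQ.mem_of_punctured hs
    ((hsS.and_eventually (eventually_nhdsWithin_of_eventually_nhds hS)).mono
      fun z hz => hz.2 ▸ hz.1)
  filter_upwards [this, hS] with z h1 h2 using h2 ▸ h1

theorem HolAt.exists_section {S : Fam n ℂ} (h : HolAt S z₀) {v : Cn n} (hv : v ∈ S z₀) :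
    ∃ s : ℂ → Cn n, AnalyticAt ℂ s z₀ ∧ (∀ᶠ z in 𝓝 z₀, s z ∈ S z) ∧ s z₀ = v := by
  obtain ⟨Q, hQ, hS⟩ := h
  refine ⟨fun z => Q z v, hQ.an.clm_apply analyticAt_const, ?_, ?_⟩
  · filter_upwards [hS] with z hz using hz ▸ apply_mem_ran _ _
  · exact hQ.mem_iff.1 (hS.self_of_nhds.symm ▸ hv)

theorem HolAt.finrank_eq {S : Fam n ℂ} (h : HolAt S z₀) :
    ∀ᶠ z in 𝓝 z₀, Module.finrank ℂ (S z) = Module.finrank ℂ (S z₀) := by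
  obtain ⟨Q, hQ, hS⟩ := h
  filter_upwards [hQ.finrank_eq, hS] with z h1 h2
  rw [← h2, h1, hS.self_of_nhds]

/-- A family is the range of an analytic family of idempotents if and only if it has an
analytic frame. -/
theorem holAt_iff_exists_frame {S : Fam n ℂ} {d : ℕ} :
    HolAt S z₀ ∧ Module.finrank ℂ (S z₀) = d ↔
      ∃ s : Fin d → ℂ → Cn n, (∀ j, AnalyticAt ℂ (s j) z₀) ∧
        ∀ᶠ z in 𝓝 z₀, LinearIndependent ℂ (fun j => s j z) ∧
          Submodule.span ℂ (Set.range fun j => s j z) = S z := by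
  constructor
  · rintro ⟨⟨Q, hQ, hS⟩, hd⟩
    let b := Module.finBasisOfFinrankEq ℂ (S z₀) hd
    have han : ∀ j, AnalyticAt ℂ (fun z => Q z (b j)) z₀ := fun j =>
      hQ.an.clm_apply analyticAt_const
    have h0 : (fun j => Q z₀ (b j)) = fun j => ((b j : S z₀) : Cn n) := by
      funext j
      exact hQ.mem_iff.1 (hS.self_of_nhds.symm ▸ (b j).2)
    have hli : LinearIndependent ℂ (fun j => Q z₀ (b j)) := by
      rw [h0]
      exact b.linearIndependent.map' (S z₀).subtype (Submodule.ker_subtype _)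
    have hcont : ContinuousAt (fun z => fun j => Q z (b j)) z₀ :=
      continuousAt_pi.2 fun j => (han j).continuousAt
    have hev := hcont.eventually (isOpen_setOfPred_linearIndependent.mem_nhds hli)
    refine ⟨fun j z => Q z (b j), han, ?_⟩
    have hHol : HolAt S z₀ := ⟨Q, hQ, hS⟩
    filter_upwards [hev, hS, hHol.finrank_eq] with z h1 h2 h3
    refine ⟨h1, Submodule.eq_of_le_of_finrank_eq ?_ ?_⟩
    · rw [Submodule.span_le]
      rintro _ ⟨j, rfl⟩
      exact h2 ▸ apply_mem_ran _ _
    · rw [finrank_span_eq_card h1, h3, hd, Fintype.card_fin]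
  · rintro ⟨s, hs, hS⟩
    obtain ⟨Q, hQ, hQs⟩ := genHolAt_span hs
    have hd : ∀ᶠ z in 𝓝 z₀, Module.finrank ℂ (S z) = d := by
      filter_upwards [hS] with z hz
      rw [← hz.2, finrank_span_eq_card hz.1, Fintype.card_fin]
    have hle : ∀ᶠ z in 𝓝 z₀, ∀ j, s j z ∈ ran (Q z) := by
      refine eventually_all.2 fun j => hQ.mem_of_punctured (hs j) (Eventually.frequently ?_)
      filter_upwards [hQs] with z hz
      rw [hz]
      exact Submodule.subset_span ⟨j, rfl⟩
    -- The rank of `ran (Q z)` is locally constant and equals `d` off `z₀`. Hence the inclusion of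
    -- the span of the frame in it is an equality at `z₀` as well.
    have hr : Module.finrank ℂ (ran (Q z₀)) = d := by
      obtain ⟨z, h1, h2, h3, h4⟩ := ((eventually_nhdsWithin_of_eventually_nhds hQ.finrank_eq).and
        (hQs.and (eventually_nhdsWithin_of_eventually_nhds (hS.and hd)))).exists
      rw [← h1, h2]
      exact (congrArg (fun W : Submodule ℂ (Cn n) => Module.finrank ℂ W) h3.2).trans h4
    refine ⟨⟨Q, hQ, ?_⟩, hd.self_of_nhds⟩
    filter_upwards [hle, hS, hd, hQ.finrank_eq] with z h1 h2 h3 h4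
    refine (Submodule.eq_of_le_of_finrank_eq ?_ ?_).symm
    · rw [← h2.2, Submodule.span_le]
      rintro _ ⟨j, rfl⟩
      exact h1 j
    · rw [h3, h4, hr]

end LocalBundles

/-! ### Derivatives of sections: osculating bundles in one coordinate -/

section LocalDerivatives

variable {n : ℕ} {z₀ : ℂ}

theorem isHolSectionNear_iff {E : Fam n ℂ} {s : ℂ → Cn n} :
    IsHolSectionNear E s z₀ ↔ AnalyticAt ℂ s z₀ ∧ ∀ᶠ z in 𝓝 z₀, s z ∈ E z :=
  and_congr holNear_iff_analyticAt Iff.rfl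

theorem analyticAt_iteratedDeriv {s : ℂ → Cn n} (hs : AnalyticAt ℂ s z₀) (l : ℕ) :
    AnalyticAt ℂ (iteratedDeriv l s) z₀ := by
  rw [iteratedDeriv_eq_iterate]
  exact hs.iterated_deriv l

/-- The product rule applied to `s = Q s`. Thus `Q'` measures, modulo the bundle, the failure of
derivatives of sections to be sections. -/
theorem IdemAt.deriv_section {Q : ℂ → Op n} (hQ : IdemAt Q z₀) {s : ℂ → Cn n}
    (hs : AnalyticAt ℂ s z₀) (h : ∀ᶠ z in 𝓝 z₀, s z ∈ ran (Q z)) :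
    deriv s z₀ = deriv Q z₀ (s z₀) + Q z₀ (deriv s z₀) := by
  have h1 : s =ᶠ[𝓝 z₀] fun z => Q z (s z) := by
    filter_upwards [h, hQ.eventually] with z h1 h2 using (h2.mem_iff.1 h1).symm
  refine h1.deriv_eq.trans ?_
  have := hQ.an.differentiableAt.hasDerivAt.clm_apply hs.differentiableAt.hasDerivAt
  exact this.deriv

theorem IdemAt.apply_deriv_apply {Q : ℂ → Op n} (hQ : IdemAt Q z₀) (v : Cn n) :
    Q z₀ (deriv Q z₀ (Q z₀ v)) = 0 := by
  have han : AnalyticAt ℂ (fun z => Q z v) z₀ := hQ.an.clm_apply analyticAt_const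
  have h := hQ.deriv_section han (Eventually.of_forall fun z => apply_mem_ran _ _)
  have h2 := congrArg (Q z₀) h
  rw [map_add, hQ.apply_apply] at h2
  simpa using h2

theorem zDeriv_mem_derivSpan {E : Fam n ℂ} {s : ℂ → Cn n} (hs : AnalyticAt ℂ s z₀)
    (hsE : ∀ᶠ z in 𝓝 z₀, s z ∈ E z) {l i : ℕ} (hl : l ≤ i) :
    iteratedDeriv l s z₀ ∈ derivSpan E i z₀ :=
  Submodule.subset_span ⟨s, isHolSectionNear_iff.2 ⟨hs, hsE⟩, l, hl,
    (zDeriv_eq_iteratedDeriv _ _ _).symm⟩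

theorem derivSpan_le_iff {E : Fam n ℂ} {i : ℕ} {W : Submodule ℂ (Cn n)} :
    derivSpan E i z₀ ≤ W ↔ ∀ s, AnalyticAt ℂ s z₀ → (∀ᶠ z in 𝓝 z₀, s z ∈ E z) → ∀ l ≤ i,
      iteratedDeriv l s z₀ ∈ W := by
  constructor
  · exact fun h s hs hsE l hl => h (zDeriv_mem_derivSpan hs hsE hl)
  · intro h
    refine Submodule.span_le.2 ?_
    rintro _ ⟨s, hs, l, hl, rfl⟩
    rw [isHolSectionNear_iff] at hs
    rw [zDeriv_eq_iteratedDeriv]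
    exact h s hs.1 hs.2 l hl

theorem derivKer_le_iff {E : Fam n ℂ} {i : ℕ} {W : Submodule ℂ (Cn n)} :
    derivKer E i z₀ ≤ W ↔ ∀ s, AnalyticAt ℂ s z₀ →
      (∀ᶠ z in 𝓝 z₀, ∀ l ≤ i, iteratedDeriv l s z ∈ E z) → s z₀ ∈ W := by
  constructor
  · intro h s hs hsE
    refine h (Submodule.subset_span ⟨s, isHolSectionNear_iff.2 ⟨hs, ?_⟩, ?_, rfl⟩)
    · filter_upwards [hsE] with z hz using by simpa using hz 0 (Nat.zero_le _)
    · simpa only [zDeriv_eq_iteratedDeriv] using hsE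
  · intro h
    refine Submodule.span_le.2 ?_
    rintro _ ⟨s, hs, hs', rfl⟩
    rw [isHolSectionNear_iff] at hs
    simp only [zDeriv_eq_iteratedDeriv] at hs'
    exact h s hs.1 hs'

theorem mem_derivKer {E : Fam n ℂ} {i : ℕ} {s : ℂ → Cn n} (hs : AnalyticAt ℂ s z₀)
    (hsE : ∀ᶠ z in 𝓝 z₀, ∀ l ≤ i, iteratedDeriv l s z ∈ E z) : s z₀ ∈ derivKer E i z₀ :=
  derivKer_le_iff.1 le_rfl s hs hsE

theorem mem_derivKer_one {E : Fam n ℂ} {s : ℂ → Cn n} (hs : AnalyticAt ℂ s z₀)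
    (hsE : ∀ᶠ z in 𝓝 z₀, s z ∈ E z) (hsE' : ∀ᶠ z in 𝓝 z₀, deriv s z ∈ E z) :
    s z₀ ∈ derivKer E 1 z₀ := by
  refine mem_derivKer hs ?_
  filter_upwards [hsE, hsE'] with z h1 h2 l hl
  interval_cases l
  · simpa using h1
  · simpa using h2

theorem derivKer_le (E : Fam n ℂ) (i : ℕ) (z : ℂ) : derivKer E i z ≤ E z :=
  derivKer_le_iff.2 fun s _ h => by simpa using h.self_of_nhds 0 (Nat.zero_le _)

theorem derivSpan_le_fill (E : Fam n ℂ) (i : ℕ) (z : ℂ) :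
    derivSpan E i z ≤ fill (derivSpan E i) z := by
  refine derivSpan_le_iff.2 fun s hs hsE l hl => ?_
  refine Submodule.subset_span ⟨iteratedDeriv l s,
    holNear_iff_analyticAt.2 (analyticAt_iteratedDeriv hs l), ?_, rfl⟩
  refine eventually_nhdsWithin_of_eventually_nhds ?_
  filter_upwards [hs.eventually_analyticAt, hsE.eventually_nhds] with w h1 h2
  exact zDeriv_mem_derivSpan h1 h2 hl

theorem HolAt.derivSpan_zero {E : Fam n ℂ} (hE : HolAt E z₀) : derivSpan E 0 z₀ = E z₀ := by
  apply le_antisymm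
  · refine derivSpan_le_iff.2 fun s hs hsE l hl => ?_
    obtain rfl := Nat.le_zero.1 hl
    simpa using hsE.self_of_nhds
  · intro v hv
    obtain ⟨s, hs, hsE, rfl⟩ := hE.exists_section hv
    simpa using zDeriv_mem_derivSpan hs hsE le_rfl (l := 0) (i := 0)

theorem HolAt.derivKer_zero {E : Fam n ℂ} (hE : HolAt E z₀) : derivKer E 0 z₀ = E z₀ := by
  refine le_antisymm (derivKer_le _ _ _) fun v hv => ?_
  obtain ⟨s, hs, hsE, rfl⟩ := hE.exists_section hv
  refine mem_derivKer hs (hsE.mono fun z hz l hl => ?_)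
  obtain rfl := Nat.le_zero.1 hl
  simpa using hz

/-- Finitely many sections suffice: a section is a combination, with analytic coefficients, of the
images `Q eⱼ` of the standard basis, and by the Leibniz rule its derivatives lie in the span of
theirs. -/
theorem HolAt.genHolAt_derivSpan {E : Fam n ℂ} (hE : HolAt E z₀) (i : ℕ) :
    GenHolAt (derivSpan E i) z₀ := by
  obtain ⟨Q, hQ, hQE⟩ := hE
  let e : Fin n → Cn n := fun j => EuclideanSpace.single j 1
  have han : ∀ {z}, IdemAt Q z → ∀ j, AnalyticAt ℂ (fun w => Q w (e j)) z := fun h j =>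
    h.an.clm_apply analyticAt_const
  refine (genHolAt_span (ι := Fin (i + 1) × Fin n)
    (x := fun a z => iteratedDeriv a.1 (fun w => Q w (e a.2)) z)
    fun a => analyticAt_iteratedDeriv (han hQ _) _).congr ?_
  refine eventually_nhdsWithin_of_eventually_nhds ?_
  filter_upwards [hQ.eventually, hQE.eventually_nhds] with z h1 h2
  apply le_antisymm
  · rw [Submodule.span_le]
    rintro _ ⟨⟨m, j⟩, rfl⟩
    refine zDeriv_mem_derivSpan (han h1 j) ?_ (Nat.lt_succ_iff.1 m.2)
    filter_upwards [h2] with w hw using hw ▸ apply_mem_ran _ _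
  · refine derivSpan_le_iff.2 fun s hs hsE l hl => ?_
    have h3 : s =ᶠ[𝓝 z] fun w => ∑ j, ((fun w => s w j) • fun w => Q w (e j)) w := by
      filter_upwards [hsE, h2, h1.eventually] with w h3 h4 h5
      rw [← h4, h5.mem_iff] at h3
      have h6 : s w = ∑ j, s w j • e j := by
        simpa [e] using ((EuclideanSpace.basisFun (Fin n) ℂ).sum_repr (s w)).symm
      rw [← h3]
      conv_lhs => rw [h6]
      simp only [map_sum, map_smul, Pi.smul_apply']
    have hsj : ∀ j, AnalyticAt ℂ (fun w => s w j) z := fun j =>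
      (EuclideanSpace.proj j : Cn n →L[ℂ] ℂ).comp_analyticAt hs
    rw [h3.iteratedDeriv_eq, iteratedDeriv_fun_sum fun j _ =>
      ((hsj j).smul (han h1 j)).contDiffAt]
    refine Submodule.sum_mem _ fun j _ => ?_
    have h4 := iteratedDerivWithin_smul (n := l) (Set.mem_univ z) uniqueDiffOn_univ
      (hsj j).contDiffAt.contDiffWithinAt (han h1 j).contDiffAt.contDiffWithinAt
    simp only [iteratedDerivWithin_univ] at h4
    rw [h4]
    refine Submodule.sum_mem _ fun k hk => ?_
    refine Submodule.smul_of_tower_mem _ _ (Submodule.smul_mem _ _ (Submodule.subset_span ?_))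
    exact ⟨(⟨l - k, by omega⟩, j), rfl⟩

theorem IdemAt.derivKer_one_le {Q : ℂ → Op n} (hQ : IdemAt Q z₀) {E : Fam n ℂ}
    (hE : ∀ᶠ z in 𝓝 z₀, ran (Q z) = E z) {v : Cn n} (hv : v ∈ derivKer E 1 z₀) :
    v ∈ E z₀ ∧ deriv Q z₀ v = 0 := by
  have : derivKer E 1 z₀ ≤ E z₀ ⊓ LinearMap.ker (deriv Q z₀).toLinearMap := by
    refine derivKer_le_iff.2 fun s hs hsE => ?_
    have h0 : ∀ᶠ z in 𝓝 z₀, s z ∈ E z :=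
      hsE.mono fun z hz => by simpa using hz 0 (Nat.zero_le _)
    have h1 : deriv s z₀ ∈ E z₀ := by simpa using hsE.self_of_nhds 1 le_rfl
    refine ⟨h0.self_of_nhds, ?_⟩
    have h2 := hQ.deriv_section hs ((h0.and hE).mono fun z hz => hz.2 ▸ hz.1)
    rw [← hE.self_of_nhds, hQ.mem_iff] at h1
    rw [h1] at h2
    simpa using h2
  exact this hv

/-- By `s' = Q's + Qs'`, a section has its derivative in the bundle exactly when `Q's = 0`. The
family `R` fills the holes of `E ∩ ker Q'`; the kernel may jump on a discrete set, hence the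
equality only off `z₀`. -/
theorem IdemAt.derivKer_one {Q : ℂ → Op n} (hQ : IdemAt Q z₀) {E : Fam n ℂ}
    (hE : ∀ᶠ z in 𝓝 z₀, ran (Q z) = E z) :
    HolAt (derivKer E 1) z₀ ∧ ∀ᶠ z in 𝓝[≠] z₀,
      derivKer E 1 z = E z ⊓ LinearMap.ker (deriv Q z).toLinearMap := by
  have hE0 : HolAt E z₀ := ⟨Q, hQ, hE⟩
  obtain ⟨R, hR, hRS⟩ := hE0.genHolAt.inf_ker hQ.an.deriv
  have key : ∀ {z}, IdemAt R z → IdemAt Q z → (∀ᶠ w in 𝓝 z, ran (Q w) = E w) →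
      (∀ᶠ w in 𝓝[≠] z, ran (R w) = E w ⊓ LinearMap.ker (deriv Q w).toLinearMap) →
      ran (R z) = derivKer E 1 z := by
    intro z hR hQ hE hRS
    have hHol : HolAt E z := ⟨Q, hQ, hE⟩
    apply le_antisymm
    · rintro _ ⟨v, rfl⟩
      have hs : AnalyticAt ℂ (fun w => R w v) z := hR.an.clm_apply analyticAt_const
      have h1 : ∀ᶠ w in 𝓝 z, R w v ∈ E w := by
        refine hHol.mem_of_punctured hs (Eventually.frequently ?_)
        filter_upwards [hRS] with w hw
        exact (hw ▸ apply_mem_ran (R w) v : R w v ∈ E w ⊓ _).1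
      have h2 : ∀ᶠ w in 𝓝 z, deriv Q w (R w v) = 0 := by
        refine (hQ.an.deriv.clm_apply hs).frequently_zero_iff_eventually_zero.1
          (Eventually.frequently ?_)
        filter_upwards [hRS] with w hw
        exact (hw ▸ apply_mem_ran (R w) v : R w v ∈ E w ⊓ _).2
      refine mem_derivKer_one hs h1 ?_
      filter_upwards [h1.eventually_nhds, h2, hQ.eventually, hE.eventually_nhds,
        hs.eventually_analyticAt] with w h3 h4 h5 h6 h7
      have h8 := h5.deriv_section h7 ((h3.and h6).mono fun z hz => hz.2 ▸ hz.1)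
      rw [h4, zero_add] at h8
      rw [← h6.self_of_nhds, h8]
      exact apply_mem_ran _ _
    · refine derivKer_le_iff.2 fun s hs hsE => ?_
      refine (hR.mem_of_punctured hs (Eventually.frequently ?_)).self_of_nhds
      filter_upwards [hRS, eventually_nhdsWithin_of_eventually_nhds (hsE.eventually_nhds.and
        (hs.eventually_analyticAt.and (hQ.eventually.and hE.eventually_nhds)))] with w h1 h2
      rw [h1]
      exact h2.2.2.1.derivKer_one_le h2.2.2.2 (mem_derivKer h2.2.1 h2.1)
  have hev : ∀ᶠ z in 𝓝 z₀, ran (R z) = derivKer E 1 z := by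
    filter_upwards [hR.eventually, hQ.eventually, hE.eventually_nhds,
      eventually_punctured_of_punctured hRS] with z h1 h2 h3 h4 using key h1 h2 h3 h4
  refine ⟨⟨R, hR, hev⟩, ?_⟩
  filter_upwards [eventually_nhdsWithin_of_eventually_nhds hev, hRS] with z h1 h2
  rw [← h1, h2]

theorem HolAt.derivKer_one {E : Fam n ℂ} (hE : HolAt E z₀) : HolAt (derivKer E 1) z₀ := by
  obtain ⟨Q, hQ, hQE⟩ := hE
  exact (hQ.derivKer_one hQE).1

theorem HolAt.deriv_mem {E : Fam n ℂ} (hE : HolAt E z₀) {s : ℂ → Cn n}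
    (hs : AnalyticAt ℂ s z₀) (hsE : ∀ᶠ z in 𝓝 z₀, s z ∈ derivKer E 1 z) :
    deriv s z₀ ∈ E z₀ := by
  obtain ⟨Q, hQ, hQE⟩ := hE
  have h2 := hQ.deriv_section hs
    ((hsE.and hQE).mono fun z hz => hz.2 ▸ derivKer_le E 1 z hz.1)
  rw [(hQ.derivKer_one_le hQE hsE.self_of_nhds).2, zero_add] at h2
  rw [← hQE.self_of_nhds, h2]
  exact apply_mem_ran _ _

theorem HolAt.congr {S S' : Fam n ℂ} (h : HolAt S z₀) (hS : ∀ᶠ z in 𝓝 z₀, S z = S' z) :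
    HolAt S' z₀ := by
  obtain ⟨Q, hQ, hS'⟩ := h
  exact ⟨Q, hQ, (hS'.and hS).mono fun z hz => hz.1.trans hz.2⟩

/-- The three claims support each other in the induction on `i`. The middle one says that every
section of `E⁽⁻ⁱ⁾`, not only a generating one, has its derivatives up to order `i` in `E`, which is
what identifies `E⁽⁻ⁱ⁻¹⁾` with `(E⁽⁻ⁱ⁾)⁽⁻¹⁾`. The point varies because the identities are needed on
neighbourhoods. -/
theorem HolAt.derivKer_aux {E : Fam n ℂ} (i : ℕ) : ∀ {z₀}, HolAt E z₀ →
    HolAt (derivKer E i) z₀ ∧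
    (∀ s, AnalyticAt ℂ s z₀ → (∀ᶠ z in 𝓝 z₀, s z ∈ derivKer E i z) →
      ∀ l ≤ i, iteratedDeriv l s z₀ ∈ E z₀) ∧
    derivKer E (i + 1) z₀ = derivKer (derivKer E i) 1 z₀ := by
  have step : ∀ i, (∀ {z₀}, HolAt E z₀ → ∀ s, AnalyticAt ℂ s z₀ →
        (∀ᶠ z in 𝓝 z₀, s z ∈ derivKer E i z) → ∀ l ≤ i, iteratedDeriv l s z₀ ∈ E z₀) →
      ∀ {z₀}, HolAt E z₀ → derivKer E (i + 1) z₀ = derivKer (derivKer E i) 1 z₀ := by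
    intro i ih z₀ hE
    apply le_antisymm
    · refine derivKer_le_iff.2 fun s hs hsE => mem_derivKer_one hs ?_ ?_
      · filter_upwards [hs.eventually_analyticAt, hsE.eventually_nhds] with z h1 h2
        exact mem_derivKer h1 (h2.mono fun w hw l hl => hw l (by omega))
      · filter_upwards [hs.eventually_analyticAt, hsE.eventually_nhds] with z h1 h2
        refine mem_derivKer h1.deriv (h2.mono fun w hw l hl => ?_)
        rw [← iteratedDeriv_succ']
        exact hw _ (by omega)
    · refine derivKer_le_iff.2 fun s hs hsE => mem_derivKer hs ?_
      filter_upwards [hs.eventually_analyticAt, hsE.eventually_nhds, hE.eventually]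
        with z h1 h2 h3 l hl
      rcases l with - | l
      · exact ih h3 s h1 (h2.mono fun w hw => by simpa using hw 0 (by omega)) 0 (by omega)
      · rw [iteratedDeriv_succ']
        exact ih h3 _ h1.deriv (h2.mono fun w hw => by simpa using hw 1 le_rfl) l (by omega)
  induction i with
  | zero =>
    have h0 : ∀ {z₀}, HolAt E z₀ → ∀ s, AnalyticAt ℂ s z₀ →
        (∀ᶠ z in 𝓝 z₀, s z ∈ derivKer E 0 z) → ∀ l ≤ 0, iteratedDeriv l s z₀ ∈ E z₀ := by
      intro z₀ hE s hs hsE l hl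
      obtain rfl := Nat.le_zero.1 hl
      simpa using derivKer_le _ _ _ hsE.self_of_nhds
    intro z₀ hE
    refine ⟨hE.congr (hE.eventually.mono fun z hz => hz.derivKer_zero.symm), h0 hE, step 0 h0 hE⟩
  | succ i ih =>
    have h1 : ∀ {z₀}, HolAt E z₀ → ∀ s, AnalyticAt ℂ s z₀ →
        (∀ᶠ z in 𝓝 z₀, s z ∈ derivKer E (i + 1) z) →
          ∀ l ≤ i + 1, iteratedDeriv l s z₀ ∈ E z₀ := by
      intro z₀ hE s hs hsE l hl
      have h2 : ∀ᶠ z in 𝓝 z₀, s z ∈ derivKer (derivKer E i) 1 z := by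
        filter_upwards [hsE, hE.eventually] with z h1 h2 using (ih h2).2.2 ▸ h1
      rcases l with - | l
      · simpa using derivKer_le _ _ _ hsE.self_of_nhds
      · rw [iteratedDeriv_succ']
        refine (ih hE).2.1 _ hs.deriv ?_ l (by omega)
        filter_upwards [h2.eventually_nhds, hs.eventually_analyticAt, hE.eventually] with z h3 h4 h5
        exact (ih h5).1.deriv_mem h4 h3
    intro z₀ hE
    refine ⟨(ih hE).1.derivKer_one.congr ?_, h1 hE, step _ h1 hE⟩
    exact hE.eventually.mono fun z hz => (ih hz).2.2.symm

theorem HolAt.derivKer {E : Fam n ℂ} (hE : HolAt E z₀) (i : ℕ) : HolAt (derivKer E i) z₀ :=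
  (HolAt.derivKer_aux i hE).1

theorem HolAt.derivKer_succ {E : Fam n ℂ} (hE : HolAt E z₀) (i : ℕ) :
    SuperHorizontal.derivKer E (i + 1) z₀ =
      SuperHorizontal.derivKer (SuperHorizontal.derivKer E i) 1 z₀ :=
  (HolAt.derivKer_aux i hE).2.2

theorem HolAt.fill_le {Y S : Fam n ℂ} (hY : HolAt Y z₀) (h : ∀ᶠ z in 𝓝[≠] z₀, S z ≤ Y z) :
    fill S z₀ ≤ Y z₀ := by
  refine Submodule.span_le.2 ?_
  rintro _ ⟨t, ht, htS, rfl⟩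
  exact (hY.mem_of_punctured (holNear_iff_analyticAt.1 ht)
    ((htS.and h).mono fun z hz => hz.2 hz.1).frequently).self_of_nhds

theorem HolAt.fill_derivSpan_succ {E : Fam n ℂ} (hE : HolAt E z₀) (i : ℕ) :
    fill (derivSpan E (i + 1)) z₀ = fill (derivSpan (fill (derivSpan E i)) 1) z₀ := by
  have hHol : ∀ i, ∀ᶠ z in 𝓝 z₀, HolAt (fill (derivSpan E i)) z := fun i =>
    (hE.genHolAt_derivSpan i).holAt_fill.eventually
  apply le_antisymm
  · refine ((hHol i).self_of_nhds.genHolAt_derivSpan 1).holAt_fill.fill_le ?_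
    refine Eventually.of_forall fun z => derivSpan_le_iff.2 fun s hs hsE l hl => ?_
    have hmem : ∀ l ≤ i, ∀ᶠ w in 𝓝 z, iteratedDeriv l s w ∈ fill (derivSpan E i) w := by
      intro l hl
      filter_upwards [hs.eventually_analyticAt, hsE.eventually_nhds] with w h1 h2
      exact derivSpan_le_fill _ _ _ (zDeriv_mem_derivSpan h1 h2 hl)
    refine derivSpan_le_fill _ _ _ ?_
    rcases hl.lt_or_eq with hl | rfl
    · simpa using zDeriv_mem_derivSpan (analyticAt_iteratedDeriv hs l) (hmem l (by omega))
        (Nat.zero_le 1)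
    · have := zDeriv_mem_derivSpan (analyticAt_iteratedDeriv hs i) (hmem i le_rfl) (le_refl 1)
      rwa [iteratedDeriv_one, ← iteratedDeriv_succ] at this
  · have hY := hHol (i + 1)
    -- With `Y = E⁽ⁱ⁺¹⁾`, the generators of `E⁽ⁱ⁾` have their derivatives in `Y`, so `E⁽ⁱ⁾ ⊆ Y⁽⁻¹⁾`.
    -- Then arbitrary sections of `E⁽ⁱ⁾`, including those obtained by filling holes, have
    -- derivatives in `Y`.
    have hle : ∀ᶠ z in 𝓝 z₀,
        fill (derivSpan E i) z ≤ SuperHorizontal.derivKer (fill (derivSpan E (i + 1))) 1 z := by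
      filter_upwards [hY] with z hz
      refine hz.derivKer_one.fill_le ?_
      refine Eventually.of_forall fun w => derivSpan_le_iff.2 fun s hs hsE l hl => ?_
      have hmem : ∀ l ≤ i + 1, ∀ᶠ w in 𝓝 w,
          iteratedDeriv l s w ∈ fill (derivSpan E (i + 1)) w := by
        intro l hl
        filter_upwards [hs.eventually_analyticAt, hsE.eventually_nhds] with w h1 h2
        exact derivSpan_le_fill _ _ _ (zDeriv_mem_derivSpan h1 h2 hl)
      refine mem_derivKer_one (analyticAt_iteratedDeriv hs l) (hmem l (by omega)) ?_
      rw [← iteratedDeriv_succ]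
      exact hmem _ (by omega)
    refine hY.self_of_nhds.fill_le (eventually_nhdsWithin_of_eventually_nhds ?_)
    filter_upwards [hle.eventually_nhds, hY] with z h1 h2
    refine derivSpan_le_iff.2 fun s hs hsE l hl => ?_
    have h3 : ∀ᶠ w in 𝓝 z,
        s w ∈ SuperHorizontal.derivKer (fill (derivSpan E (i + 1))) 1 w := by
      filter_upwards [hsE, h1] with w h3 h4 using h4 h3
    interval_cases l
    · simpa using derivKer_le _ _ _ h3.self_of_nhds
    · simpa using h2.deriv_mem hs h3

theorem finrank_map_add_finrank_inf_ker (A : Op n) (G : Submodule ℂ (Cn n)) :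
    Module.finrank ℂ (G.map (A : Cn n →ₗ[ℂ] Cn n)) +
      Module.finrank ℂ (G ⊓ LinearMap.ker (A : Cn n →ₗ[ℂ] Cn n) : Submodule ℂ (Cn n)) =
      Module.finrank ℂ G := by
  have h := LinearMap.finrank_range_add_finrank_ker ((A : Cn n →ₗ[ℂ] Cn n).domRestrict G)
  rw [LinearMap.range_domRestrict, LinearMap.ker_domRestrict] at h
  rw [← h]
  congr 1
  rw [← Submodule.finrank_map_subtype_eq, Submodule.map_comap_subtype]

/-- If `F⁽⁻¹⁾ ⊆ G ⊆ F`, then `rank G⁽¹⁾ ≤ rank F + rank G - rank F⁽⁻¹⁾`. -/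
theorem HolAt.finrank_derivSpan_le {F G : Fam n ℂ} (hF : HolAt F z₀)
    (hGF : ∀ᶠ z in 𝓝 z₀, G z ≤ F z)
    (hFG : ∀ᶠ z in 𝓝 z₀, SuperHorizontal.derivKer F 1 z ≤ G z) :
    ∀ᶠ z in 𝓝[≠] z₀, Module.finrank ℂ (derivSpan G 1 z) +
      Module.finrank ℂ (SuperHorizontal.derivKer F 1 z) ≤
        Module.finrank ℂ (F z) + Module.finrank ℂ (G z) := by
  obtain ⟨Q, hQ, hQF⟩ := hF
  filter_upwards [(hQ.derivKer_one hQF).2, eventually_nhdsWithin_of_eventually_nhds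
    (hGF.eventually_nhds.and (hFG.and (hQ.eventually.and hQF.eventually_nhds)))] with z h1 h2
  obtain ⟨h2, h3, h4, h5⟩ := h2
  -- The derivative of a section `s` of `G` is `Q's` modulo `F`. The bound follows by rank-nullity
  -- for `Q'` on `G`, as `F⁽⁻¹⁾ ⊆ G ∩ ker Q'` off a discrete set.
  have hle : derivSpan G 1 z ≤ F z ⊔ (G z).map (deriv Q z).toLinearMap := by
    refine derivSpan_le_iff.2 fun s hs hsG l hl => ?_
    have hsF : ∀ᶠ w in 𝓝 z, s w ∈ F w := (hsG.and h2).mono fun w hw => hw.2 hw.1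
    interval_cases l
    · simpa using Submodule.mem_sup_left hsF.self_of_nhds
    · rw [iteratedDeriv_one, h4.deriv_section hs ((hsF.and h5).mono fun w hw => hw.2 ▸ hw.1),
        add_comm]
      refine Submodule.add_mem_sup ?_ ⟨_, hsG.self_of_nhds, rfl⟩
      exact h5.self_of_nhds ▸ apply_mem_ran _ _
  have e1 := finrank_map_add_finrank_inf_ker (deriv Q z) (G z)
  have e2 := Submodule.finrank_mono hle
  have e3 := Submodule.finrank_add_le_finrank_add_finrank (F z)
    ((G z).map (deriv Q z).toLinearMap)
  have e4 : Module.finrank ℂ (SuperHorizontal.derivKer F 1 z) ≤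
      Module.finrank ℂ
        (G z ⊓ LinearMap.ker (deriv Q z).toLinearMap : Submodule ℂ (Cn n)) := by
    refine Submodule.finrank_mono (le_inf h3 ?_)
    rw [h1]
    exact inf_le_right
  omega

/-- Off a discrete set `F⁽¹⁾ = F ⊕ Q'F`, the sum being direct because `QQ'Q = 0`, while `F⁽⁻¹⁾` is
the kernel of `Q'` on `F`. -/
theorem HolAt.finrank_derivSpan_add {F : Fam n ℂ} (hF : HolAt F z₀) :
    ∀ᶠ z in 𝓝[≠] z₀, Module.finrank ℂ (derivSpan F 1 z) +
      Module.finrank ℂ (SuperHorizontal.derivKer F 1 z) = 2 * Module.finrank ℂ (F z) := by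
  have hle := hF.finrank_derivSpan_le (Eventually.of_forall fun z => le_rfl)
    (Eventually.of_forall fun z => derivKer_le F 1 z)
  obtain ⟨Q, hQ, hQF⟩ := hF
  filter_upwards [hle, (hQ.derivKer_one hQF).2, eventually_nhdsWithin_of_eventually_nhds
    (hQ.eventually.and hQF.eventually_nhds)] with z h0 h1 h2
  obtain ⟨h4, h5⟩ := h2
  refine le_antisymm (h0.trans_eq (two_mul _).symm) ?_
  have hge : F z ⊔ (F z).map (deriv Q z).toLinearMap ≤ derivSpan F 1 z := by
    have hHol : HolAt F z := ⟨Q, h4, h5⟩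
    have hF0 : F z ≤ derivSpan F 1 z := by
      intro v hv
      obtain ⟨s, hs, hsF, rfl⟩ := hHol.exists_section hv
      simpa using zDeriv_mem_derivSpan hs hsF (Nat.zero_le 1)
    refine sup_le hF0 ?_
    rintro _ ⟨v, hv, rfl⟩
    obtain ⟨s, hs, hsF, rfl⟩ := hHol.exists_section hv
    have e1 := h4.deriv_section hs ((hsF.and h5).mono fun w hw => hw.2 ▸ hw.1)
    have e2 : (deriv Q z) (s z) = deriv s z - Q z (deriv s z) := by rw [eq_sub_iff_add_eq, ← e1]
    change (deriv Q z) (s z) ∈ _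
    rw [e2]
    refine Submodule.sub_mem _ ?_ (hF0 (h5.self_of_nhds ▸ apply_mem_ran _ _))
    simpa using zDeriv_mem_derivSpan hs hsF (le_refl 1)
  have hdisj : F z ⊓ (F z).map (deriv Q z).toLinearMap = ⊥ := by
    rw [eq_bot_iff]
    rintro _ ⟨hv, v, hv', rfl⟩
    rw [SetLike.mem_coe, ← h5.self_of_nhds, h4.mem_iff] at hv hv'
    change Q z (deriv Q z v) = deriv Q z v at hv
    change deriv Q z v ∈ _
    rw [← hv, ← hv', h4.apply_deriv_apply]
    exact Submodule.zero_mem _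
  have e1 := finrank_map_add_finrank_inf_ker (deriv Q z) (F z)
  have e2 := Submodule.finrank_mono hge
  have e3 := Submodule.finrank_sup_add_finrank_inf_eq (F z)
    ((F z).map (deriv Q z).toLinearMap)
  rw [hdisj, finrank_bot] at e3
  rw [h1]
  omega

end LocalDerivatives

/-! ### Higher derivatives under a change of coordinate -/

section ChangeOfVariable

variable {F : Type*} [NormedAddCommGroup F] [NormedSpace ℂ F] [CompleteSpace F]

theorem iteratedDeriv_comp_eq_sum {f : ℂ → F} {τ : ℂ → ℂ} {w : ℂ} (hf : AnalyticAt ℂ f (τ w))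
    (hτ : AnalyticAt ℂ τ w) (l : ℕ) :
    ∃ a : ℕ → ℂ → ℂ, (∀ k, AnalyticAt ℂ (a k) w) ∧ ∀ᶠ v in 𝓝 w,
      iteratedDeriv l (f ∘ τ) v = ∑ k ∈ Finset.range (l + 1), a k v • iteratedDeriv k f (τ v) := by
  induction l with
  | zero => exact ⟨fun _ _ => 1, fun _ => analyticAt_const, by simp⟩
  | succ l ih =>
    obtain ⟨a, ha, hal⟩ := ih
    -- Differentiating `aₖ · f⁽ᵏ⁾(τ)` contributes `aₖ'` to the coefficient of order `k` and `aₖ τ'`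
    -- to that of order `k + 1`. The truncation discards `aₖ` for `k > l`, about whose derivative
    -- nothing is wanted.
    refine ⟨fun k v => (if k ≤ l then deriv (a k) v else 0) +
      (if k = 0 then 0 else a (k - 1) v * deriv τ v), fun k => ?_, ?_⟩
    · refine AnalyticAt.add ?_ ?_
      · split_ifs
        exacts [(ha k).deriv, analyticAt_const]
      · split_ifs
        exacts [analyticAt_const, (ha _).mul hτ.deriv]
    · filter_upwards [hal.eventually_nhds, eventually_all_finset (Finset.range (l + 1)) |>.2
        fun k _ => (ha k).eventually_analyticAt, hτ.eventually_analyticAt,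
        hτ.continuousAt.eventually hf.eventually_analyticAt] with v h1 h2 h3 h4
      rw [iteratedDeriv_succ, EventuallyEq.deriv_eq h1]
      have hd : HasDerivAt (fun v => ∑ k ∈ Finset.range (l + 1), a k v • iteratedDeriv k f (τ v))
          (∑ k ∈ Finset.range (l + 1), (a k v • (deriv τ v • iteratedDeriv (k + 1) f (τ v)) +
            deriv (a k) v • iteratedDeriv k f (τ v))) v := by
        refine HasDerivAt.fun_sum fun k hk => ?_
        have hfk : AnalyticAt ℂ (iteratedDeriv k f) (τ v) := by
          rw [iteratedDeriv_eq_iterate]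
          exact h4.iterated_deriv k
        have h5 := hfk.differentiableAt.hasDerivAt
        rw [← iteratedDeriv_succ] at h5
        exact (h2 k hk).differentiableAt.hasDerivAt.smul
          (h5.scomp v h3.differentiableAt.hasDerivAt)
      rw [hd.deriv]
      simp only [add_smul, Finset.sum_add_distrib]
      rw [add_comm]
      congr 1
      · rw [Finset.sum_range_succ _ (l + 1)]
        simp only [show ¬ l + 1 ≤ l by omega, if_false, zero_smul, add_zero]
        refine Finset.sum_congr rfl fun k hk => ?_
        rw [if_pos (Nat.lt_succ_iff.1 (Finset.mem_range.1 hk))]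
      · rw [Finset.sum_range_succ' _ (l + 1)]
        simp [mul_smul]

theorem iteratedDeriv_comp_mem_span {f : ℂ → F} {τ : ℂ → ℂ} {w : ℂ}
    (hf : AnalyticAt ℂ f (τ w)) (hτ : AnalyticAt ℂ τ w) {l i : ℕ} (hl : l ≤ i) :
    iteratedDeriv l (f ∘ τ) w ∈ Submodule.span ℂ {v | ∃ k ≤ i, v = iteratedDeriv k f (τ w)} := by
  obtain ⟨a, -, hal⟩ := iteratedDeriv_comp_eq_sum hf hτ l
  rw [hal.self_of_nhds]
  refine Submodule.sum_mem _ fun k hk => Submodule.smul_mem _ _ (Submodule.subset_span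
    ⟨k, ?_, rfl⟩)
  rw [Finset.mem_range] at hk
  omega

end ChangeOfVariable

/-! ### Passing between the surface and its charts -/

section Charts

variable {n : ℕ} {M : Type*} [TopologicalSpace M] [ChartedSpace ℂ M]

/-- The expression of a family in the preferred chart at `p`. -/
noncomputable def loc (p : M) (E : Fam n M) : Fam n ℂ := fun z => E ((chartAt ℂ p).symm z)

theorem eventually_nhds_chart_symm {p : M} {z : ℂ} (hz : z ∈ (chartAt ℂ p).target)
    {P : M → Prop} :
    (∀ᶠ q in 𝓝 ((chartAt ℂ p).symm z), P q) ↔ ∀ᶠ w in 𝓝 z, P ((chartAt ℂ p).symm w) := by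
  rw [← (chartAt ℂ p).symm.map_nhds_eq hz, eventually_map]

theorem eventually_nhds_chart {p : M} {P : M → Prop} :
    (∀ᶠ q in 𝓝 p, P q) ↔ ∀ᶠ w in 𝓝 (chartAt ℂ p p), P ((chartAt ℂ p).symm w) := by
  rw [← eventually_nhds_chart_symm (mem_chart_target ℂ p),
    (chartAt ℂ p).left_inv (mem_chart_source ℂ p)]

theorem eventually_nhdsNE_chart_symm {p : M} {z : ℂ} (hz : z ∈ (chartAt ℂ p).target)
    {P : M → Prop} :
    (∀ᶠ q in 𝓝[≠] ((chartAt ℂ p).symm z), P q) ↔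
      ∀ᶠ w in 𝓝[≠] z, P ((chartAt ℂ p).symm w) := by
  rw [eventually_nhdsWithin_iff, eventually_nhdsWithin_iff, eventually_nhds_chart_symm hz]
  refine eventually_congr ?_
  filter_upwards [(chartAt ℂ p).open_target.mem_nhds hz] with w hw
  have : w = z ↔ (chartAt ℂ p).symm w = (chartAt ℂ p).symm z :=
    ((chartAt ℂ p).symm.injOn.eq_iff hw hz).symm
  simp only [Set.mem_compl_iff, Set.mem_singleton_iff, this]

theorem eventually_nhdsNE_chart {p : M} {P : M → Prop} :
    (∀ᶠ q in 𝓝[≠] p, P q) ↔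
      ∀ᶠ w in 𝓝[≠] (chartAt ℂ p p), P ((chartAt ℂ p).symm w) := by
  rw [← eventually_nhdsNE_chart_symm (mem_chart_target ℂ p),
    (chartAt ℂ p).left_inv (mem_chart_source ℂ p)]

instance nhdsNE_neBot (p : M) : (𝓝[≠] p).NeBot := by
  rw [← Filter.frequently_true_iff_neBot]
  intro h
  rw [eventually_nhdsNE_chart] at h
  have hb : (𝓝[≠] (chartAt ℂ p p)).NeBot := inferInstance
  exact hb.ne (by simpa using h)

theorem eventually_target {p : M} : ∀ᶠ z in 𝓝 (chartAt ℂ p p), z ∈ (chartAt ℂ p).target :=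
  (chartAt ℂ p).open_target.mem_nhds (mem_chart_target ℂ p)

theorem comp_chart_comp_symm {X : Type*} (t : ℂ → X) {p : M} {z : ℂ}
    (hz : z ∈ (chartAt ℂ p).target) :
    (t ∘ chartAt ℂ p) ∘ (chartAt ℂ p).symm =ᶠ[𝓝 z] t := by
  filter_upwards [(chartAt ℂ p).open_target.mem_nhds hz] with w hw
  simp [(chartAt ℂ p).right_inv hw]

theorem comp_transition {X : Type*} (s : M → X) {p p' : M} {z : ℂ}
    (hz : z ∈ (chartAt ℂ p).target) (hz' : (chartAt ℂ p).symm z ∈ (chartAt ℂ p').source) :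
    (s ∘ (chartAt ℂ p').symm) ∘ (chartAt ℂ p' ∘ (chartAt ℂ p).symm) =ᶠ[𝓝 z]
      s ∘ (chartAt ℂ p).symm := by
  have h1 : ∀ᶠ w in 𝓝 z, (chartAt ℂ p).symm w ∈ (chartAt ℂ p').source :=
    (eventually_nhds_chart_symm hz).1 ((chartAt ℂ p').open_source.mem_nhds hz')
  filter_upwards [h1] with w hw
  simp [(chartAt ℂ p').left_inv hw]

variable [IsManifold 𝓘(ℂ, ℂ) ω M]

theorem mdifferentiableAt_iff_chart {F : Type*} [NormedAddCommGroup F] [NormedSpace ℂ F]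
    {f : M → F} {p : M} {z : ℂ} (hz : z ∈ (chartAt ℂ p).target) :
    MDifferentiableAt 𝓘(ℂ, ℂ) 𝓘(ℂ, F) f ((chartAt ℂ p).symm z) ↔
      DifferentiableAt ℂ (f ∘ (chartAt ℂ p).symm) z := by
  rw [mdifferentiableAt_iff_source_of_mem_source ((chartAt ℂ p).map_target hz)]
  simp only [modelWithCornersSelf_coe, Set.range_id, mdifferentiableWithinAt_univ]
  rw [mdifferentiableAt_iff_differentiableAt]
  simp only [mfld_simps, (chartAt ℂ p).right_inv hz]

theorem holNear_chart_iff {s : M → Cn n} {p : M} {z : ℂ} (hz : z ∈ (chartAt ℂ p).target) :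
    HolNear s ((chartAt ℂ p).symm z) ↔ AnalyticAt ℂ (s ∘ (chartAt ℂ p).symm) z := by
  rw [Complex.analyticAt_iff_eventually_differentiableAt, HolNear, eventually_nhds_chart_symm hz]
  refine eventually_congr ?_
  filter_upwards [(chartAt ℂ p).open_target.mem_nhds hz] with w hw
  exact mdifferentiableAt_iff_chart hw

theorem holNear_iff_chart {s : M → Cn n} {p : M} :
    HolNear s p ↔ AnalyticAt ℂ (s ∘ (chartAt ℂ p).symm) (chartAt ℂ p p) := by
  rw [← holNear_chart_iff (mem_chart_target ℂ p), (chartAt ℂ p).left_inv (mem_chart_source ℂ p)]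

/-- The transition functions are analytic. -/
theorem analyticAt_transition {p p' : M} {z : ℂ} (hz : z ∈ (chartAt ℂ p).target)
    (hz' : (chartAt ℂ p).symm z ∈ (chartAt ℂ p').source) :
    AnalyticAt ℂ (chartAt ℂ p' ∘ (chartAt ℂ p).symm) z := by
  rw [Complex.analyticAt_iff_eventually_differentiableAt]
  have h1 : ∀ᶠ w in 𝓝 z, (chartAt ℂ p).symm w ∈ (chartAt ℂ p').source :=
    (eventually_nhds_chart_symm hz).1 ((chartAt ℂ p').open_source.mem_nhds hz')
  filter_upwards [h1, (chartAt ℂ p).open_target.mem_nhds hz] with w h2 h3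
  rw [← mdifferentiableAt_iff_chart h3]
  exact mdifferentiableAt_atlas (chart_mem_atlas ℂ p') h2

theorem iteratedDeriv_chart_mem_span {s : M → Cn n} {p p' : M} {z : ℂ}
    (hz : z ∈ (chartAt ℂ p).target) (hz' : (chartAt ℂ p).symm z ∈ (chartAt ℂ p').source)
    (hs : HolNear s ((chartAt ℂ p).symm z)) {l i : ℕ} (hl : l ≤ i) :
    iteratedDeriv l (s ∘ (chartAt ℂ p).symm) z ∈ Submodule.span ℂ {v | ∃ k ≤ i,
      v = iteratedDeriv k (s ∘ (chartAt ℂ p').symm) (chartAt ℂ p' ((chartAt ℂ p).symm z))} := by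
  rw [← (comp_transition s hz hz').iteratedDeriv_eq]
  refine iteratedDeriv_comp_mem_span ?_ (analyticAt_transition hz hz') hl
  refine (holNear_chart_iff ((chartAt ℂ p').map_source hz')).1 ?_
  simpa [(chartAt ℂ p').left_inv hz'] using hs

/-- `zDeriv` uses the preferred chart at the point where it is evaluated, the right-hand side the
fixed chart at `p`. Each derivative of order at most `i` in one coordinate is a combination of such
derivatives in the other, so the spans agree. -/
theorem span_zDeriv_eq {s : M → Cn n} {p : M} {z : ℂ} (hz : z ∈ (chartAt ℂ p).target)
    (hs : HolNear s ((chartAt ℂ p).symm z)) (i : ℕ) :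
    Submodule.span ℂ {v | ∃ l ≤ i, v = zDeriv l s ((chartAt ℂ p).symm z)} =
      Submodule.span ℂ {v | ∃ l ≤ i, v = zDeriv l (s ∘ (chartAt ℂ p).symm) z} := by
  set q := (chartAt ℂ p).symm z with hq
  have hz2 : chartAt ℂ q q ∈ (chartAt ℂ q).target := mem_chart_target ℂ q
  have e : (chartAt ℂ q).symm (chartAt ℂ q q) = q := (chartAt ℂ q).left_inv (mem_chart_source ℂ q)
  have e' : chartAt ℂ p q = z := (chartAt ℂ p).right_inv hz
  apply le_antisymm <;> rw [Submodule.span_le]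
  · rintro _ ⟨l, hl, rfl⟩
    have := iteratedDeriv_chart_mem_span (p' := p) hz2 (e.symm ▸ (chartAt ℂ p).map_target hz)
      (e.symm ▸ hs) hl
    rw [e, e'] at this
    simp only [zDeriv_eq_iteratedDeriv]
    exact this
  · rintro _ ⟨l, hl, rfl⟩
    rw [zDeriv_eq_iteratedDeriv]
    exact iteratedDeriv_chart_mem_span (p' := q) hz (mem_chart_source ℂ q) hs hl

theorem zDeriv_mem_iff {s : M → Cn n} {p : M} {z : ℂ} (hz : z ∈ (chartAt ℂ p).target)
    (hs : HolNear s ((chartAt ℂ p).symm z)) (i : ℕ) (W : Submodule ℂ (Cn n)) :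
    (∀ l ≤ i, zDeriv l s ((chartAt ℂ p).symm z) ∈ W) ↔
      ∀ l ≤ i, zDeriv l (s ∘ (chartAt ℂ p).symm) z ∈ W := by
  have key : ∀ f : ℕ → Cn n, (∀ l ≤ i, f l ∈ W) ↔ Submodule.span ℂ {v | ∃ l ≤ i, v = f l} ≤ W := by
    intro f
    rw [Submodule.span_le]
    exact ⟨fun h _ ⟨l, hl, e⟩ => e ▸ h l hl, fun h l hl => h ⟨l, hl, rfl⟩⟩
  rw [key, key, span_zDeriv_eq hz hs]

theorem isHolSectionNear_chart_iff {E : Fam n M} {s : M → Cn n} {p : M} {z : ℂ}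
    (hz : z ∈ (chartAt ℂ p).target) :
    IsHolSectionNear E s ((chartAt ℂ p).symm z) ↔
      IsHolSectionNear (loc p E) (s ∘ (chartAt ℂ p).symm) z := by
  rw [isHolSectionNear_iff, IsHolSectionNear, holNear_chart_iff hz, eventually_nhds_chart_symm hz]
  rfl

theorem holNear_comp_chart {t : ℂ → Cn n} {p : M} {z : ℂ} (hz : z ∈ (chartAt ℂ p).target) :
    HolNear (t ∘ chartAt ℂ p) ((chartAt ℂ p).symm z) ↔ AnalyticAt ℂ t z := by
  rw [holNear_chart_iff hz, analyticAt_congr (comp_chart_comp_symm t hz)]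

theorem isHolSectionNear_comp_chart {E : Fam n M} {t : ℂ → Cn n} {p : M} {z : ℂ}
    (hz : z ∈ (chartAt ℂ p).target) :
    IsHolSectionNear E (t ∘ chartAt ℂ p) ((chartAt ℂ p).symm z) ↔
      IsHolSectionNear (loc p E) t z := by
  rw [isHolSectionNear_chart_iff hz, isHolSectionNear_iff, isHolSectionNear_iff,
    analyticAt_congr (comp_chart_comp_symm t hz)]
  refine and_congr_right fun _ => eventually_congr ?_
  filter_upwards [comp_chart_comp_symm t hz] with w hw
  rw [hw]

theorem loc_fill (S : Fam n M) {p : M} {z : ℂ} (hz : z ∈ (chartAt ℂ p).target) :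
    loc p (fill S) z = fill (loc p S) z := by
  apply le_antisymm <;> refine Submodule.span_le.2 ?_
  · rintro _ ⟨t, ht, htS, rfl⟩
    refine Submodule.subset_span ⟨t ∘ (chartAt ℂ p).symm, ?_, ?_, rfl⟩
    · exact holNear_iff_analyticAt.2 ((holNear_chart_iff hz).1 ht)
    · exact (eventually_nhdsNE_chart_symm hz).1 htS
  · rintro _ ⟨t, ht, htS, rfl⟩
    refine Submodule.subset_span ⟨t ∘ chartAt ℂ p, ?_, ?_, ?_⟩
    · exact (holNear_comp_chart hz).2 (holNear_iff_analyticAt.1 ht)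
    · rw [eventually_nhdsNE_chart_symm hz]
      filter_upwards [htS, eventually_nhdsWithin_of_eventually_nhds
        (comp_chart_comp_symm t hz)] with w h1 h2
      exact h2.symm ▸ h1
    · exact (comp_chart_comp_symm t hz).eq_of_nhds.symm

theorem loc_derivSpan (E : Fam n M) (i : ℕ) {p : M} {z : ℂ} (hz : z ∈ (chartAt ℂ p).target) :
    loc p (derivSpan E i) z = derivSpan (loc p E) i z := by
  apply le_antisymm <;> refine Submodule.span_le.2 ?_
  · rintro _ ⟨s, hs, l, hl, rfl⟩
    refine (zDeriv_mem_iff hz hs.1 i _).2 (fun l hl => ?_) l hl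
    exact Submodule.subset_span ⟨_, (isHolSectionNear_chart_iff hz).1 hs, l, hl, rfl⟩
  · rintro _ ⟨t, ht, l, hl, rfl⟩
    have ht' := (isHolSectionNear_comp_chart hz).2 ht
    have h1 := (zDeriv_mem_iff hz ht'.1 i (loc p (derivSpan E i) z)).1
      (fun l hl => Submodule.subset_span ⟨_, ht', l, hl, rfl⟩) l hl
    rwa [zDeriv_eq_iteratedDeriv, (comp_chart_comp_symm t hz).iteratedDeriv_eq,
      ← zDeriv_eq_iteratedDeriv] at h1

theorem loc_derivKer (E : Fam n M) (i : ℕ) {p : M} {z : ℂ} (hz : z ∈ (chartAt ℂ p).target) :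
    loc p (derivKer E i) z = derivKer (loc p E) i z := by
  have key : ∀ s : M → Cn n, IsHolSectionNear E s ((chartAt ℂ p).symm z) →
      ((∀ᶠ q in 𝓝 ((chartAt ℂ p).symm z), ∀ l ≤ i, zDeriv l s q ∈ E q) ↔
        ∀ᶠ w in 𝓝 z, ∀ l ≤ i, zDeriv l (s ∘ (chartAt ℂ p).symm) w ∈ loc p E w) := by
    intro s hs
    rw [eventually_nhds_chart_symm hz]
    refine eventually_congr ?_
    filter_upwards [(eventually_nhds_chart_symm hz).1 hs.1.eventually_nhds,
      (chartAt ℂ p).open_target.mem_nhds hz] with w h1 h2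
    exact zDeriv_mem_iff h2 h1 i _
  apply le_antisymm <;> refine Submodule.span_le.2 ?_
  · rintro _ ⟨s, hs, hs', rfl⟩
    exact Submodule.subset_span
      ⟨_, (isHolSectionNear_chart_iff hz).1 hs, (key s hs).1 hs', rfl⟩
  · rintro _ ⟨t, ht, ht', rfl⟩
    have hs := (isHolSectionNear_comp_chart hz).2 ht
    refine Submodule.subset_span ⟨_, hs, (key _ hs).2 ?_,
      (comp_chart_comp_symm t hz).eq_of_nhds.symm⟩
    filter_upwards [ht', (comp_chart_comp_symm t hz).eventually_nhds] with w h1 h2 l hl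
    rw [zDeriv_eq_iteratedDeriv, EventuallyEq.iteratedDeriv_eq l h2, ← zDeriv_eq_iteratedDeriv]
    exact h1 l hl

end Charts

/-! ### Osculating bundles and ranks on a Riemann surface -/

section GlobalBundles

variable {n : ℕ} {M : Type*} [TopologicalSpace M] [ChartedSpace ℂ M]

/-- `E` is, locally, the range of an analytic family of idempotents. -/
def Hol (E : Fam n M) : Prop := ∀ p, HolAt (loc p E) (chartAt ℂ p p)

/-- `S` is, locally and off a discrete set, the range of an analytic family of idempotents. -/
def GenHol (S : Fam n M) : Prop := ∀ p, GenHolAt (loc p S) (chartAt ℂ p p)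

theorem loc_self (p : M) (E : Fam n M) : loc p E (chartAt ℂ p p) = E p := by
  rw [loc, (chartAt ℂ p).left_inv (mem_chart_source ℂ p)]

theorem loc_mono {E F : Fam n M} (h : E ≤ F) (p : M) : loc p E ≤ loc p F := fun _ => h _

theorem Hol.genHol {E : Fam n M} (hE : Hol E) : GenHol E := fun p => (hE p).genHolAt

theorem fill_congr {S S' : Fam n M} (h : ∀ p, ∀ᶠ q in 𝓝[≠] p, S q = S' q) :
    fill S = fill S' := by
  funext p
  unfold fill
  congr 1
  ext v
  refine exists_congr fun t => and_congr_right fun _ => and_congr_left fun _ => ?_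
  refine eventually_congr ((h p).mono fun q hq => ?_)
  rw [hq]

theorem Hol.isLocallyConstant_finrank {E : Fam n M} (hE : Hol E) :
    IsLocallyConstant fun p => Module.finrank ℂ (E p) := by
  rw [IsLocallyConstant.iff_eventually_eq]
  intro p
  rw [eventually_nhds_chart]
  filter_upwards [(hE p).finrank_eq] with z hz
  rw [loc_self] at hz
  exact hz

theorem derivSpan_mono {E F : Fam n M}
    (h : E ≤ F) (i : ℕ) : derivSpan E i ≤ derivSpan F i := by
  refine fun p => Submodule.span_mono ?_
  rintro _ ⟨s, hs, l, hl, rfl⟩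
  exact ⟨s, ⟨hs.1, hs.2.mono fun q hq => h q hq⟩, l, hl, rfl⟩

theorem derivKer_mono {E F : Fam n M}
    (h : E ≤ F) (i : ℕ) : derivKer E i ≤ derivKer F i := by
  refine fun p => Submodule.span_mono ?_
  rintro _ ⟨s, hs, hs', rfl⟩
  exact ⟨s, ⟨hs.1, hs.2.mono fun q hq => h q hq⟩, hs'.mono fun q hq l hl => h q (hq l hl), rfl⟩

theorem fill_mono {E F : Fam n M}
    (h : E ≤ F) : fill E ≤ fill F := by
  refine fun p => Submodule.span_mono ?_
  rintro _ ⟨t, ht, htE, rfl⟩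
  exact ⟨t, ht, htE.mono fun q hq => h q hq, rfl⟩

theorem osc_mono {E F : Fam n M}
    (h : E ≤ F) (i : ℤ) : osc E i ≤ osc F i := by
  unfold osc
  split_ifs
  exacts [fill_mono (derivSpan_mono h _), derivKer_mono h _]

theorem osc_natCast (E : Fam n M) (i : ℕ) :
    osc E i = fill (derivSpan E i) := by
  simp [osc]

theorem osc_neg_natCast (E : Fam n M)
    (i : ℕ) (hi : 0 < i) : osc E (-i) = derivKer E i := by
  simp [osc, hi.ne']

theorem osc_one (E : Fam n M) :
    osc E 1 = fill (derivSpan E 1) := osc_natCast E 1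

theorem osc_neg_one (E : Fam n M) :
    osc E (-1) = derivKer E 1 := osc_neg_natCast E 1 one_pos

theorem isHolSectionNear_congr {E E' : Fam n M} {p : M} (h : ∀ᶠ q in 𝓝 p, E q = E' q)
    (s : M → Cn n) : IsHolSectionNear E s p ↔ IsHolSectionNear E' s p := by
  refine and_congr_right fun _ => eventually_congr (h.mono fun q hq => ?_)
  rw [hq]

theorem derivSpan_congr {E E' : Fam n M} {p : M} (h : ∀ᶠ q in 𝓝 p, E q = E' q) (i : ℕ) :
    derivSpan E i p = derivSpan E' i p := by
  unfold derivSpan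
  simp only [isHolSectionNear_congr h]

theorem derivKer_congr {E E' : Fam n M} {p : M} (h : ∀ᶠ q in 𝓝 p, E q = E' q) (i : ℕ) :
    derivKer E i p = derivKer E' i p := by
  have : ∀ s : M → Cn n, (∀ᶠ q in 𝓝 p, ∀ l ≤ i, zDeriv l s q ∈ E q) ↔
      ∀ᶠ q in 𝓝 p, ∀ l ≤ i, zDeriv l s q ∈ E' q := fun s =>
    eventually_congr (h.mono fun q hq => by rw [hq])
  unfold derivKer
  simp only [isHolSectionNear_congr h, this]

theorem fill_congr_near {S S' : Fam n M} {p : M} (h : ∀ᶠ q in 𝓝 p, S q = S' q) :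
    fill S p = fill S' p := by
  have : ∀ t : M → Cn n, (∀ᶠ q in 𝓝[≠] p, t q ∈ S q) ↔ ∀ᶠ q in 𝓝[≠] p, t q ∈ S' q := fun t =>
    eventually_congr ((eventually_nhdsWithin_of_eventually_nhds h).mono fun q hq => by rw [hq])
  unfold fill
  simp only [this]

theorem derivKer_le_self (F : Fam n M)
    (i : ℕ) : derivKer F i ≤ F := by
  refine fun p => Submodule.span_le.2 ?_
  rintro _ ⟨s, hs, -, rfl⟩
  exact hs.2.self_of_nhds

theorem osc_neg_one_le (F : Fam n M) :
    osc F (-1) ≤ F := by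
  rw [osc_neg_one]
  exact derivKer_le_self F 1

theorem Hol.isLocallyConstant_of_rank {E : Fam n M} (hE : Hol E)
    (h : ∀ p, ∀ᶠ q in 𝓝 p, E p ≤ E q) : IsLocallyConstant E := by
  rw [IsLocallyConstant.iff_eventually_eq]
  intro p
  filter_upwards [h p, (IsLocallyConstant.iff_eventually_eq _).1 hE.isLocallyConstant_finrank p]
    with q h1 h2
  exact (Submodule.eq_of_le_of_finrank_eq h1 h2.symm).symm

theorem Hol.finrank [ConnectedSpace M] {E : Fam n M} (hE : Hol E) (p : M) : Module.finrank ℂ (E p) = rk E := by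
  have h : ∀ q, Module.finrank ℂ (E q) = Module.finrank ℂ (E p) := fun q =>
    hE.isLocallyConstant_finrank.apply_eq_of_preconnectedSpace q p
  unfold rk
  simp [h]

theorem rk_mono [ConnectedSpace M] {E F : Fam n M} (hE : Hol E) (hF : Hol F) (h : E ≤ F) : rk E ≤ rk F := by
  obtain ⟨p⟩ := (inferInstance : Nonempty M)
  rw [← hE.finrank p, ← hF.finrank p]
  exact Submodule.finrank_mono (h p)

theorem eq_of_le_of_rk_le [ConnectedSpace M] {E F : Fam n M} (hE : Hol E) (hF : Hol F) (h : E ≤ F)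
    (h' : rk F ≤ rk E) : E = F := by
  funext p
  refine Submodule.eq_of_le_of_finrank_le (h p) ?_
  rwa [hE.finrank, hF.finrank]

/-! #### Subbundles of a Riemann surface -/

variable [IsManifold 𝓘(ℂ, ℂ) ω M]

theorem isHolSubbundle_iff_forall {E : Fam n M} {d : ℕ} :
    IsHolSubbundle E d ↔ Hol E ∧ ∀ p, Module.finrank ℂ (E p) = d := by
  rw [Hol, ← forall_and]
  refine forall_congr' fun p => ?_
  rw [← loc_self p E, holAt_iff_exists_frame]
  constructor
  · rintro ⟨s, hs, hsE⟩
    exact ⟨fun j => s j ∘ (chartAt ℂ p).symm, fun j => holNear_iff_chart.1 (hs j),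
      eventually_nhds_chart.1 hsE⟩
  · rintro ⟨s, hs, hsE⟩
    refine ⟨fun j => s j ∘ chartAt ℂ p, fun j => ?_, ?_⟩
    · have := (holNear_comp_chart (mem_chart_target ℂ p)).2 (hs j)
      rwa [(chartAt ℂ p).left_inv (mem_chart_source ℂ p)] at this
    · rw [eventually_nhds_chart]
      filter_upwards [hsE, eventually_target] with z h1 h2
      simp only [Function.comp_apply, (chartAt ℂ p).right_inv h2]
      exact h1

theorem GenHol.hol_fill {S : Fam n M} (hS : GenHol S) : Hol (fill S) := fun p =>
  (hS p).holAt_fill.congr <| eventually_target.mono fun _ hz => (loc_fill S hz).symm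

theorem GenHol.fill_eq {S : Fam n M} (hS : GenHol S) (p : M) :
    ∀ᶠ q in 𝓝[≠] p, fill S q = S q := by
  rw [eventually_nhdsNE_chart]
  filter_upwards [(hS p).fill_eq, eventually_nhdsWithin_of_eventually_nhds eventually_target]
    with z h1 h2
  exact (loc_fill S h2).trans h1

theorem Hol.fill_le {S Y : Fam n M} (hY : Hol Y) (h : ∀ p, ∀ᶠ q in 𝓝[≠] p, S q ≤ Y q) :
    fill S ≤ Y := by
  intro p
  have := (hY p).fill_le (S := loc p S) (eventually_nhdsNE_chart.1 (h p))
  rwa [← loc_fill S (mem_chart_target ℂ p), loc_self, loc_self] at this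

theorem Hol.fill_eq {E : Fam n M} (hE : Hol E) : fill E = E := by
  funext p
  have := (hE p).fill_eq
  rwa [← loc_fill E (mem_chart_target ℂ p), loc_self, loc_self] at this

theorem Hol.exists_section {E : Fam n M} (hE : Hol E) {p : M} {v : Cn n} (hv : v ∈ E p) :
    ∃ s, IsHolSectionNear E s p ∧ s p = v := by
  obtain ⟨s, hs, hsE, hsv⟩ := (hE p).exists_section (v := v) (by rwa [loc_self])
  have h1 := (isHolSectionNear_comp_chart (E := E) (mem_chart_target ℂ p)).2
    (isHolSectionNear_iff.2 ⟨hs, hsE⟩)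
  rw [(chartAt ℂ p).left_inv (mem_chart_source ℂ p)] at h1
  exact ⟨_, h1, hsv⟩

theorem Hol.le_fill {B S : Fam n M} (hB : Hol B) (h : ∀ p, ∀ᶠ q in 𝓝[≠] p, B q ≤ S q) :
    B ≤ fill S := by
  intro p v hv
  obtain ⟨s, hs, rfl⟩ := hB.exists_section hv
  refine Submodule.subset_span ⟨s, hs.1, ?_, rfl⟩
  filter_upwards [h p, eventually_nhdsWithin_of_eventually_nhds hs.2] with q h1 h2 using h1 h2

theorem genHol_derivSpan {E : Fam n M} (hE : Hol E) (i : ℕ) : GenHol (derivSpan E i) := fun p =>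
  ((hE p).genHolAt_derivSpan i).congr <| eventually_nhdsWithin_of_eventually_nhds <|
    eventually_target.mono fun _ hz => (loc_derivSpan E i hz).symm

theorem hol_derivKer {E : Fam n M} (hE : Hol E) (i : ℕ) : Hol (derivKer E i) := fun p =>
  ((hE p).derivKer i).congr <| eventually_target.mono fun _ hz => (loc_derivKer E i hz).symm

theorem hol_osc {E : Fam n M} (hE : Hol E) (i : ℤ) : Hol (osc E i) := by
  unfold osc
  split_ifs
  exacts [(genHol_derivSpan hE _).hol_fill, hol_derivKer hE _]

theorem Hol.derivSpan_zero {E : Fam n M} (hE : Hol E) : derivSpan E 0 = E := by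
  funext p
  have := (hE p).derivSpan_zero
  rwa [← loc_derivSpan E 0 (mem_chart_target ℂ p), loc_self, loc_self] at this

theorem Hol.derivKer_zero {E : Fam n M} (hE : Hol E) : derivKer E 0 = E := by
  funext p
  have := (hE p).derivKer_zero
  rwa [← loc_derivKer E 0 (mem_chart_target ℂ p), loc_self, loc_self] at this

theorem Hol.osc_zero {E : Fam n M} (hE : Hol E) : osc E 0 = E := by
  have := osc_natCast E 0
  rw [hE.derivSpan_zero, hE.fill_eq] at this
  exact_mod_cast this

theorem loc_fill_derivSpan (E : Fam n M) (i : ℕ) {p : M} {z : ℂ}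
    (hz : z ∈ (chartAt ℂ p).target) :
    loc p (fill (derivSpan E i)) z = fill (derivSpan (loc p E) i) z := by
  rw [loc_fill _ hz]
  refine fill_congr_near ?_
  filter_upwards [(chartAt ℂ p).open_target.mem_nhds hz] with w hw using loc_derivSpan E i hw

/-- Restricted to `0 ≤ i`: for negative `i` only an inclusion survives, as a non-constant line
bundle `E` has `E⁽⁻¹⁾ = 0`. -/
theorem Hol.osc_add_one {E : Fam n M} (hE : Hol E) (i : ℤ) (hi : 0 ≤ i) :
    osc E (i + 1) = osc (osc E i) 1 := by
  lift i to ℕ using hi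
  rw [osc_one, osc_natCast, ← Nat.cast_succ, osc_natCast]
  funext p
  have h := (hE p).fill_derivSpan_succ i
  rw [← loc_fill_derivSpan E (i + 1) (mem_chart_target ℂ p), loc_self] at h
  rw [Nat.succ_eq_add_one, h, ← loc_self p (fill (derivSpan (fill (derivSpan E i)) 1)),
    loc_fill_derivSpan _ 1 (mem_chart_target ℂ p)]
  refine (fill_congr_near ?_).symm
  filter_upwards [eventually_target.eventually_nhds] with z hz
  exact derivSpan_congr (hz.mono fun w hw => loc_fill_derivSpan E i hw) 1

theorem Hol.osc_sub_one {E : Fam n M} (hE : Hol E) (i : ℤ) (hi : i ≤ 0) :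
    osc E (i - 1) = osc (osc E i) (-1) := by
  obtain ⟨i, rfl⟩ : ∃ j : ℕ, i = -j := ⟨i.natAbs, by omega⟩
  have e : (-(i : ℤ) - 1) = -((i + 1 : ℕ) : ℤ) := by push_cast; ring
  have e' : osc E (-(i : ℤ)) = derivKer E i := by
    rcases Nat.eq_zero_or_pos i with rfl | h
    · rw [hE.derivKer_zero]
      exact_mod_cast hE.osc_zero
    · exact osc_neg_natCast E i h
  rw [osc_neg_one, e, osc_neg_natCast _ _ i.succ_pos, e']
  funext p
  have h := (hE p).derivKer_succ i
  rw [← loc_derivKer E (i + 1) (mem_chart_target ℂ p), loc_self] at h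
  rw [h, ← loc_self p (derivKer (derivKer E i) 1), loc_derivKer _ 1 (mem_chart_target ℂ p)]
  refine (derivKer_congr ?_ 1).symm
  filter_upwards [eventually_target] with z hz using loc_derivKer E i hz

theorem zDeriv_one_mem_of_derivKer {F : Fam n M} (hF : Hol F) {p : M} {s : M → Cn n}
    (hs : IsHolSectionNear (osc F (-1)) s p) : zDeriv 1 s p ∈ F p := by
  rw [osc_neg_one] at hs
  have h1 := (isHolSectionNear_chart_iff (E := derivKer F 1) (s := s) (mem_chart_target ℂ p)).1
    (by rwa [(chartAt ℂ p).left_inv (mem_chart_source ℂ p)])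
  rw [isHolSectionNear_iff] at h1
  have h2 := (hF p).deriv_mem h1.1 (by
    filter_upwards [h1.2, eventually_target] with z h1 h2 using loc_derivKer F 1 h2 ▸ h1)
  rw [loc_self] at h2
  rwa [zDeriv, iteratedDeriv_one]

theorem derivSpan_le_osc (E : Fam n M) (i : ℕ) : derivSpan E i ≤ osc E i := by
  intro p
  rw [osc_natCast, ← loc_self p (derivSpan E i), ← loc_self p (fill (derivSpan E i)),
    loc_fill_derivSpan E i (mem_chart_target ℂ p), loc_derivSpan E i (mem_chart_target ℂ p)]
  exact derivSpan_le_fill _ _ _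

/-- `E⁽¹⁾ ⊆ F` if and only if local sections of `E` and their derivatives are in `F`. -/
theorem osc_one_le_iff {E F : Fam n M} (hE : Hol E) (hF : Hol F) :
    osc E 1 ≤ F ↔ E ≤ F ∧ ∀ p s, IsHolSectionNear E s p → zDeriv 1 s p ∈ F p := by
  constructor
  · intro h
    have h1 : derivSpan E 1 ≤ F := (derivSpan_le_osc E 1).trans h
    refine ⟨fun p v hv => ?_, fun p s hs => h1 p (Submodule.subset_span ⟨s, hs, 1, le_rfl, rfl⟩)⟩
    obtain ⟨s, hs, rfl⟩ := hE.exists_section hv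
    refine h1 p (Submodule.subset_span ⟨s, hs, 0, zero_le_one, ?_⟩)
    rw [zDeriv, iteratedDeriv_zero, Function.comp_apply,
      (chartAt ℂ p).left_inv (mem_chart_source ℂ p)]
  · rintro ⟨h0, h1⟩
    rw [osc_one]
    refine hF.fill_le fun p => Eventually.of_forall fun q => Submodule.span_le.2 ?_
    rintro _ ⟨s, hs, l, hl, rfl⟩
    interval_cases l
    · rw [zDeriv, iteratedDeriv_zero, Function.comp_apply,
        (chartAt ℂ q).left_inv (mem_chart_source ℂ q)]
      exact h0 q hs.2.self_of_nhds
    · exact h1 q s hs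

/-- `E⁽¹⁾ ⊆ F` if and only if `E ⊆ F⁽⁻¹⁾`. -/
theorem osc_one_le_iff_le {E F : Fam n M} (hE : Hol E) (hF : Hol F) :
    osc E 1 ≤ F ↔ E ≤ osc F (-1) := by
  rw [osc_one_le_iff hE hF]
  constructor
  · rintro ⟨h0, h1⟩ p v hv
    obtain ⟨s, hs, rfl⟩ := hE.exists_section hv
    rw [osc_neg_one]
    refine Submodule.subset_span ⟨s, ⟨hs.1, hs.2.mono fun q hq => h0 q hq⟩, ?_, rfl⟩
    filter_upwards [hs.1.eventually_nhds, hs.2.eventually_nhds] with q h2 h3 l hl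
    interval_cases l
    · rw [zDeriv, iteratedDeriv_zero, Function.comp_apply,
        (chartAt ℂ q).left_inv (mem_chart_source ℂ q)]
      exact h0 q h3.self_of_nhds
    · exact h1 q s ⟨h2, h3⟩
  · intro h
    refine ⟨h.trans (osc_neg_one_le F), fun p s hs => ?_⟩
    exact zDeriv_one_mem_of_derivKer hF ⟨hs.1, hs.2.mono fun q hq => h q hq⟩

/-! #### The rank -/

variable [ConnectedSpace M]

theorem isHolSubbundle_iff {E : Fam n M} {d : ℕ} : IsHolSubbundle E d ↔ Hol E ∧ rk E = d := by
  rw [isHolSubbundle_iff_forall]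
  refine and_congr_right fun hE => ?_
  simp only [hE.finrank, forall_const]

theorem Hol.isHolSubbundle {E : Fam n M} (hE : Hol E) : IsHolSubbundle E (rk E) :=
  isHolSubbundle_iff.2 ⟨hE, rfl⟩

theorem rk_fill {S : Fam n M} (hS : GenHol S) {p : M} {d : ℕ}
    (h : ∃ᶠ q in 𝓝[≠] p, Module.finrank ℂ (S q) = d) : rk (fill S) = d := by
  obtain ⟨q, h1, h2⟩ := (h.and_eventually (hS.fill_eq p)).exists
  rw [← hS.hol_fill.finrank q, h2, h1]

/-- `rank F⁽¹⁾ - rank F = rank F - rank F⁽⁻¹⁾`. -/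
theorem rk_osc_one_add {F : Fam n M} (hF : Hol F) :
    rk (osc F 1) + rk (osc F (-1)) = 2 * rk F := by
  obtain ⟨p⟩ := (inferInstance : Nonempty M)
  have h' : ∀ᶠ q in 𝓝[≠] p, Module.finrank ℂ (derivSpan F 1 q) +
      Module.finrank ℂ (derivKer F 1 q) =
      2 * Module.finrank ℂ (F q) := by
    rw [eventually_nhdsNE_chart]
    filter_upwards [(hF p).finrank_derivSpan_add,
      eventually_nhdsWithin_of_eventually_nhds eventually_target] with z h1 h2
    rw [← loc_derivSpan F 1 h2, ← loc_derivKer F 1 h2] at h1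
    exact h1
  obtain ⟨q, h1, h2⟩ := (h'.and ((genHol_derivSpan hF 1).fill_eq p)).exists
  rw [← (hol_osc hF 1).finrank q, ← (hol_osc hF (-1)).finrank q, osc_one, osc_neg_one, h2,
    ← hF.finrank q]
  exact h1

/-- If `F⁽⁻¹⁾ ⊆ G ⊆ F`, then `rank G⁽¹⁾ ≤ rank F + rank G - rank F⁽⁻¹⁾`. -/
theorem rk_osc_one_add_le {F G : Fam n M} (hF : Hol F) (hG : Hol G) (hGF : G ≤ F)
    (hFG : osc F (-1) ≤ G) : rk (osc G 1) + rk (osc F (-1)) ≤ rk F + rk G := by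
  obtain ⟨p⟩ := (inferInstance : Nonempty M)
  rw [osc_neg_one] at hFG
  have h := (hF p).finrank_derivSpan_le (Eventually.of_forall (loc_mono hGF p))
    (eventually_target.mono fun z hz => (loc_derivKer F 1 hz).symm.trans_le (hFG _))
  have h' : ∀ᶠ q in 𝓝[≠] p, Module.finrank ℂ (derivSpan G 1 q) +
      Module.finrank ℂ (derivKer F 1 q) ≤
      Module.finrank ℂ (F q) + Module.finrank ℂ (G q) := by
    rw [eventually_nhdsNE_chart]
    filter_upwards [h,
      eventually_nhdsWithin_of_eventually_nhds eventually_target] with z h1 h2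
    rw [← loc_derivSpan G 1 h2, ← loc_derivKer F 1 h2] at h1
    exact h1
  obtain ⟨q, h1, h2⟩ := (h'.and ((genHol_derivSpan hG 1).fill_eq p)).exists
  rw [← (hol_osc hG 1).finrank q, ← (hol_osc hF (-1)).finrank q, osc_one, osc_neg_one, h2,
    ← hF.finrank q, ← hG.finrank q]
  exact h1

end GlobalBundles

/-! ### Solving linear systems with analytic coefficients -/

section Meromorphic

variable {n : ℕ}

theorem analyticAt_det {d : ℕ} {N : ℂ → Matrix (Fin d) (Fin d) ℂ} {z₀ : ℂ}
    (hN : ∀ i j, AnalyticAt ℂ (fun z => N z i j) z₀) : AnalyticAt ℂ (fun z => (N z).det) z₀ := by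
  simp only [Matrix.det_apply]
  refine Finset.analyticAt_fun_sum _ fun σ _ => ?_
  simp only [Units.smul_def, zsmul_eq_mul]
  exact analyticAt_const.mul (Finset.analyticAt_fun_prod _ fun i _ => hN _ _)

theorem analyticAt_adjugate {d : ℕ} {N : ℂ → Matrix (Fin d) (Fin d) ℂ} {z₀ : ℂ}
    (hN : ∀ i j, AnalyticAt ℂ (fun z => N z i j) z₀) (i j : Fin d) :
    AnalyticAt ℂ (fun z => (N z).adjugate i j) z₀ := by
  simp only [Matrix.adjugate_apply]
  refine analyticAt_det fun k l => ?_
  by_cases h : k = j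
  · subst h
    simpa using analyticAt_const
  · simpa [Matrix.updateRow_ne h] using hN k l

/-- The vector in the span of the `t j z` whose coordinates with respect to the functionals `c i`
are the `a i`. -/
noncomputable def solve {d : ℕ} (t : Fin d → ℂ → Cn n) (c : Fin d → Cn n →L[ℂ] ℂ) (a : Fin d → ℂ)
    (z : ℂ) : Cn n :=
  ∑ j, ((Matrix.of fun i j => c i (t j z))⁻¹.mulVec a) j • t j z

variable {d : ℕ} {t : Fin d → ℂ → Cn n} {c : Fin d → Cn n →L[ℂ] ℂ} {z₀ : ℂ}

theorem coord_solve (a : Fin d → ℂ) {z : ℂ}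
    (hz : (Matrix.of fun i j => c i (t j z)).det ≠ 0) (i : Fin d) :
    c i (solve t c a z) = a i := by
  have h := Matrix.mulVec_mulVec a (Matrix.of fun i j => c i (t j z))
    (Matrix.of fun i j => c i (t j z))⁻¹
  rw [Matrix.mul_nonsing_inv _ (isUnit_iff_ne_zero.2 hz), Matrix.one_mulVec] at h
  have h2 := congrFun h i
  rw [← h2, solve, map_sum]
  simp only [map_smul, smul_eq_mul, Matrix.mulVec, dotProduct, Matrix.of_apply]
  exact Finset.sum_congr rfl fun j _ => mul_comm _ _

/-- Cramer's rule: the adjugate has analytic entries, so the poles are confined to the zeros of the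
determinant. -/
theorem solve_eq (ht : ∀ j, AnalyticAt ℂ (t j) z₀) (a : Fin d → ℂ) :
    ∃ g : ℂ → Cn n, AnalyticAt ℂ g z₀ ∧
      ∀ z, solve t c a z = ((Matrix.of fun i j => c i (t j z)).det)⁻¹ • g z := by
  have hN : ∀ i j, AnalyticAt ℂ (fun z => (Matrix.of fun i j => c i (t j z)) i j) z₀ :=
    fun i j => (c i).comp_analyticAt (ht j)
  refine ⟨fun z => ∑ j, ((Matrix.of fun i j => c i (t j z)).adjugate.mulVec a) j • t j z,
    Finset.analyticAt_fun_sum _ fun j _ => AnalyticAt.fun_smul ?_ (ht j), fun z => ?_⟩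
  · simp only [Matrix.mulVec, dotProduct]
    exact Finset.analyticAt_fun_sum _ fun k _ => (analyticAt_adjugate hN j k).mul analyticAt_const
  · rw [solve, Finset.smul_sum]
    refine Finset.sum_congr rfl fun j _ => ?_
    rw [Matrix.inv_def, Ring.inverse_eq_inv', Matrix.smul_mulVec, Pi.smul_apply, smul_assoc]

theorem analyticAt_det_coord (ht : ∀ j, AnalyticAt ℂ (t j) z₀) :
    AnalyticAt ℂ (fun z => (Matrix.of fun i j => c i (t j z)).det) z₀ :=
  analyticAt_det fun i j => (c i).comp_analyticAt (ht j)

theorem meromorphicAt_solve (ht : ∀ j, AnalyticAt ℂ (t j) z₀) (a : Fin d → ℂ) :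
    MeromorphicAt (solve t c a) z₀ := by
  obtain ⟨g, hg, h⟩ := solve_eq ht a (c := c)
  rw [funext h]
  exact (analyticAt_det_coord ht).meromorphicAt.inv.smul hg.meromorphicAt

theorem analyticAt_solve (ht : ∀ j, AnalyticAt ℂ (t j) z₀) (a : Fin d → ℂ)
    (h0 : (Matrix.of fun i j => c i (t j z₀)).det ≠ 0) : AnalyticAt ℂ (solve t c a) z₀ := by
  obtain ⟨g, hg, h⟩ := solve_eq ht a (c := c)
  rw [funext h]
  exact ((analyticAt_det_coord ht).inv h0).smul hg

/-- The matrix of coordinates is invertible if the functionals separate the points of the span. -/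
theorem det_coord_ne_zero_iff {z : ℂ} (hli : LinearIndependent ℂ fun j => t j z) :
    (Matrix.of fun i j => c i (t j z)).det ≠ 0 ↔
      ∀ x ∈ Submodule.span ℂ (Set.range fun j => t j z), (∀ i, c i x = 0) → x = 0 := by
  rw [← not_iff_not, not_not, ← Matrix.exists_mulVec_eq_zero_iff]
  push Not
  have key : ∀ v : Fin d → ℂ, (∀ i, c i (∑ j, v j • t j z) = 0) ↔
      (Matrix.of fun i j => c i (t j z)).mulVec v = 0 := by
    intro v
    rw [funext_iff]
    refine forall_congr' fun i => ?_
    rw [map_sum]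
    simp only [map_smul, smul_eq_mul, Matrix.mulVec, dotProduct, Matrix.of_apply, Pi.zero_apply,
      mul_comm]
  constructor
  · rintro ⟨v, hv, hv0⟩
    refine ⟨∑ j, v j • t j z, Submodule.sum_mem _ fun j _ => Submodule.smul_mem _ _
      (Submodule.subset_span ⟨j, rfl⟩), (key v).2 hv0, fun h => hv ?_⟩
    exact funext (Fintype.linearIndependent_iff.1 hli v h)
  · rintro ⟨x, hx, hx0, hne⟩
    obtain ⟨v, rfl⟩ := (Submodule.mem_span_range_iff_exists_fun ℂ).1 hx
    refine ⟨v, ?_, (key v).1 hx0⟩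
    rintro rfl
    simp at hne

end Meromorphic

/-! ### Global meromorphic sections and intermediate bundles -/

section GlobalSections

variable {n : ℕ} {M : Type*} [TopologicalSpace M] [ChartedSpace ℂ M]

theorem GenHol.map_op {S : Fam n M} (hS : GenHol S) (A : Op n) :
    GenHol fun q => (S q).map A.toLinearMap := by
  intro p
  obtain ⟨Q, hQ, hQS⟩ := hS p
  refine (genHolAt_span (x := fun (j : Fin n) z => A (Q z (EuclideanSpace.single j 1)))
    fun j => A.comp_analyticAt (hQ.an.clm_apply analyticAt_const)).congr ?_
  filter_upwards [hQS] with z hz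
  change _ = (loc p S z).map A.toLinearMap
  rw [← hz, ran]
  apply le_antisymm
  · rw [Submodule.span_le]
    rintro _ ⟨j, rfl⟩
    exact ⟨_, ⟨_, rfl⟩, rfl⟩
  · rintro _ ⟨_, ⟨v, rfl⟩, rfl⟩
    have h6 : v = ∑ j, v j • (EuclideanSpace.single j 1 : Cn n) := by
      simpa using ((EuclideanSpace.basisFun (Fin n) ℂ).sum_repr v).symm
    rw [h6]
    change A (Q z _) ∈ _
    simp only [map_sum, map_smul]
    exact Submodule.sum_mem _ fun j _ => Submodule.smul_mem _ _ (Submodule.subset_span ⟨j, rfl⟩)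

theorem GenHol.sup_span_mero {S E : Fam n M} (hS : GenHol S) {s : M → Cn n}
    (hs : IsMeroSection E s) : GenHol fun q => S q ⊔ Submodule.span ℂ {s q} := by
  intro p
  obtain ⟨k, hk⟩ := hs.1 p
  refine ((hS p).sup_span (ι := Unit) fun _ => hk).congr ?_
  filter_upwards [self_mem_nhdsWithin] with z hz
  rw [Set.range_const, Submodule.span_singleton_smul_eq
    (isUnit_iff_ne_zero.2 (pow_ne_zero _ (sub_ne_zero.2 hz)))]
  rfl

theorem IsMeroSection.mono {E F : Fam n M}
    (h : E ≤ F) {s : M → Cn n} (hs : IsMeroSection E s) : IsMeroSection F s :=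
  ⟨hs.1, fun p => (hs.2 p).mono fun q hq => h q hq⟩

variable [IsManifold 𝓘(ℂ, ℂ) ω M] [ConnectedSpace M]

/-- Through every vector of a subbundle of the trivial bundle there is a global meromorphic
section. -/
theorem Hol.exists_isMeroSection {E : Fam n M} (hE : Hol E) {p₀ : M} {v : Cn n} (hv : v ∈ E p₀) :
    ∃ s, IsMeroSection E s ∧ HolNear s p₀ ∧ s p₀ = v := by
  classical
  set V := E p₀ with hV
  have hd : Module.finrank ℂ V = rk E := hE.finrank p₀
  let b := Module.finBasisOfFinrankEq ℂ V hd
  -- The coordinates of the orthogonal projection to the fixed fibre `V = E p₀`. The section sought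
  -- is the one whose projection to `V` is constantly `v`.
  let c : Fin (rk E) → Cn n →L[ℂ] ℂ := fun i =>
    (LinearMap.toContinuousLinearMap (b.coord i)).comp V.orthogonalProjectionOnto
  have hcV : ∀ x : Cn n, (∀ i, c i x = 0) ↔ V.starProjection x = 0 := by
    intro x
    rw [Submodule.starProjection_apply, Submodule.coe_eq_zero]
    exact b.forall_coord_eq_zero_iff
  let a : Fin (rk E) → ℂ := fun i => c i v
  have hframe : ∀ p, ∃ t : Fin (rk E) → ℂ → Cn n, (∀ j, AnalyticAt ℂ (t j) (chartAt ℂ p p)) ∧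
      ∀ᶠ z in 𝓝 (chartAt ℂ p p), LinearIndependent ℂ (fun j => t j z) ∧
        Submodule.span ℂ (Set.range fun j => t j z) = E ((chartAt ℂ p).symm z) := fun p =>
    holAt_iff_exists_frame.1 ⟨hE p, hE.finrank _⟩
  let inj : M → Prop := fun q => ∀ x ∈ E q, (∀ i, c i x = 0) → x = 0
  -- Defined without reference to a chart, so that it is global. The value `0` is used where the
  -- projection fails to be injective or there is no solution; such points turn out to be isolated.
  let s : M → Cn n := fun q =>
    if h : inj q ∧ ∃ x, x ∈ E q ∧ ∀ i, c i x = a i then h.2.choose else 0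
  have hs : ∀ q x, inj q → x ∈ E q → (∀ i, c i x = a i) → s q = x := by
    intro q x hq hx hxa
    have h : inj q ∧ ∃ x, x ∈ E q ∧ ∀ i, c i x = a i := ⟨hq, x, hx, hxa⟩
    have e : s q = h.2.choose := dif_pos h
    rw [e, ← sub_eq_zero]
    refine hq _ ((E q).sub_mem h.2.choose_spec.1 hx) fun i => ?_
    rw [map_sub, h.2.choose_spec.2 i, hxa i, sub_self]
  have hs0 : ∀ q, s q ∈ E q := by
    intro q
    by_cases h : inj q ∧ ∃ x, x ∈ E q ∧ ∀ i, c i x = a i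
    · have e : s q = h.2.choose := dif_pos h
      exact e ▸ h.2.choose_spec.1
    · have e : s q = 0 := dif_neg h
      exact e ▸ Submodule.zero_mem _
  have hloc : ∀ (t : Fin (rk E) → ℂ → Cn n) (p : M) (z : ℂ), LinearIndependent ℂ (fun j => t j z) →
      Submodule.span ℂ (Set.range fun j => t j z) = E ((chartAt ℂ p).symm z) →
      (inj ((chartAt ℂ p).symm z) ↔ (Matrix.of fun i j => c i (t j z)).det ≠ 0) ∧
      (inj ((chartAt ℂ p).symm z) → s ((chartAt ℂ p).symm z) = solve t c a z) := by
    intro t p z hli hsp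
    have h1 : inj ((chartAt ℂ p).symm z) ↔ (Matrix.of fun i j => c i (t j z)).det ≠ 0 := by
      rw [det_coord_ne_zero_iff hli, hsp]
    refine ⟨h1, fun hi => hs _ _ hi ?_ (coord_solve a (h1.1 hi))⟩
    rw [← hsp, solve]
    exact Submodule.sum_mem _ fun j _ => Submodule.smul_mem _ _ (Submodule.subset_span ⟨j, rfl⟩)
  have hinj0 : inj p₀ := by
    intro x hx hx0
    rw [← Submodule.starProjection_eq_self_iff.2 (show x ∈ V from hx)]
    exact (hcV x).1 hx0
  have hinj_near : ∀ᶠ z in 𝓝 (chartAt ℂ p₀ p₀), inj ((chartAt ℂ p₀).symm z) := by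
    obtain ⟨t, ht, htE⟩ := hframe p₀
    have h0 : (Matrix.of fun i j => c i (t j (chartAt ℂ p₀ p₀))).det ≠ 0 := by
      have h := htE.self_of_nhds
      rw [← (hloc t p₀ _ h.1 h.2).1, (chartAt ℂ p₀).left_inv (mem_chart_source ℂ p₀)]
      exact hinj0
    filter_upwards [htE, (analyticAt_det_coord ht).continuousAt.eventually_ne h0] with z h1 h2
    exact (hloc t p₀ z h1.1 h1.2).1.2 h2
  have hinj_iff : ∀ q, inj q ↔
      Module.finrank ℂ ((E q).map V.starProjection.toLinearMap) = rk E := by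
    intro q
    have h := finrank_map_add_finrank_inf_ker V.starProjection (E q)
    rw [hE.finrank q] at h
    have h2 : inj q ↔ E q ⊓ LinearMap.ker V.starProjection.toLinearMap = ⊥ := by
      rw [Submodule.eq_bot_iff]
      refine forall_congr' fun x => ?_
      rw [Submodule.mem_inf, LinearMap.mem_ker, and_imp, hcV]
      rfl
    rw [h2, ← Submodule.finrank_eq_zero (R := ℂ)]
    omega
  have hmap := hE.genHol.map_op V.starProjection
  -- The images of the fibres in `V` form a bundle off a discrete set. Its rank is full near `p₀`,
  -- hence everywhere by connectedness, so injectivity can fail only on a discrete set.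
  have hrk : rk (fill fun q => (E q).map V.starProjection.toLinearMap) = rk E := by
    refine rk_fill hmap (p := p₀) (Eventually.frequently ?_)
    rw [eventually_nhdsNE_chart]
    refine eventually_nhdsWithin_of_eventually_nhds ?_
    filter_upwards [hinj_near] with z hz using (hinj_iff _).1 hz
  have hinj : ∀ p, ∀ᶠ z in 𝓝[≠] (chartAt ℂ p p), inj ((chartAt ℂ p).symm z) := by
    intro p
    rw [← eventually_nhdsNE_chart]
    filter_upwards [hmap.fill_eq p] with q hq
    have := hmap.hol_fill.finrank q
    rw [hq, hrk] at this
    exact (hinj_iff q).2 this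
  refine ⟨s, ⟨fun p => ?_, fun p => Eventually.of_forall hs0⟩, ?_, ?_⟩
  · obtain ⟨t, ht, htE⟩ := hframe p
    refine (meromorphicAt_solve ht a (c := c)).congr ?_
    filter_upwards [hinj p, eventually_nhdsWithin_of_eventually_nhds htE] with z h1 h2
    exact ((hloc t p z h2.1 h2.2).2 h1).symm
  · obtain ⟨t, ht, htE⟩ := hframe p₀
    rw [holNear_iff_chart]
    have h0 := htE.self_of_nhds
    refine (analyticAt_solve ht a ((hloc t p₀ _ h0.1 h0.2).1.1
      hinj_near.self_of_nhds)).congr ?_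
    filter_upwards [hinj_near, htE] with z h1 h2
    exact ((hloc t p₀ z h2.1 h2.2).2 h1).symm
  · exact hs p₀ v hinj0 hv fun i => rfl

/-- A proper subbundle can be enlarged by a global meromorphic section. -/
theorem exists_add_section {P E : Fam n M} (hP : Hol P) (hE : Hol E) (hPE : P ≤ E)
    (hlt : rk P < rk E) :
    ∃ (s : M → Cn n) (P' : Fam n M), IsMeroSection E s ∧ Hol P' ∧ rk P' = rk P + 1 ∧
      P ≤ P' ∧ P' ≤ E ∧ ∀ p, ∀ᶠ q in 𝓝[≠] p, P' q = P q ⊔ Submodule.span ℂ {s q} := by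
  obtain ⟨p₀⟩ := (inferInstance : Nonempty M)
  obtain ⟨v, hvE, hvP⟩ : ∃ v ∈ E p₀, v ∉ P p₀ := by
    by_contra! h
    have := Submodule.finrank_mono (show E p₀ ≤ P p₀ from h)
    rw [hP.finrank, hE.finrank] at this
    omega
  obtain ⟨s, hs, hs', rfl⟩ := hE.exists_isMeroSection hvE
  have hgen := hP.genHol.sup_span_mero hs
  refine ⟨s, _, hs, hgen.hol_fill, ?_, ?_, ?_, hgen.fill_eq⟩
  · refine rk_fill hgen (p := p₀) (Eventually.frequently ?_)
    -- If `s` met `P` at points accumulating at `p₀`, the identity theorem would put `s p₀` into `P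
    -- p₀`.
    have hnot : ∀ᶠ q in 𝓝[≠] p₀, s q ∉ P q := by
      by_contra h
      rw [not_eventually] at h
      simp only [not_not] at h
      have h2 : ∃ᶠ z in 𝓝[≠] (chartAt ℂ p₀ p₀),
          (s ∘ (chartAt ℂ p₀).symm) z ∈ loc p₀ P z := by
        intro h3
        exact h (eventually_nhdsNE_chart.2 h3)
      have h3 := ((hP p₀).mem_of_punctured (holNear_iff_chart.1 hs') h2).self_of_nhds
      rw [loc_self, Function.comp_apply,
        (chartAt ℂ p₀).left_inv (mem_chart_source ℂ p₀)] at h3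
      exact hvP h3
    filter_upwards [hnot] with q hq
    have hne : s q ≠ 0 := fun h => hq (h ▸ Submodule.zero_mem _)
    have h1 := Submodule.finrank_sup_add_finrank_inf_eq (P q) (Submodule.span ℂ {s q})
    have h2 : P q ⊓ Submodule.span ℂ {s q} = ⊥ :=
      ((Submodule.disjoint_span_singleton' hne).2 hq).eq_bot
    rw [h2, finrank_bot, finrank_span_singleton hne, hP.finrank] at h1
    exact h1
  · exact hP.le_fill fun p => Eventually.of_forall fun q => le_sup_left
  · refine hE.fill_le fun p => ?_
    filter_upwards [hs.2 p] with q hq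
    exact sup_le (hPE q) ((Submodule.span_singleton_le_iff_mem _ _).2 hq)

/-- Between two subbundles there are subbundles of all intermediate ranks. -/
theorem exists_hol_between {P E : Fam n M} (hP : Hol P) (hE : Hol E) (hPE : P ≤ E) {e : ℕ}
    (h1 : rk P ≤ e) (h2 : e ≤ rk E) : ∃ F, Hol F ∧ rk F = e ∧ P ≤ F ∧ F ≤ E := by
  obtain ⟨k, rfl⟩ := Nat.exists_eq_add_of_le h1
  induction k generalizing P with
  | zero => exact ⟨P, hP, rfl, le_rfl, hPE⟩
  | succ k ih =>
    obtain ⟨s, P', -, hP', hr, h3, h4, -⟩ := exists_add_section hP hE hPE (by omega)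
    obtain ⟨F, hF, hFr, h5, h6⟩ := ih hP' h4 (by omega) (by omega)
    exact ⟨F, hF, by omega, h3.trans h5, h6⟩

theorem exists_sections {B F : Fam n M} (hB : Hol B) (hF : Hol F) (hBF : B ≤ F) {r : ℕ}
    (hr : r + rk B = rk F) :
    ∃ s : Fin r → M → Cn n, (∀ j, IsMeroSection F (s j)) ∧
      ∀ p, ∀ᶠ q in 𝓝[≠] p, F q = B q ⊔ Submodule.span ℂ (Set.range fun j => s j q) := by
  induction r generalizing B with
  | zero =>
    obtain rfl := eq_of_le_of_rk_le hB hF hBF (by omega)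
    exact ⟨fun j => j.elim0, fun j => j.elim0, fun p => Eventually.of_forall fun q => by simp⟩
  | succ r ih =>
    obtain ⟨s, B', hs, hB', hr', h3, h4, h5⟩ := exists_add_section hB hF hBF (by omega)
    obtain ⟨s', hs', h6⟩ := ih hB' h4 (by omega)
    refine ⟨Fin.cons s s', Fin.cases hs hs', fun p => ?_⟩
    filter_upwards [h5 p, h6 p] with q h7 h8
    rw [h8, h7, sup_assoc, ← Submodule.span_union]
    congr 2
    ext x
    simp [Fin.exists_fin_succ, eq_comm]

/-- The bundles obtained from `B` by adding meromorphic sections of `E` are those between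
`B` and `E`. -/
theorem addSections_iff {B E F : Fam n M} {e : ℕ} (hB : Hol B) (hE : Hol E) (hBE : B ≤ E) :
    AddSections B E e F ↔ Hol F ∧ rk F = e ∧ B ≤ F ∧ F ≤ E := by
  constructor
  · rintro ⟨r, s, -, hs, -, rfl, hF⟩
    refine ⟨(isHolSubbundle_iff.1 hF).1, (isHolSubbundle_iff.1 hF).2, ?_, ?_⟩
    · exact hB.le_fill fun p => Eventually.of_forall fun q => le_sup_left
    · refine hE.fill_le fun p => ?_
      filter_upwards [eventually_all.2 fun j => (hs j).2 p] with q hq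
      refine sup_le (hBE q) (Submodule.span_le.2 ?_)
      rintro _ ⟨j, rfl⟩
      exact hq j
  · rintro ⟨hF, rfl, hBF, hFE⟩
    obtain ⟨r, hr⟩ := Nat.exists_eq_add_of_le' (rk_mono hB hF hBF)
    obtain ⟨s, hs, hsF⟩ := exists_sections hB hF hBF hr.symm
    refine ⟨r, s, hr.symm, fun j => (hs j).mono hFE, fun p => ?_, ?_, hF.isHolSubbundle⟩
    · filter_upwards [hsF p] with q hq
      -- Independence is forced by counting: `r` vectors raise the rank from `rk B` to `rk B + r`.
      rw [linearIndependent_iff_card_le_finrank_span, Fintype.card_fin, Set.finrank]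
      have h1 := Submodule.finrank_add_le_finrank_add_finrank (B q)
        (Submodule.span ℂ (Set.range fun j => s j q))
      rw [← hq, hF.finrank, hB.finrank] at h1
      omega
    · rw [addSpan, ← fill_congr hsF, hF.fill_eq]

end GlobalSections

/-! ### Bundles closed under differentiation are constant -/

section ConstantBundles

variable {n : ℕ}

/-- Comparison of orders of vanishing: a non-zero solution vanishing to order `k + 1` at `z₀` has a
derivative of order exactly `k`, whereas `A Y` has order at least `k + 1`. -/
theorem eventually_eq_zero_of_deriv_eq_mul {A Y : ℂ → Op n} {z₀ : ℂ} (hA : AnalyticAt ℂ A z₀)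
    (hY : AnalyticAt ℂ Y z₀) (h : ∀ᶠ z in 𝓝 z₀, deriv Y z = A z * Y z) (h0 : Y z₀ = 0) :
    ∀ᶠ z in 𝓝 z₀, Y z = 0 := by
  by_contra hne
  obtain ⟨k, u, hu, hu0, hYu⟩ := hY.exists_eventuallyEq_pow_smul_nonzero_iff.2 hne
  obtain ⟨k, rfl⟩ : ∃ m, k = m + 1 := by
    refine Nat.exists_eq_succ_of_ne_zero ?_
    rintro rfl
    have := hYu.self_of_nhds
    rw [h0, pow_zero, one_smul] at this
    exact hu0 this.symm
  let g : ℂ → Op n := fun z => ((k + 1 : ℕ) : ℂ) • u z + (z - z₀) • (deriv u z - A z * u z)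
  have hid : AnalyticAt ℂ (fun z : ℂ => z - z₀) z₀ := analyticAt_id.sub analyticAt_const
  have hg : AnalyticAt ℂ g z₀ :=
    (analyticAt_const.fun_smul hu).add (hid.fun_smul (hu.deriv.sub (hA.mul hu)))
  have hg0 : ∀ᶠ z in 𝓝[≠] z₀, g z = 0 := by
    filter_upwards [self_mem_nhdsWithin, eventually_nhdsWithin_of_eventually_nhds
      (h.and (hYu.eventually_nhds.and hu.eventually_analyticAt))] with z hz h1
    obtain ⟨h1, h2, h3⟩ := h1
    have hd : HasDerivAt (fun z => (z - z₀) ^ (k + 1) • u z)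
        ((z - z₀) ^ (k + 1) • deriv u z +
          (((k + 1 : ℕ) : ℂ) * (z - z₀) ^ (k + 1 - 1) * 1) • u z) z :=
      (((hasDerivAt_id z).sub_const z₀).pow (k + 1)).smul h3.differentiableAt.hasDerivAt
    rw [EventuallyEq.deriv_eq h2, hd.deriv, h2.self_of_nhds, mul_smul_comm] at h1
    have h4 : (z - z₀) ^ k • g z = 0 := by
      rw [← sub_eq_zero] at h1
      rw [← h1]
      simp only [g, smul_add, smul_sub, smul_smul, Nat.add_sub_cancel, mul_one, pow_succ]
      rw [mul_comm ((z - z₀) ^ k)]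
      abel
    exact (smul_eq_zero.1 h4).resolve_left (pow_ne_zero _ (sub_ne_zero.2 hz))
  have := (hg.frequently_zero_iff_eventually_zero.1 hg0.frequently).self_of_nhds
  have hgz : g z₀ = ((k + 1 : ℕ) : ℂ) • u z₀ := by
    change _ + (z₀ - z₀) • _ = _
    rw [sub_self]
    exact (congrArg _ (zero_smul ℂ (deriv u z₀ - A z₀ * u z₀))).trans (add_zero _)
  rw [hgz] at this
  rcases (smul_eq_zero (R := ℂ) (M := Op n)).1 this with h | h
  · exact Nat.cast_ne_zero.2 k.succ_ne_zero h
  · exact hu0 h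

/-- `Y = (1 - Q) Q(z₀)` measures how far the fibre at `z₀` is from the fibre at `z`. Closedness
under differentiation means `Q'Q = 0`, so `Y' = -Q' Q(z₀) = -Q' Y`, and `Y` vanishes at `z₀`. -/
theorem HolAt.eventually_le_of_deriv_mem {S : Fam n ℂ} {z₀ : ℂ} (hS : HolAt S z₀)
    (h : ∀ᶠ z in 𝓝 z₀, ∀ s, AnalyticAt ℂ s z → (∀ᶠ w in 𝓝 z, s w ∈ S w) → deriv s z ∈ S z) :
    ∀ᶠ z in 𝓝 z₀, S z₀ ≤ S z := by
  obtain ⟨Q, hQ, hQS⟩ := hS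
  have hYan : AnalyticAt ℂ (fun z => (1 - Q z) * Q z₀) z₀ :=
    (analyticAt_const.sub hQ.an).mul analyticAt_const
  have h0 : (1 - Q z₀) * Q z₀ = 0 := by
    rw [sub_mul, one_mul, hQ.idem.self_of_nhds, sub_self]
  have hder : ∀ᶠ z in 𝓝 z₀, deriv (fun z => (1 - Q z) * Q z₀) z =
      (-deriv Q z) * ((1 - Q z) * Q z₀) := by
    filter_upwards [h, hQ.eventually, hQS.eventually_nhds] with z h1 h2 h3
    have hd : HasDerivAt (fun z => (1 - Q z) * Q z₀) ((-deriv Q z) * Q z₀) z := by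
      have := (h2.an.differentiableAt.hasDerivAt.const_sub 1).mul_const (Q z₀)
      simpa using this
    have hQQ : deriv Q z * Q z = 0 := by
      ext1 v
      have han : AnalyticAt ℂ (fun w => Q w v) z := h2.an.clm_apply analyticAt_const
      have e1 := h2.deriv_section han (Eventually.of_forall fun w => apply_mem_ran _ _)
      have e2 := h1 _ han (h3.mono fun w hw => hw ▸ apply_mem_ran _ _)
      rw [← h3.self_of_nhds, h2.mem_iff] at e2
      rw [e2] at e1
      simpa using e1
    rw [hd.deriv, ← mul_assoc, mul_sub, mul_one, neg_mul (deriv Q z) (Q z), hQQ, neg_zero,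
      sub_zero]
  filter_upwards [eventually_eq_zero_of_deriv_eq_mul hQ.an.deriv.neg hYan hder h0, hQS]
    with z h1 h2
  rw [← h2, ← hQS.self_of_nhds]
  rintro _ ⟨v, rfl⟩
  have h3 : (1 - Q z) (Q z₀ v) = 0 := congrArg (fun B : Op n => B v) h1
  rw [sub_apply, sub_eq_zero] at h3
  exact ⟨Q z₀ v, h3.symm⟩

variable {M : Type*} [TopologicalSpace M] [ChartedSpace ℂ M]

theorem idemAt_const {A : Op n} (hA : A * A = A) (z : ℂ) : IdemAt (fun _ => A) z :=
  ⟨analyticAt_const, Eventually.of_forall fun _ => hA⟩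

theorem ran_starProjection (L : Submodule ℂ (Cn n)) : ran L.starProjection = L :=
  L.range_starProjection

theorem starProjection_mul_self (L : Submodule ℂ (Cn n)) :
    L.starProjection * L.starProjection = L.starProjection :=
  L.isIdempotentElem_starProjection

theorem hol_const (L : Submodule ℂ (Cn n)) : Hol (fun _ : M => L) := fun _ =>
  ⟨fun _ => L.starProjection, idemAt_const (starProjection_mul_self L) _,
    Eventually.of_forall fun _ => ran_starProjection L⟩

variable [IsManifold 𝓘(ℂ, ℂ) ω M]

theorem osc_one_const_le (L : Submodule ℂ (Cn n)) :
    osc (fun _ : M => L) 1 ≤ fun _ => L := by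
  rw [osc_one_le_iff (hol_const L) (hol_const L)]
  refine ⟨le_rfl, fun p s hs => ?_⟩
  have h1 := (isHolSectionNear_chart_iff (E := fun _ => L) (s := s) (mem_chart_target ℂ p)).1
    (by rwa [(chartAt ℂ p).left_inv (mem_chart_source ℂ p)])
  rw [isHolSectionNear_iff] at h1
  have h2 := (idemAt_const (starProjection_mul_self L) _).deriv_section h1.1
    (h1.2.mono fun z hz => by rwa [ran_starProjection])
  rw [deriv_const, zero_apply, zero_add] at h2
  rw [zDeriv, iteratedDeriv_one, h2]
  exact (ran_starProjection L).le (apply_mem_ran _ _)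

/-- A subbundle which is closed under differentiation is constant. -/
theorem Hol.exists_const [ConnectedSpace M] {E : Fam n M} (hE : Hol E) (h : osc E 1 ≤ E) :
    ∃ L, E = fun _ => L := by
  obtain ⟨p₀⟩ := (inferInstance : Nonempty M)
  have hlc : IsLocallyConstant E := by
    refine hE.isLocallyConstant_of_rank fun p => ?_
    rw [eventually_nhds_chart]
    have := (hE p).eventually_le_of_deriv_mem ?_
    · rw [loc_self] at this
      exact this
    filter_upwards [eventually_target] with z hz s hs hsE
    have h1 := (isHolSectionNear_comp_chart hz).2 (isHolSectionNear_iff.2 ⟨hs, hsE⟩)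
    have h2 := (derivSpan_le_osc E 1).trans h ((chartAt ℂ p).symm z)
    change loc p (derivSpan E 1) z ≤ loc p E z at h2
    rw [loc_derivSpan E 1 hz] at h2
    simpa using h2 (zDeriv_mem_derivSpan hs hsE le_rfl)
  exact ⟨E p₀, funext fun q => hlc.apply_eq_of_preconnectedSpace q p₀⟩

end ConstantBundles

/-! ### Inequalities between gaps and ranks -/

section Gap

variable {n : ℕ} {M : Type*} [TopologicalSpace M] [ChartedSpace ℂ M] [IsManifold 𝓘(ℂ, ℂ) ω M]

theorem le_osc_one {E : Fam n M} (hE : Hol E) : E ≤ osc E 1 :=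
  ((osc_one_le_iff hE (hol_osc hE 1)).1 le_rfl).1

/-- Equality for `c ≥ 0`; for `c < 0` the adjunction applies, because `T⁽ᶜ⁾ = (T⁽ᶜ⁺¹⁾)⁽⁻¹⁾`. -/
theorem osc_osc_one_le {T : Fam n M} (hT : Hol T) (c : ℤ) :
    osc (osc T c) 1 ≤ osc T (c + 1) := by
  rcases le_or_gt 0 c with h | h
  · rw [hT.osc_add_one c h]
  · have h2 := hT.osc_sub_one (c + 1) (by omega)
    rw [add_sub_cancel_right] at h2
    rw [osc_one_le_iff_le (hol_osc hT _) (hol_osc hT _), h2]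

theorem osc_sub_le {T E : Fam n M} (hT : Hol T) (hE : Hol E) {c c' : ℤ} (hc' : c' ≤ 0)
    (h : osc T c ≤ osc E c') (k : ℕ) : osc T (c - k) ≤ osc E (c' - k) := by
  induction k with
  | zero => simpa using h
  | succ k ih =>
    have e : c' - (k + 1 : ℕ) = c' - k - 1 := by push_cast; ring
    rw [e, hE.osc_sub_one _ (by omega), ← osc_one_le_iff_le (hol_osc hT _) (hol_osc hE _)]
    refine ((osc_osc_one_le hT _).trans_eq ?_).trans ih
    push_cast
    congr 1
    ring

variable [ConnectedSpace M]

theorem gap_add {E : Fam n M} (hE : Hol E) : gap E + rk E = rk (osc E 1) := by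
  have := rk_mono hE (hol_osc hE 1) (le_osc_one hE)
  rw [gap]
  omega

theorem gap_add_rk_osc {E : Fam n M} (hE : Hol E) : gap E + rk (osc E (-1)) = rk E := by
  have h1 := rk_osc_one_add hE
  have h2 := gap_add hE
  omega

/-- Enlarging a bundle raises its gap by at most the added rank: the gap is rank `F` - rank `F⁽⁻¹⁾`,
and `B⁽⁻¹⁾ ⊆ F⁽⁻¹⁾`. -/
theorem gap_add_rk_le {B F : Fam n M} (hB : Hol B) (hF : Hol F) (h : B ≤ F) :
    gap F + rk B ≤ rk F + gap B := by
  have h1 := rk_mono (hol_osc hB (-1)) (hol_osc hF (-1)) (osc_mono h (-1))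
  have h2 := gap_add_rk_osc hB
  have h3 := gap_add_rk_osc hF
  omega

theorem gap_add_rk_le_of_osc_le {B F : Fam n M} (hB : Hol B) (hF : Hol F) (h : osc B 1 ≤ F) :
    gap B + rk B ≤ rk F := by
  rw [gap_add hB]
  exact rk_mono (hol_osc hB 1) hF h

/-- The corank of `(E⁽¹⁾)⁽⁻¹⁾` in `E⁽¹⁾` is the gap of `E⁽¹⁾`, and `(E⁽¹⁾)⁽⁻¹⁾` contains `E`. -/
theorem gap_osc_one_le {E : Fam n M} (hE : Hol E) : gap (osc E 1) ≤ gap E := by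
  have h1 := gap_add_rk_osc (hol_osc hE 1)
  have h2 := gap_add hE
  have h3 := rk_mono hE (hol_osc (hol_osc hE 1) (-1))
    ((osc_one_le_iff_le hE (hol_osc hE 1)).1 le_rfl)
  omega

theorem gap_osc_neg_one_le {E : Fam n M} (hE : Hol E) : gap (osc E (-1)) ≤ gap E := by
  have h1 := gap_add_rk_osc hE
  have h2 := gap_add_rk_le_of_osc_le (hol_osc hE (-1)) hE
    ((osc_one_le_iff_le (hol_osc hE (-1)) hE).2 le_rfl)
  omega

theorem gap_osc_le {T : Fam n M} (hT : Hol T) (c : ℤ) : gap (osc T c) ≤ gap T := by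
  induction c using Int.induction_on with
  | zero => rw [hT.osc_zero]
  | succ i ih =>
    rw [hT.osc_add_one _ (Int.natCast_nonneg i)]
    exact (gap_osc_one_le (hol_osc hT _)).trans ih
  | pred i ih =>
    rw [hT.osc_sub_one _ (by omega)]
    exact (gap_osc_neg_one_le (hol_osc hT _)).trans ih

theorem rk_osc_add_one_le {T : Fam n M} (hT : Hol T) (c : ℤ) :
    rk (osc T (c + 1)) ≤ rk (osc T c) + gap T := by
  rcases le_or_gt 0 c with h | h
  · rw [hT.osc_add_one c h, ← gap_add (hol_osc hT c)]
    have := gap_osc_le hT c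
    omega
  · have h1 := gap_add_rk_osc (hol_osc hT (c + 1))
    rw [← hT.osc_sub_one (c + 1) (by omega), add_sub_cancel_right] at h1
    have := gap_osc_le hT (c + 1)
    omega

theorem rk_osc_le_add {T : Fam n M} (hT : Hol T) (c : ℤ) (k : ℕ) :
    rk (osc T (c + k)) ≤ rk (osc T c) + k * gap T := by
  induction k with
  | zero => simp
  | succ k ih =>
    have := rk_osc_add_one_le hT (c + k)
    rw [add_assoc] at this
    push_cast
    rw [add_one_mul]
    omega

/-- For `c ≤ 0` the two sides are equal by the rank formula for `T⁽ᶜ⁻¹⁾ = (T⁽ᶜ⁾)⁽⁻¹⁾`. For `c > 0`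
the left side can only be smaller, because gaps do not grow under differentiation. -/
theorem gap_osc_add_rk_le {T : Fam n M} (hT : Hol T) (c : ℤ) :
    gap (osc T c) + rk (osc T (c - 1)) ≤ rk (osc T c) := by
  rcases le_or_gt c 0 with h | h
  · rw [hT.osc_sub_one c h, gap_add_rk_osc (hol_osc hT c)]
  · have e := hT.osc_add_one (c - 1) (by omega)
    rw [sub_add_cancel] at e
    rw [e, ← gap_add (hol_osc hT _)]
    have := gap_osc_one_le (hol_osc hT (c - 1))
    omega

theorem rk_const {n : ℕ} {M : Type*} [TopologicalSpace M] [ConnectedSpace M]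
    (L : Submodule ℂ (Cn n)) : rk (fun _ : M => L) = Module.finrank ℂ L := by
  simp [rk]

theorem gap_const (L : Submodule ℂ (Cn n)) : gap (fun _ : M => L) = 0 := by
  have h1 := gap_add_rk_le_of_osc_le (hol_const (M := M) L) (hol_const L) (osc_one_const_le L)
  omega

theorem osc_one_le_of_gap_eq_zero {E : Fam n M} (hE : Hol E) (h : gap E = 0) : osc E 1 ≤ E := by
  have h1 := gap_add hE
  exact (eq_of_le_of_rk_le hE (hol_osc hE 1) (le_osc_one hE) (by omega)).ge

/-- The filled fibrewise sum. The rank bound through a common subbundle `C` replaces the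
construction of an intersection bundle. -/
theorem exists_hol_sup {A B : Fam n M} (hA : Hol A) (hB : Hol B) :
    ∃ S, Hol S ∧ A ≤ S ∧ B ≤ S ∧ (∀ F, Hol F → A ≤ F → B ≤ F → S ≤ F) ∧
      ∀ C, Hol C → C ≤ A → C ≤ B → rk S + rk C ≤ rk A + rk B := by
  have hgen : GenHol fun q => A q ⊔ B q := by
    intro p
    obtain ⟨t, ht, htB⟩ := holAt_iff_exists_frame.1 ⟨hB p, rfl⟩
    refine ((hA p).genHolAt.sup_span ht).congr ?_
    filter_upwards [eventually_nhdsWithin_of_eventually_nhds htB] with z hz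
    rw [hz.2]
    rfl
  refine ⟨_, hgen.hol_fill, hA.le_fill fun p => Eventually.of_forall fun q => le_sup_left,
    hB.le_fill fun p => Eventually.of_forall fun q => le_sup_right, fun F hF h1 h2 =>
    hF.fill_le fun p => Eventually.of_forall fun q => sup_le (h1 q) (h2 q), fun C hC h1 h2 => ?_⟩
  obtain ⟨p⟩ := (inferInstance : Nonempty M)
  obtain ⟨q, hq⟩ := (hgen.fill_eq p).exists
  have h3 := Submodule.finrank_sup_add_finrank_inf_eq (A q) (B q)
  have h4 := Submodule.finrank_mono (le_inf (h1 q) (h2 q))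
  rw [← hgen.hol_fill.finrank q, ← hC.finrank q, ← hA.finrank q, ← hB.finrank q, hq, ← h3]
  exact Nat.add_le_add_left h4 _

end Gap

/-! ### The single step of the algorithm -/

section SingleStep

variable {n : ℕ} {M : Type*} [TopologicalSpace M] [ChartedSpace ℂ M] [IsManifold 𝓘(ℂ, ℂ) ω M]
  [ConnectedSpace M]

/-- A bundle found from `(T, E, j, i, g, d)` lies between `T⁽ʲ⁾` and `E⁽⁻ⁱ⁾`, has rank `d`, and
its rank grows by at most `g` under differentiation. -/
theorem AlgStep.spec {T E F : Fam n M} {j i : ℤ} {g d : ℕ} (hT : Hol T) (hE : Hol E) (hi : 0 ≤ i)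
    (hTE : osc T j ≤ osc E (-i)) (hg : gap T ≤ g) (h : AlgStep T E j i g d F) :
    Hol F ∧ rk F = d ∧ gap F ≤ g ∧ osc T j ≤ F ∧ F ≤ osc E (-i) := by
  obtain ⟨hTF, h⟩ := h
  split_ifs at h with hg0 hd
  · obtain ⟨hFE, L, rfl, rfl⟩ := h
    exact ⟨hol_const L, rk_const L, (gap_const L).trans_le (Nat.zero_le _), hTF, hFE⟩
  · subst h
    exact ⟨hol_osc hT j, hd, (gap_osc_le hT j).trans hg, le_rfl, hTE⟩
  · obtain ⟨k₀, ⟨hk₀, hmax⟩, G, hG0, hG, rfl⟩ := h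
    simp only [Set.mem_ofPred_eq] at hk₀
    -- Maximality of `k₀`: the index `k₀ + 1` fails the strict inequality. This is what bounds the
    -- gap of the first bundle of the chain.
    have hk1 : d ≤ rk (osc T (j - (k₀ + 1 : ℕ))) + (k₀ + 1) * g := by
      by_contra! hlt
      have : k₀ + 1 ≤ k₀ := hmax hlt
      omega
    have key : ∀ l ≤ k₀, Hol (G l) ∧ rk (G l) = d - (k₀ - l) * g ∧ gap (G l) ≤ g ∧
        G l ≤ osc E (-i - k₀ + l) := by
      intro l hl
      induction l with
      | zero =>
        rw [addSections_iff (hol_osc hT _) (hol_osc hE _) (osc_sub_le hT hE (by omega) hTE k₀)]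
          at hG0
        obtain ⟨h1, h2, h3, h4⟩ := hG0
        refine ⟨h1, h2, ?_, by simpa using h4⟩
        -- The gap of `G 0` is at most `d - k₀ g` - rank `T⁽ʲ⁻ᵏ⁰⁾` + gap `T⁽ʲ⁻ᵏ⁰⁾`, hence at most `d
        -- - k₀ g` - rank `T⁽ʲ⁻ᵏ⁰⁻¹⁾`, which is at most `g`.
        have h5 := gap_add_rk_le (hol_osc hT _) h1 h3
        have h6 := gap_osc_add_rk_le hT (j - k₀)
        have e : j - (k₀ + 1 : ℕ) = j - k₀ - 1 := by push_cast; ring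
        rw [e, add_one_mul] at hk1
        omega
      | succ l ih =>
        obtain ⟨h1, h2, h3, h4⟩ := ih (by omega)
        have hle : osc (G l) 1 ≤ osc E (-i - k₀ + (l + 1)) := by
          rw [← add_assoc]
          exact (osc_mono h4 1).trans (osc_osc_one_le hE _)
        have h := hG l (by omega)
        rw [addSections_iff (hol_osc h1 1) (hol_osc hE _) hle] at h
        obtain ⟨h5, h6, h7, h8⟩ := h
        refine ⟨h5, h6, ?_, by exact_mod_cast h8⟩
        -- The rank added to `(G l)⁽¹⁾`, plus its gap, is at most rank `G (l+1)` - rank `G l` = `g`.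
        have h9 := gap_add_rk_le (hol_osc h1 1) h5 h7
        have h10 := gap_osc_one_le h1
        have h11 := gap_add h1
        have e : k₀ - l = (k₀ - (l + 1)) + 1 := by omega
        have hle2 : (k₀ - l) * g ≤ k₀ * g := Nat.mul_le_mul_right g (Nat.sub_le _ _)
        rw [e, add_one_mul] at h2 hle2
        omega
    obtain ⟨h1, h2, h3, h4⟩ := key k₀ le_rfl
    refine ⟨h1, by simpa using h2, h3, hTF, by simpa using h4⟩

/-- The chain is built downwards from its last member. As `F` has gap at most `g`, `F⁽⁻¹⁾` has rank
at least `d - g`, and the rank hypothesis with `k = 1` gives rank `T⁽ᶜ⁻¹⁾ < d - g`. Hence some `F'`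
of rank `d - g` lies between them. From `F'⁽¹⁾ ⊆ F` its gap is again at most `g`, so the
construction repeats with `c`, `c'`, `d` lowered. -/
theorem exists_chain {T E : Fam n M} (hT : Hol T) (hE : Hol E) {g : ℕ} (k₀ : ℕ) :
    ∀ {c c' : ℤ} {d : ℕ} {F : Fam n M}, c' ≤ 0 → Hol F → rk F = d → gap F ≤ g → osc T c ≤ F →
      F ≤ osc E c' → (∀ k ≤ k₀, rk (osc T (c - k)) + k * g < d) →
      ∃ G : ℕ → Fam n M, G k₀ = F ∧
        (∀ l ≤ k₀, Hol (G l) ∧ rk (G l) = d - (k₀ - l) * g ∧ osc T (c - k₀ + l) ≤ G l ∧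
          G l ≤ osc E (c' - k₀ + l)) ∧
        ∀ l < k₀, osc (G l) 1 ≤ G (l + 1) := by
  induction k₀ with
  | zero =>
    intro c c' d F hc' hF hd hg hTF hFE hk
    refine ⟨fun _ => F, rfl, fun l hl => ?_, fun l hl => absurd hl (Nat.not_lt_zero l)⟩
    obtain rfl := Nat.le_zero.1 hl
    simpa using ⟨hF, hd, hTF, hFE⟩
  | succ k₀ ih =>
    intro c c' d F hc' hF hd hg hTF hFE hk
    have hTF' : osc T (c - 1) ≤ osc F (-1) := by
      rw [← osc_one_le_iff_le (hol_osc hT _) hF]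
      refine (osc_osc_one_le hT _).trans ?_
      rwa [sub_add_cancel]
    have h1 := hk 1 (by omega)
    have h2 := gap_add_rk_osc hF
    rw [one_mul, Nat.cast_one] at h1
    obtain ⟨F', hF', hd', hTF'', hF'F⟩ := exists_hol_between (hol_osc hT (c - 1))
      (hol_osc hF (-1)) hTF' (e := d - g) (by omega) (by omega)
    have hUF : osc F' 1 ≤ F := (osc_one_le_iff_le hF' hF).2 hF'F
    have hg' : gap F' ≤ g := by
      have := gap_add_rk_le_of_osc_le hF' hF hUF
      omega
    have hF'E : F' ≤ osc E (c' - 1) := by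
      rw [hE.osc_sub_one c' hc']
      exact hF'F.trans (osc_mono hFE (-1))
    obtain ⟨G, hG1, hG2, hG3⟩ := ih (by omega) hF' hd' hg' hTF'' hF'E fun k hkk => by
      have := hk (k + 1) (by omega)
      rw [add_one_mul] at this
      have e : c - 1 - k = c - (k + 1 : ℕ) := by push_cast; ring
      rw [e]
      omega
    refine ⟨fun l => if l ≤ k₀ then G l else F, by simp, fun l hl => ?_, fun l hl => ?_⟩
    · rcases hl.lt_or_eq with hl | rfl
      · have hl' : l ≤ k₀ := by omega
        obtain ⟨h3, h4, h5, h6⟩ := hG2 l hl'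
        simp only [hl', if_true]
        have e1 : c - (k₀ + 1 : ℕ) + l = c - 1 - k₀ + l := by push_cast; ring
        have e2 : c' - (k₀ + 1 : ℕ) + l = c' - 1 - k₀ + l := by push_cast; ring
        have e3 : k₀ + 1 - l = k₀ - l + 1 := by omega
        rw [e1, e2, e3, add_one_mul]
        exact ⟨h3, by omega, h5, h6⟩
      · simpa using ⟨hF, hd, hTF, hFE⟩
    · have hl' : l ≤ k₀ := by omega
      simp only [hl', if_true]
      split_ifs with h
      · exact hG3 l (by omega)
      · obtain rfl : l = k₀ := by omega
        rwa [hG1]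

/-- Conversely, every bundle `F` of rank `d` between `T⁽ʲ⁾` and `E⁽⁻ⁱ⁾` with `g_F ≤ g` is found
from `(T, E, j, i, g, d)`. -/
theorem algStep_of_between {T E F : Fam n M} {j i : ℤ} {g d : ℕ} (hT : Hol T) (hE : Hol E)
    (hF : Hol F) (hi : 0 ≤ i) (hd : rk F = d) (hgT : gap T ≤ g) (hgF : gap F ≤ g)
    (hTF : osc T j ≤ F) (hFE : F ≤ osc E (-i)) : AlgStep T E j i g d F := by
  refine ⟨hTF, ?_⟩
  split_ifs with hg0 hrk
  · obtain ⟨L, rfl⟩ := hF.exists_const (osc_one_le_of_gap_eq_zero hF (by omega))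
    exact ⟨hFE, L, by rwa [rk_const] at hd, rfl⟩
  · exact (eq_of_le_of_rk_le (hol_osc hT j) hF hTF (by omega)).symm
  · have hlt : rk (osc T j) < d := lt_of_le_of_ne (hd ▸ rk_mono (hol_osc hT j) hF hTF) hrk
    set S : Set ℕ := {k : ℕ | rk (osc T (j - k)) + k * g < d} with hS
    have hne : S.Nonempty := ⟨0, by simpa [hS] using hlt⟩
    have hbdd : BddAbove S := by
      refine ⟨d, fun k hk => ?_⟩
      have h1 : rk (osc T (j - k)) + k * g < d := hk
      have h2 : k * 1 ≤ k * g := Nat.mul_le_mul_left k (Nat.one_le_iff_ne_zero.2 hg0)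
      omega
    -- Each step backwards lowers the rank of `T⁽ʲ⁻ᵏ⁾` by at most `gap T ≤ g`. So the strict
    -- inequality at the maximum of `S` holds for all smaller `k`.
    have hmono : Monotone fun k : ℕ => rk (osc T (j - k)) + k * g := by
      refine monotone_nat_of_le_succ fun k => ?_
      have h1 := rk_osc_add_one_le hT (j - (k + 1 : ℕ))
      have e : j - (k + 1 : ℕ) + 1 = j - k := by push_cast; ring
      rw [e] at h1
      rw [add_one_mul]
      omega
    have hmem : sSup S ∈ S := Nat.sSup_mem hne hbdd
    obtain ⟨G, hG1, hG2, hG3⟩ := exists_chain hT hE (sSup S) (by omega) hF hd hgF hTF hFE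
      fun k hk => lt_of_le_of_lt (hmono hk) hmem
    refine ⟨sSup S, ⟨hmem, fun k hk => le_csSup hbdd hk⟩, G, ?_, fun l hl => ?_, hG1⟩
    · obtain ⟨h1, h2, h3, h4⟩ := hG2 0 (Nat.zero_le _)
      simp only [Nat.cast_zero, add_zero, Nat.sub_zero] at h2 h3 h4
      rw [addSections_iff (hol_osc hT _) (hol_osc hE _) (h3.trans h4)]
      exact ⟨h1, h2, h3, h4⟩
    · obtain ⟨h1, -, -, -⟩ := hG2 l hl.le
      obtain ⟨h5, h6, h7, h8⟩ := hG2 (l + 1) hl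
      push_cast at h8
      rw [addSections_iff (hol_osc h1 1) (hol_osc hE _) ((hG3 l hl).trans h8)]
      exact ⟨h5, h6, hG3 l hl, h8⟩

/-- The rank is lowered by one at a time, starting from `E`. If the gap of `E` is below `g`, any
hyperplane bundle containing `P` will do, since its gap exceeds that of `E` by at most one. If the
gap equals `g`, the hyperplane bundle is chosen to contain `E⁽⁻¹⁾` too, and then its gap is at most
that of `E`. -/
theorem exists_between_of_gap_lt {P : Fam n M} (hP : Hol P) {g e : ℕ} (hgP : gap P < g)
    (he : rk P ≤ e) (k : ℕ) : ∀ {E : Fam n M}, Hol E → P ≤ E → gap E ≤ g → rk E = e + k →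
      ∃ F, Hol F ∧ rk F = e ∧ gap F ≤ g ∧ P ≤ F ∧ F ≤ E := by
  induction k with
  | zero => exact fun {E} hE hPE hgE hr => ⟨E, hE, hr, hgE, hPE, le_rfl⟩
  | succ k ih =>
    intro E hE hPE hgE hr
    obtain ⟨E', hE', hr', hPE', hE'E, hg'⟩ : ∃ E', Hol E' ∧ rk E' = e + k ∧ P ≤ E' ∧ E' ≤ E ∧
        gap E' ≤ g := by
      rcases hgE.lt_or_eq with hlt | heq
      · obtain ⟨E', hE', hr', h1, h2⟩ := exists_hol_between hP hE hPE (e := e + k) (by omega)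
          (by omega)
        refine ⟨E', hE', hr', h1, h2, ?_⟩
        have h3 := gap_add_rk_le_of_osc_le hE' (hol_osc hE 1) (osc_mono h2 1)
        rw [← gap_add hE] at h3
        omega
      -- The sum `S` of `E⁽⁻¹⁾` and `P` is proper: its rank is at most rank `E⁽⁻¹⁾` + rank `P` -
      -- rank `P⁽⁻¹⁾` = rank `E` - `g` + `gap P`. Here `gap P < g` is indispensable.
      · obtain ⟨S, hS, h1, h2, h3, h4⟩ := exists_hol_sup (hol_osc hE (-1)) hP
        have h5 := h4 _ (hol_osc hP (-1)) (osc_mono hPE (-1)) (osc_neg_one_le P)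
        have h6 := gap_add_rk_osc hE
        have h7 := gap_add_rk_osc hP
        obtain ⟨E', hE', hr', h8, h9⟩ := exists_hol_between hS hE
          (h3 E hE (osc_neg_one_le E) hPE) (e := e + k) (by omega) (by omega)
        refine ⟨E', hE', hr', h2.trans h8, h9, ?_⟩
        have h10 := rk_osc_one_add_le hE hE' h9 (h1.trans h8)
        rw [← gap_add hE'] at h10
        omega
    obtain ⟨F, hF, h1, h2, h3, h4⟩ := ih hE' hPE' hg' hr'
    exact ⟨F, hF, h1, h2, h3, h4.trans hE'E⟩

/-- The case `g = 0`, where the strict gap inequality is unavailable. Gap zero means constant, and a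
fibre of any intermediate bundle serves as the constant subspace. -/
theorem exists_const_between {P E : Fam n M} (hP : Hol P) (hE : Hol E) (hPE : P ≤ E)
    (hgP : gap P = 0) (hgE : gap E = 0) {e : ℕ} (h1 : rk P ≤ e) (h2 : e ≤ rk E) :
    ∃ F, Hol F ∧ rk F = e ∧ gap F = 0 ∧ P ≤ F ∧ F ≤ E := by
  obtain ⟨L, rfl⟩ := hP.exists_const (osc_one_le_of_gap_eq_zero hP hgP)
  obtain ⟨L', rfl⟩ := hE.exists_const (osc_one_le_of_gap_eq_zero hE hgE)
  obtain ⟨p⟩ := (inferInstance : Nonempty M)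
  obtain ⟨F, hF, hr, h3, h4⟩ := exists_hol_between hP hE hPE h1 h2
  refine ⟨fun _ => F p, hol_const _, ?_, gap_const _, fun _ => h3 p, fun _ => h4 p⟩
  rw [rk_const, hF.finrank, hr]

end SingleStep

/-! ### The zero bundle and the full bundle -/

section TrivialBundles

variable {n : ℕ} {M : Type*} [TopologicalSpace M]

theorem hol_bot [ChartedSpace ℂ M] : Hol (⊥ : Fam n M) := hol_const ⊥

theorem hol_top [ChartedSpace ℂ M] : Hol (⊤ : Fam n M) := hol_const ⊤

variable [ConnectedSpace M]

theorem rk_bot : rk (⊥ : Fam n M) = 0 := by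
  have := rk_const (M := M) (⊥ : Submodule ℂ (Cn n))
  rwa [finrank_bot] at this

theorem rk_top : rk (⊤ : Fam n M) = n := by
  have := rk_const (M := M) (⊤ : Submodule ℂ (Cn n))
  rwa [finrank_top, finrank_euclideanSpace_fin] at this

end TrivialBundles

/-! ### The recursion: invariants, existence of steps, equivalence with flags -/

section Algorithm

variable {n : ℕ} {M : Type*} [TopologicalSpace M] [ChartedSpace ℂ M] [IsManifold 𝓘(ℂ, ℂ) ω M]

theorem osc_add_le_iff {T E : Fam n M} (hT : Hol T) (hE : Hol E) (k : ℕ) :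
    ∀ {c c' : ℤ}, 0 ≤ c → c' ≤ 0 → (osc T (c + k) ≤ osc E c' ↔ osc T c ≤ osc E (c' - k)) := by
  induction k with
  | zero => intro c c' _ _; simp
  | succ k ih =>
    intro c c' hc hc'
    have e1 : c + (k + 1 : ℕ) = c + 1 + k := by push_cast; ring
    have e2 : c' - (k + 1 : ℕ) = c' - k - 1 := by push_cast; ring
    rw [e1, e2, ih (by omega) hc', hT.osc_add_one c hc, hE.osc_sub_one (c' - k) (by omega),
      osc_one_le_iff_le (hol_osc hT _) (hol_osc hE _)]

theorem osc_sub_le_iff {T E : Fam n M} (hT : Hol T) (hE : Hol E) {a m b : ℤ} (h1 : a ≤ m)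
    (h2 : m ≤ b) : osc T (b - a) ≤ E ↔ osc T (m - a) ≤ osc E (-(b - m)) := by
  have h := osc_add_le_iff hT hE (b - m).toNat (c := m - a) (c' := 0) (by omega) le_rfl
  rw [hE.osc_zero, Int.toNat_of_nonneg (by omega)] at h
  have e : m - a + (b - m) = b - a := by ring
  rwa [e, zero_sub] at h

theorem le_osc_natCast {T : Fam n M} (hT : Hol T) (k : ℕ) : T ≤ osc T k := by
  induction k with
  | zero => exact hT.osc_zero.ge
  | succ k ih =>
    push_cast
    rw [hT.osc_add_one _ (Int.natCast_nonneg k)]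
    exact ih.trans (le_osc_one (hol_osc hT _))

theorem le_osc_of_nonneg {T : Fam n M} (hT : Hol T) {k : ℤ} (hk : 0 ≤ k) : T ≤ osc T k := by
  lift k to ℕ using hk
  exact le_osc_natCast hT k

theorem exists_isLastMin (d : ℤ → ℕ) {a b : ℤ} (h : a + 1 < b) : ∃ m, IsLastMin d a b m := by
  obtain ⟨m, hm, hmin⟩ := Finset.exists_min_image (Finset.Ioo a b)
    -- Lexicographic minimisation: among equal jumps the negated index selects the largest one.
    (fun i => toLex (jump d i, -i)) ⟨a + 1, by simp; omega⟩
  simp only [Finset.mem_Ioo, Prod.Lex.toLex_le_toLex, and_imp] at hm hmin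
  refine ⟨m, hm.1, hm.2, fun i h1 h2 => ?_, fun i h1 h2 => ?_⟩
  · have := hmin i h1 h2
    omega
  · have := hmin i (hm.1.trans h1) h2
    omega

theorem Monotone.add_jump {d : ℤ → ℕ} (hd : Monotone d) (i : ℤ) : d i + jump d i = d (i + 1) := by
  have := hd (show i ≤ i + 1 by omega)
  rw [jump]
  omega

variable [ConnectedSpace M]

theorem gap_bot : gap (⊥ : Fam n M) = 0 := gap_const _

theorem gap_top : gap (⊤ : Fam n M) = 0 := gap_const _

theorem osc_bot_le (E : Fam n M) {k : ℤ} (hk : 0 ≤ k) :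
    osc (⊥ : Fam n M) k ≤ E := by
  have hb : Hol (⊥ : Fam n M) := hol_bot
  have h1 := rk_osc_le_add hb 0 k.toNat
  rw [gap_bot, hb.osc_zero, rk_bot, Int.toNat_of_nonneg hk, zero_add, mul_zero, add_zero] at h1
  rw [← eq_of_le_of_rk_le hb (hol_osc hb k) bot_le (by rwa [rk_bot])]
  exact bot_le

/-- The properties of the dimensions `dᵢ` which the algorithm depends on. -/
structure IsDimSeq (n : ℕ) (r k : ℤ) (d : ℤ → ℕ) : Prop where
  mono : Monotone d
  eq_zero : ∀ i < -r, d i = 0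
  eq_top : ∀ i ≥ k, d i = n

/-- What is known about the bundles `A a` and `A b` when the recursion reaches `(a, b)`. -/
structure StageInv (d : ℤ → ℕ) (A : ℤ → Fam n M) (a b : ℤ) : Prop where
  hol_left : Hol (A a)
  rk_left : rk (A a) = d a
  hol_right : Hol (A b)
  rk_right : rk (A b) = d b
  gap_left : gap (A a) ≤ jump d a
  jump_left : ∀ i, a < i → i < b → jump d a ≤ jump d i
  gap_lt : ∀ i, a < i → i < b → gap (A a) < jump d i ∨ gap (A a) = 0
  gap_right : ∀ i, a < i → i < b → gap (A b) ≤ jump d i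
  osc_le : osc (A a) (b - a) ≤ A b

variable {d : ℤ → ℕ} {A : ℤ → Fam n M} {r k : ℤ}

/-- Each derivative raises the rank by at most the gap of `A a`, hence by at most `h_a`, which does
not exceed `h` at any index in the range; the first derivative is compared with `h_a` itself. -/
theorem StageInv.rk_osc_left_le {a b : ℤ} (h : StageInv d A a b) (hd : Monotone d) (j : ℕ)
    (hj : a + j ≤ b) : rk (osc (A a) j) ≤ d (a + j) := by
  induction j with
  | zero => simpa [h.hol_left.osc_zero] using h.rk_left.le
  | succ j ih =>
    push_cast at hj ⊢
    have h1 := rk_osc_add_one_le h.hol_left j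
    have h2 := ih (by omega)
    have h3 := Monotone.add_jump hd (a + j)
    have h4 : jump d a ≤ jump d (a + j) := by
      rcases j.eq_zero_or_pos with rfl | hj0
      · simp
      · exact h.jump_left _ (by omega) (by omega)
    have h5 := h.gap_left
    rw [← add_assoc]
    omega

/-- The mirror image: each step down loses at most the gap of `A b`, which is bounded by the jump at
every index strictly inside the range. -/
theorem StageInv.le_rk_osc_right {a b : ℤ} (h : StageInv d A a b) (hd : Monotone d) (j : ℕ)
    (hj : a < b - j) : d (b - j) ≤ rk (osc (A b) (-j)) := by
  induction j with
  | zero => simpa [h.hol_right.osc_zero] using h.rk_right.ge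
  | succ j ih =>
    push_cast at hj ⊢
    have h1 := rk_osc_add_one_le h.hol_right (-(j + 1 : ℤ))
    have e : -(j + 1 : ℤ) + 1 = -j := by ring
    have e2 : b - (j + 1 : ℤ) + 1 = b - j := by ring
    have h2 := ih (by omega)
    have h3 := Monotone.add_jump hd (b - (j + 1 : ℤ))
    have h4 := h.gap_right (b - (j + 1 : ℤ)) (by omega) (by omega)
    rw [e] at h1
    rw [e2] at h3
    omega

theorem StageInv.admissible {a b m : ℤ} (h : StageInv d A a b) (hd : Monotone d)
    (hm : IsLastMin d a b m) :
    Admissible (A a) (A b) (m - a) (b - m) (jump d m) (d m) := by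
  obtain ⟨h1, h2, -, -⟩ := hm
  have h3 := h.rk_osc_left_le hd (m - a).toNat (by omega)
  have h4 := h.le_rk_osc_right hd (b - m).toNat (by omega)
  rw [Int.toNat_of_nonneg (by omega)] at h3 h4
  rw [add_sub_cancel] at h3
  rw [sub_sub_cancel] at h4
  refine ⟨⟨_, h.hol_left.isHolSubbundle⟩, ⟨_, h.hol_right.isHolSubbundle⟩,
    (le_osc_of_nonneg h.hol_left (by omega)).trans h.osc_le, by omega, by omega,
    h.gap_left.trans (h.jump_left m h1 h2), h.gap_right m h1 h2, ?_, h3, h4⟩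
  exact (osc_sub_le_iff h.hol_left h.hol_right h1.le h2.le).1 h.osc_le

/-- For `h_m = 0` both neighbours have gap zero and a constant bundle is taken. For `h_m > 0` the
alternative `gap_lt` gives a gap strictly below `h_m` on the left, as needed to descend from the
right-hand bundle. -/
theorem StageInv.exists_stepAt {a b m : ℤ} (h : StageInv d A a b) (hd : Monotone d)
    (hm : IsLastMin d a b m) : ∃ F, StepAt d A a b m F := by
  obtain ⟨-, -, -, -, -, h1, h2, h3, h4, h5⟩ := h.admissible hd hm
  have hT := hol_osc h.hol_left (m - a)
  have hE := hol_osc h.hol_right (-(b - m))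
  have h6 := gap_osc_le h.hol_left (m - a)
  have h7 := gap_osc_le h.hol_right (-(b - m))
  obtain ⟨F, hF, hr, hg, hTF, hFE⟩ : ∃ F, Hol F ∧ rk F = d m ∧ gap F ≤ jump d m ∧
      osc (A a) (m - a) ≤ F ∧ F ≤ osc (A b) (-(b - m)) := by
    rcases (jump d m).eq_zero_or_pos with h0 | h0
    · rw [h0]
      simpa using exists_const_between hT hE h3 (by omega) (by omega) h4 h5
    · refine exists_between_of_gap_lt hT ?_ h4 (rk (osc (A b) (-(b - m))) - d m) hE h3 (by omega)
        (by omega)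
      have := h.gap_lt m hm.1 hm.2.1
      omega
  exact ⟨F, algStep_of_between h.hol_left h.hol_right hF (sub_nonneg.2 hm.2.1.le) hr h1 hg hTF hFE⟩

/-- The range on the left keeps its left bundle, and the gap of `A m` is bounded there by minimality
of `h_m`. On the right `A m` becomes the left bundle, and its gap is strictly below all later jumps
because `m` is the last minimum. -/
theorem StageInv.step {a b m : ℤ} (h : StageInv d A a b) (hd : Monotone d)
    (hm : IsLastMin d a b m) (hs : StepAt d A a b m (A m)) :
    StageInv d A a m ∧ StageInv d A m b := by
  obtain ⟨-, -, -, -, -, h1, h2, h3, h4, h5⟩ := h.admissible hd hm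
  obtain ⟨hF, hr, hg, hTF, hFE⟩ := AlgStep.spec h.hol_left h.hol_right (sub_nonneg.2 hm.2.1.le)
    h3 h1 hs
  obtain ⟨ha, hb, hmin, hlast⟩ := hm
  refine ⟨⟨h.hol_left, h.rk_left, hF, hr, h.gap_left,
    fun i hi hi' => h.jump_left i hi (hi'.trans hb),
    fun i hi hi' => h.gap_lt i hi (hi'.trans hb),
    fun i hi hi' => hg.trans (hmin i hi (hi'.trans hb)), hTF⟩,
    ⟨hF, hr, h.hol_right, h.rk_right, hg, fun i hi hi' => (hlast i hi hi').le,
    fun i hi hi' => Or.inl (hg.trans_lt (hlast i hi hi')),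
    fun i hi hi' => h.gap_right i (ha.trans hi) hi', ?_⟩⟩
  rw [osc_sub_le_iff hF h.hol_right le_rfl hb.le, sub_self, hF.osc_zero]
  exact hFE

theorem StageInv.init (hd : IsDimSeq n r k d) (hA : HasEnds r k A) :
    StageInv d A (-r - 2) k := by
  have h1 : A (-r - 2) = ⊥ := hA.1 _ (by omega)
  have h2 : A k = ⊤ := hA.2 _ le_rfl
  have h3 : d (-r - 2) = 0 := hd.eq_zero _ (by omega)
  have h4 : d k = n := hd.eq_top _ le_rfl
  -- The reason for starting at `-r - 2` and not at `-r - 1`: both dimensions vanish, so the jump at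
  -- the left end is zero and `jump_left` holds trivially.
  have h5 : jump d (-r - 2) = 0 := by
    rw [jump, hd.eq_zero _ (by omega)]
    omega
  constructor <;> simp only [h1, h2, h3, h4, h5, hol_bot, hol_top, rk_bot, rk_top, gap_bot,
    gap_top, le_refl, zero_le, implies_true, or_true, le_top]

theorem Stage.inv (hd : IsDimSeq n r k d) (hA : HasEnds r k A) {a b : ℤ}
    (h : Stage d r k A a b) : StageInv d A a b := by
  induction h with
  | init => exact StageInv.init hd hA
  | left _ hm hs ih => exact (ih.step hd.mono hm hs).1
  | right _ hm hs ih => exact (ih.step hd.mono hm hs).2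

/-- Induction on the length of the range: when no index is left, `b = a + 1` and the invariant
`osc_le` is super-horizontality at `a`. -/
theorem Produced.isSuperHorizontalFlag (hd : IsDimSeq n r k d) (hA : Produced d r k A) :
    IsSuperHorizontalFlag d r k A := by
  obtain ⟨hends, hA⟩ := hA
  have key : ∀ (N : ℕ) (a b : ℤ), (b - a).toNat ≤ N → Stage d r k A a b → ∀ i, a ≤ i → i < b →
      Hol (A i) ∧ rk (A i) = d i ∧ Hol (A (i + 1)) ∧ osc (A i) 1 ≤ A (i + 1) := by
    intro N
    induction N with
    | zero =>
      intro a b hN _ i h1 h2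
      omega
    | succ N ih =>
      intro a b hN hst i h1 h2
      have hinv := hst.inv hd hends
      rcases (show a + 1 ≤ b by omega).eq_or_lt with rfl | hlt
      · obtain rfl : i = a := by omega
        refine ⟨hinv.hol_left, hinv.rk_left, hinv.hol_right, ?_⟩
        simpa using hinv.osc_le
      · obtain ⟨m, hm⟩ := exists_isLastMin d hlt
        have hs := hA a b m hst hm
        have h3 := hm.1
        have h4 := hm.2.1
        rcases lt_or_ge i m with h | h
        · exact ih a m (by omega) (.left hst hm hs) i h1 h
        · exact ih m b (by omega) (.right hst hm hs) i h h2
  have hall : ∀ i, Hol (A i) ∧ rk (A i) = d i ∧ Hol (A (i + 1)) ∧ osc (A i) 1 ≤ A (i + 1) := by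
    intro i
    rcases lt_or_ge i (-r - 2) with h | h
    · rw [hends.1 i (by omega), hends.1 (i + 1) (by omega), hd.eq_zero i (by omega)]
      exact ⟨hol_bot, rk_bot, hol_bot, osc_bot_le _ zero_le_one⟩
    · rcases lt_or_ge i k with h' | h'
      · exact key _ _ _ le_rfl .init i h h'
      · rw [hends.2 i h', hends.2 (i + 1) (by omega), hd.eq_top i h']
        exact ⟨hol_top, rk_top, hol_top, le_top⟩
  refine ⟨hends, fun i => isHolSubbundle_iff.2 ⟨(hall i).1, (hall i).2.1⟩, fun i => ?_,
    fun i p s hs => ?_⟩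
  · exact ((osc_one_le_iff (hall i).1 (hall i).2.2.1).1 (hall i).2.2.2).1
  · exact ((osc_one_le_iff (hall i).1 (hall i).2.2.1).1 (hall i).2.2.2).2 p s hs

/-- Depends only on the order in which indices are treated, so it is available before anything is
known of the bundles; it bounds `gap T` for a given flag. -/
theorem Stage.jump_le {M : Type*} [TopologicalSpace M] [ChartedSpace ℂ M] {A : ℤ → Fam n M}
    (hd : IsDimSeq n r k d) {a b : ℤ} (h : Stage d r k A a b) :
    ∀ i, a < i → i < b → jump d a ≤ jump d i := by
  induction h with
  | init =>
    intro i _ _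
    rw [jump, hd.eq_zero _ (by omega)]
    omega
  | left _ hm _ ih => exact fun i h1 h2 => ih i h1 (h2.trans hm.2.1)
  | right _ hm _ ih => exact fun i h1 h2 => (hm.2.2.2 i h1 h2).le

/-- Super-horizontality gives `A_i⁽¹⁾ ⊆ A_{i+1}`, so the gap of `A_i` is at most `h_i`. Iterating
places `A_m` between `A_a⁽ᵐ⁻ᵃ⁾` and `A_b⁽ᵐ⁻ᵇ⁾`, and `algStep_of_between` applies. -/
theorem IsSuperHorizontalFlag.produced (hd : IsDimSeq n r k d)
    (hA : IsSuperHorizontalFlag d r k A) : Produced d r k A := by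
  obtain ⟨hends, hsub, hle, hder⟩ := hA
  have hHol : ∀ i, Hol (A i) := fun i => (isHolSubbundle_iff.1 (hsub i)).1
  have hrk : ∀ i, rk (A i) = d i := fun i => (isHolSubbundle_iff.1 (hsub i)).2
  have hosc : ∀ i, osc (A i) 1 ≤ A (i + 1) := fun i =>
    (osc_one_le_iff (hHol i) (hHol _)).2 ⟨hle i, hder i⟩
  have hgap : ∀ i, gap (A i) ≤ jump d i := fun i => by
    have h1 := gap_add_rk_le_of_osc_le (hHol i) (hHol _) (hosc i)
    rw [hrk, hrk] at h1
    rw [jump]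
    omega
  have hmany : ∀ (a : ℤ) (j : ℕ), osc (A a) j ≤ A (a + j) := by
    intro a j
    induction j with
    | zero => simpa using (hHol a).osc_zero.le
    | succ j ih =>
      push_cast
      rw [(hHol a).osc_add_one _ (Int.natCast_nonneg j), ← add_assoc]
      exact (osc_mono ih 1).trans (hosc _)
  have hint : ∀ a b : ℤ, a ≤ b → osc (A a) (b - a) ≤ A b := fun a b hab => by
    have := hmany a (b - a).toNat
    rwa [Int.toNat_of_nonneg (by omega), add_sub_cancel] at this
  refine ⟨hends, fun a b m hst hm => ?_⟩
  refine algStep_of_between (hHol a) (hHol b) (hHol m) (sub_nonneg.2 hm.2.1.le) (hrk m)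
    ((hgap a).trans (hst.jump_le hd m hm.1 hm.2.1)) (hgap m) (hint a m hm.1.le) ?_
  have h1 := hint m b hm.2.1.le
  rwa [osc_sub_le_iff (hHol m) (hHol b) le_rfl hm.2.1.le, sub_self, (hHol m).osc_zero] at h1

end Algorithm

/-! ### Diagonal loops, the conjugacy class, adapted bases -/

section Diagonal

variable {n : ℕ}

theorem exp_apply_of_apply_eq_smul {A : Op n} {c : ℂ} {v : Cn n} (h : A v = c • v) :
    NormedSpace.exp A v = Complex.exp c • v := by
  have hpow : ∀ k : ℕ, (A ^ k) v = c ^ k • v := by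
    intro k
    induction k with
    | zero => simp
    | succ k ih =>
      rw [pow_succ, pow_succ']
      change (A ^ k) (A v) = _
      rw [h, map_smul, ih, smul_smul]
  have h1 := (NormedSpace.exp_series_hasSum_exp' (𝕂 := ℂ) A).mapL (ContinuousLinearMap.apply ℂ _ v)
  have h2 := (NormedSpace.exp_series_hasSum_exp' (𝕂 := ℂ) c).smul_const v
  rw [← Complex.exp_eq_exp_ℂ] at h2
  have e : (fun k : ℕ => ContinuousLinearMap.apply ℂ (Cn n) v ((k.factorial : ℂ)⁻¹ • A ^ k)) =
      fun k : ℕ => ((k.factorial : ℂ)⁻¹ • c ^ k) • v := funext fun k => by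
    change (k.factorial : ℂ)⁻¹ • (A ^ k) v = _
    rw [hpow, smul_smul]
    rfl
  rw [e] at h1
  exact h1.unique h2

/-- `γ(w) bⱼ = w^{mⱼ} bⱼ` for all `j`. -/
def IsDiag (b : OrthonormalBasis (Fin n) ℂ (Cn n)) (m : Fin n → ℤ) (γ : Circle → Op n) : Prop :=
  ∀ w j, γ w (b j) = (w : ℂ) ^ m j • b j

/-- The span of the basis vectors of weight at most `i`. -/
def basisFlag (b : OrthonormalBasis (Fin n) ℂ (Cn n)) (m : Fin n → ℤ) (i : ℤ) :
    Submodule ℂ (Cn n) :=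
  Submodule.span ℂ (Set.range fun j : {j // m j ≤ i} => b j)

theorem mem_basisFlag {b : OrthonormalBasis (Fin n) ℂ (Cn n)} {m : Fin n → ℤ} {i : ℤ} {v : Cn n} :
    v ∈ basisFlag b m i ↔ ∀ j, i < m j → inner ℂ (b j) v = 0 := by
  refine ⟨fun hv j hj => ?_, fun h => ?_⟩
  · refine Submodule.span_induction (p := fun v _ => inner ℂ (b j) v = 0) ?_ (inner_zero_right _)
      (fun x y _ _ hx hy => by rw [inner_add_right, hx, hy, add_zero])
      (fun c x _ hx => by rw [inner_smul_right, hx, mul_zero]) hv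
    rintro _ ⟨⟨l, hl⟩, rfl⟩
    exact b.inner_eq_zero (by rintro rfl; omega)
  · rw [← b.sum_repr' v]
    refine Submodule.sum_mem _ fun j _ => ?_
    rcases le_or_gt (m j) i with hj | hj
    · exact Submodule.smul_mem _ _ (Submodule.subset_span ⟨⟨j, hj⟩, rfl⟩)
    · rw [h j hj, zero_smul]
      exact Submodule.zero_mem _

theorem basisFlag_mono (b : OrthonormalBasis (Fin n) ℂ (Cn n)) (m : Fin n → ℤ) :
    Monotone (basisFlag b m) := fun _ _ hik _ hv =>
  mem_basisFlag.2 fun j hj => mem_basisFlag.1 hv j (hik.trans_lt hj)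

theorem finrank_basisFlag (b : OrthonormalBasis (Fin n) ℂ (Cn n)) (m : Fin n → ℤ) (i : ℤ) :
    Module.finrank ℂ (basisFlag b m i) = Fintype.card {j // m j ≤ i} :=
  finrank_span_eq_card (b.orthonormal.linearIndependent.comp _ Subtype.val_injective)

/-- `√-1 ξ` is self-adjoint, so `ξ` has an orthonormal eigenbasis with eigenvalues `-√-1 μⱼ`. The
condition `exp(2πξ) = 1` makes the `μⱼ` integers, and the weights are `-μⱼ`. -/
theorem exists_isDiag_gammaLoop {ξ : Op n} (hξ : IsIntegral ξ) :
    ∃ b m, IsDiag b m (gammaLoop ξ) := by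
  obtain ⟨h1, h2⟩ := hξ
  have hsa : IsSelfAdjoint (Complex.I • ξ) := by
    rw [IsSelfAdjoint, star_smul, h1]
    simp
  have hsym := hsa.isSymmetric
  have hn : Module.finrank ℂ (Cn n) = n := finrank_euclideanSpace_fin
  set b := hsym.eigenvectorBasis hn with hb
  set μ := hsym.eigenvalues hn with hμ
  have hev : ∀ j, ξ (b j) = (-Complex.I * μ j) • b j := fun j => by
    have h3 : Complex.I • ξ (b j) = (μ j : ℂ) • b j := hsym.apply_eigenvectorBasis hn j
    rw [mul_smul, ← h3, smul_smul]
    simp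
  have hint : ∀ j, ∃ k : ℤ, μ j = -k := fun j => by
    have h3 := exp_apply_of_apply_eq_smul (A := (2 * Real.pi : ℂ) • ξ)
      (c := 2 * Real.pi * (-Complex.I * μ j)) (v := b j) (by
        rw [smul_apply, hev, smul_smul])
    rw [h2] at h3
    change b j = _ at h3
    have h4 : Complex.exp (2 * Real.pi * (-Complex.I * μ j)) = 1 := by
      have h5 : (Complex.exp (2 * Real.pi * (-Complex.I * μ j)) - 1) • b j = 0 := by
        rw [sub_smul, ← h3, one_smul, sub_self]
      exact sub_eq_zero.1 ((smul_eq_zero.1 h5).resolve_right (b.orthonormal.ne_zero j))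
    obtain ⟨k, hk⟩ := Complex.exp_eq_one_iff.1 h4
    refine ⟨k, ?_⟩
    have h6 : (2 * Real.pi * Complex.I : ℂ) ≠ 0 := Complex.two_pi_I_ne_zero
    have h7 : (2 * Real.pi * Complex.I : ℂ) * (μ j + k) = 0 := by
      linear_combination -hk
    have h8 := (mul_eq_zero.1 h7).resolve_left h6
    have h9 : ((μ j + k : ℝ) : ℂ) = 0 := by push_cast; exact h8
    have := Complex.ofReal_eq_zero.1 h9
    linarith
  choose m hm using hint
  refine ⟨b, m, fun w j => ?_⟩
  rw [gammaLoop, exp_apply_of_apply_eq_smul (c := m j * Complex.log w), Complex.exp_int_mul,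
    Complex.exp_log (Circle.coe_ne_zero w)]
  rw [smul_apply, hev, smul_smul, hm]
  congr 1
  push_cast
  linear_combination (-(m j : ℂ) * Complex.log w) * Complex.I_sq

theorem IsDiag.mem_OmegaXi_iff {ξ : Op n} {b₀ : OrthonormalBasis (Fin n) ℂ (Cn n)} {m : Fin n → ℤ}
    (h : IsDiag b₀ m (gammaLoop ξ)) {γ : Circle → Op n} :
    γ ∈ OmegaXi ξ ↔ ∃ b, IsDiag b m γ := by
  constructor
  · rintro ⟨g, hg, rfl⟩
    refine ⟨b₀.map (Unitary.linearIsometryEquiv ⟨g, hg⟩), fun w j => ?_⟩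
    have h1 : ∀ v, star g (g v) = v := fun v => by
      have := congrArg (fun A : Op n => A v) (Unitary.star_mul_self_of_mem hg)
      exact this
    change g (gammaLoop ξ w (star g (g (b₀ j)))) = _ • g (b₀ j)
    rw [h1, h, map_smul]
  · rintro ⟨b, hb⟩
    let e : Cn n ≃ₗᵢ[ℂ] Cn n := b₀.repr.trans b.repr.symm
    have he : ∀ j, e (b₀ j) = b j := fun j => by simp [e]
    let g := Unitary.linearIsometryEquiv.symm e
    have hg : ∀ v, (g : Op n) v = e v := fun v => rfl
    have hg' : ∀ j, star (g : Op n) (b j) = b₀ j := fun j => by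
      have := congrArg (fun A : Op n => A (b₀ j)) (Unitary.star_mul_self_of_mem g.2)
      rw [← he, ← hg]
      exact this
    refine ⟨g, g.2, funext fun w => ?_⟩
    refine ContinuousLinearMap.coe_injective (b.toBasis.ext fun j => ?_)
    have : γ w (b j) = (g : Op n) (gammaLoop ξ w (star (g : Op n) (b j))) := by
      rw [hg', h, map_smul, hg, he, hb]
    simpa using this

/-- A filtration has an adapted orthonormal basis. -/
theorem exists_basisFlag_eq {F : ℤ → Submodule ℂ (Cn n)} (hF : Monotone F) {r k : ℤ}
    (hr : F (-r - 1) = ⊥) (hk : F k = ⊤) :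
    ∃ b m, (∀ i, F i = basisFlag b m i) := by
  -- The part of `F i` orthogonal to `F (i - 1)`; an orthonormal basis subordinate to these pieces
  -- is adapted to the filtration.
  let W : Finset.Icc (-r) k → Submodule ℂ (Cn n) := fun i => (F (i - 1))ᗮ ⊓ F i
  have hW : OrthogonalFamily ℂ (fun i => W i) fun i => (W i).subtypeₗᵢ := by
    have aux : ∀ i j : Finset.Icc (-r) k, i < j → ∀ v : W i, ∀ w : W j,
        inner ℂ (v : Cn n) (w : Cn n) = 0 := fun i j hij v w =>
      (Submodule.mem_orthogonal _ _).1 w.2.1 v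
        (hF (by have : (i : ℤ) < j := hij; omega) v.2.2)
    intro i j hij v w
    rcases lt_or_gt_of_ne hij with h | h
    · exact aux i j h v w
    · rw [← inner_conj_symm]
      exact (congrArg _ (aux j i h w v)).trans (map_zero _)
  have hsup : ∀ N : ℕ, -r - 1 + N ≤ k → F (-r - 1 + N) ≤ iSup W := by
    intro N
    induction N with
    | zero => intro _; simp [hr]
    | succ N ih =>
      intro hN
      push_cast at hN ⊢
      have e : -r - 1 + (N + 1 : ℤ) - 1 = -r - 1 + N := by ring
      rw [← Submodule.sup_orthogonal_inf_of_hasOrthogonalProjection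
        (hF (show -r - 1 + (N : ℤ) ≤ -r - 1 + (N + 1) by omega))]
      refine sup_le (ih (by omega)) ?_
      refine le_trans ?_ (le_iSup W ⟨-r - 1 + (N + 1), by simp; omega⟩)
      simp only [W, e, le_refl]
  have htop : iSup W = ⊤ := by
    rcases le_or_gt (-r - 1) k with h | h
    · have := hsup (k - (-r - 1)).toNat (by omega)
      rw [Int.toNat_of_nonneg (by omega), add_sub_cancel, hk] at this
      exact top_le_iff.1 this
    · have h1 := hF h.le
      rw [hr, hk] at h1
      exact top_le_iff.1 (h1.trans bot_le)
  have hint : DirectSum.IsInternal W := by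
    rw [hW.isInternal_iff, htop, Submodule.top_orthogonal_eq_bot]
  have hn : Module.finrank ℂ (Cn n) = n := finrank_euclideanSpace_fin
  let b := hint.subordinateOrthonormalBasis hn hW
  let c : Fin n → Finset.Icc (-r) k := fun a => hint.subordinateOrthonormalBasisIndex hn a hW
  have hb : ∀ a, b a ∈ W (c a) := fun a => hint.subordinateOrthonormalBasis_subordinate hn a hW
  refine ⟨b, fun a => c a, fun i => le_antisymm (fun v hv => mem_basisFlag.2 fun j hj => ?_) ?_⟩
  · exact (Submodule.mem_orthogonal' _ _).1 (hb j).1 v (hF (by omega) hv)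
  · refine Submodule.span_le.2 ?_
    rintro _ ⟨⟨j, hj⟩, rfl⟩
    exact hF hj (hb j).2

/-- The dimensions determine how often each weight occurs. The adapted basis thus has the prescribed
weights up to a permutation, by which it is reindexed. -/
theorem exists_basisFlag_eq_of_finrank {F : ℤ → Submodule ℂ (Cn n)} (hF : Monotone F) {r k : ℤ}
    (hr : F (-r - 1) = ⊥) (hk : F k = ⊤) {m : Fin n → ℤ}
    (hm : ∀ i, Module.finrank ℂ (F i) = Fintype.card {j // m j ≤ i}) :
    ∃ b, ∀ i, F i = basisFlag b m i := by
  obtain ⟨b, c, hb⟩ := exists_basisFlag_eq hF hr hk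
  have hcard : ∀ f : Fin n → ℤ, ∀ i, Fintype.card {j // f j ≤ i} =
      Fintype.card {j // f j = i} + Fintype.card {j // f j ≤ i - 1} := fun f i => by
    simp only [Fintype.card_subtype]
    rw [← Finset.card_union_of_disjoint]
    · congr 1
      ext j
      simp
      omega
    · rw [Finset.disjoint_filter]
      intro j _ h
      omega
  have hle : ∀ i, Fintype.card {j // m j ≤ i} = Fintype.card {j // c j ≤ i} := fun i => by
    rw [← hm, hb, finrank_basisFlag]
  have heq : ∀ i, Nonempty ({j // m j = i} ≃ {j // c j = i}) := fun i => by
    refine Fintype.card_eq.1 ?_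
    have h1 := hcard m i
    have h2 := hcard c i
    rw [hle, hle] at h1
    omega
  let σ : Fin n ≃ Fin n := Equiv.ofFiberEquiv fun i => (heq i).some
  have hσ : ∀ j, c (σ j) = m j := fun j => Equiv.ofFiberEquiv_map _ j
  refine ⟨b.reindex σ.symm, fun i => ?_⟩
  ext v
  rw [hb, mem_basisFlag, mem_basisFlag, ← σ.forall_congr_right]
  simp [hσ]

end Diagonal

/-! ### Fourier coefficients and the filtration of a diagonal loop -/

section FourierCoefficients

variable {n : ℕ}

theorem ext_inner_orthonormalBasis (b : OrthonormalBasis (Fin n) ℂ (Cn n)) {x y : Cn n}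
    (h : ∀ j, inner ℂ (b j) x = inner ℂ (b j) y) : x = y := by
  rw [← b.sum_repr' x, ← b.sum_repr' y]
  simp only [h]

theorem continuous_zpow_circleExp (l : ℤ) : Continuous fun θ : ℝ => (Circle.exp θ : ℂ) ^ l :=
  (continuous_subtype_val.comp Circle.exp.continuous).zpow₀ l fun _ => Or.inl (Circle.coe_ne_zero _)

theorem integral_zpow_circleExp (l : ℤ) :
    ∫ θ in (0 : ℝ)..(2 * Real.pi), (Circle.exp θ : ℂ) ^ l =
      if l = 0 then (2 * Real.pi : ℂ) else 0 := by
  split_ifs with h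
  · simp [h]
  · have e : ∀ θ : ℝ, (Circle.exp θ : ℂ) ^ l = Complex.exp (l * Complex.I * θ) := fun θ => by
      rw [Circle.coe_exp, ← Complex.exp_int_mul]
      ring_nf
    simp only [e]
    rw [integral_exp_mul_complex (by simp [h])]
    have : (l : ℂ) * Complex.I * (2 * Real.pi : ℝ) = l * (2 * Real.pi * Complex.I) := by
      push_cast; ring
    rw [this, Complex.exp_int_mul_two_pi_mul_I]
    simp

theorem fourierCoef_zpow_smul (l i : ℤ) (v : Cn n) :
    fourierCoef (fun w => (w : ℂ) ^ l • v) i = if l = i then v else 0 := by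
  have e : ∀ θ : ℝ, (Circle.exp θ : ℂ) ^ (-i) • (Circle.exp θ : ℂ) ^ l • v =
      (Circle.exp θ : ℂ) ^ (l - i) • v := fun θ => by
    rw [smul_smul, ← zpow_add₀ (Circle.coe_ne_zero _)]
    ring_nf
  simp only [fourierCoef, e]
  rw [intervalIntegral.integral_smul_const, integral_zpow_circleExp]
  rcases eq_or_ne l i with rfl | h
  · rw [sub_self, if_pos rfl, if_pos rfl, smul_smul, inv_mul_cancel₀, one_smul]
    simp [Real.pi_ne_zero]
  · simp [h, sub_ne_zero.2 h]

theorem memLp_zpow_smul (l : ℤ) (v : Cn n) :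
    MemLp (fun θ : ℝ => (Circle.exp θ : ℂ) ^ l • v) 2
      (volume.restrict (Set.Ioc 0 (2 * Real.pi))) := by
  refine MemLp.of_bound ((continuous_zpow_circleExp l).smul continuous_const).aestronglyMeasurable
    ‖v‖ (Eventually.of_forall fun θ => ?_)
  rw [norm_smul, norm_zpow, Circle.norm_coe, one_zpow, one_mul]

theorem zpow_smul_mem_Hplus {l i : ℤ} (h : i ≤ l) (v : Cn n) :
    (fun w : Circle => (w : ℂ) ^ l • v) ∈ Hplus n i :=
  ⟨memLp_zpow_smul l v, fun m hm => by rw [fourierCoef_zpow_smul, if_neg (by omega)]⟩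

theorem inner_fourierCoef {f : Circle → Cn n}
    (hf : MemLp (fun θ : ℝ => f (Circle.exp θ)) 2 (volume.restrict (Set.Ioc 0 (2 * Real.pi))))
    (v : Cn n) (i : ℤ) :
    inner ℂ v (fourierCoef f i) = (2 * Real.pi : ℂ)⁻¹ * ∫ θ in (0 : ℝ)..(2 * Real.pi),
      (Circle.exp θ : ℂ) ^ (-i) * inner ℂ v (f (Circle.exp θ)) := by
  have h1 : IntervalIntegrable (fun θ : ℝ => f (Circle.exp θ)) volume 0 (2 * Real.pi) :=
    (intervalIntegrable_iff_integrableOn_Ioc_of_le Real.two_pi_pos.le).2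
      (hf.integrable one_le_two)
  have h2 := (innerSL ℂ v).intervalIntegral_comp_comm
    (h1.continuousOn_smul (continuous_zpow_circleExp (-i)).continuousOn)
  rw [fourierCoef, inner_smul_right, ← innerSL_apply_apply ℂ v, ← h2]
  simp

theorem IsDiag.inner_apply {b : OrthonormalBasis (Fin n) ℂ (Cn n)} {m : Fin n → ℤ}
    {γ : Circle → Op n} (h : IsDiag b m γ) (w : Circle) (j : Fin n) (v : Cn n) :
    inner ℂ (b j) (γ w v) = (w : ℂ) ^ m j * inner ℂ (b j) v := by
  conv_lhs => rw [← b.sum_repr' v]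
  simp [map_sum, h w, b.inner_eq_ite, mul_comm]

/-- A loop of diagonal operators maps `H₊` to the expected filtration. -/
theorem IsDiag.loopFlag_eq {b : OrthonormalBasis (Fin n) ℂ (Cn n)} {m : Fin n → ℤ}
    {γ : Circle → Op n} (h : IsDiag b m γ) (i : ℤ) : loopFlag γ i = basisFlag b m i := by
  refine le_antisymm (Submodule.span_le.2 ?_) (Submodule.span_le.2 ?_)
  · rintro _ ⟨f, ⟨g, hg, rfl⟩, hf, rfl⟩
    refine mem_basisFlag.2 fun j hj => ?_
    -- Along `b j` the loop multiplies by `w ^ m j`, so the coefficient of index `i` of `γ g` is the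
    -- coefficient of `g` of index `i - m j < 0`, which vanishes.
    have h2 := inner_fourierCoef hg.1 (b j) (i - m j)
    rw [hg.2 _ (by omega), inner_zero_right] at h2
    rw [inner_fourierCoef hf.1, h2]
    congr 2
    funext θ
    rw [h.inner_apply, ← mul_assoc, ← zpow_add₀ (Circle.coe_ne_zero _)]
    ring_nf
  · rintro _ ⟨⟨j, hj⟩, rfl⟩
    -- This function is the image under the loop of `w ^ (i - m j) • b j`, which is in `H₊` because
    -- `m j ≤ i`.
    refine Submodule.subset_span ⟨fun w => (w : ℂ) ^ i • b j,
      ⟨_, zpow_smul_mem_Hplus (l := i - m j) (by omega) (b j), funext fun w => ?_⟩,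
      zpow_smul_mem_Hplus le_rfl _, by rw [fourierCoef_zpow_smul, if_pos rfl]⟩
    rw [map_smul, h, smul_smul, ← zpow_add₀ (Circle.coe_ne_zero _)]
    ring_nf

end FourierCoefficients

/-! ### Weights of the homomorphism and the dimension sequence -/

section Weights

variable {n : ℕ} {ξ : Op n} {r k : ℤ}

/-- The weights of `γ_ξ`, for which the loops in `Ω_ξ` are those diagonalised by an orthonormal
basis with these weights. -/
theorem exists_weights (hξ : IsIntegral ξ) (hrk : FlagBounds ξ r k) :
    ∃ m : Fin n → ℤ, (∀ j, -r ≤ m j ∧ m j ≤ k) ∧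
      (∀ γ, γ ∈ OmegaXi ξ ↔ ∃ b, IsDiag b m γ) ∧
      ∀ i, flagDim ξ i = Fintype.card {j // m j ≤ i} := by
  obtain ⟨b, m, hb⟩ := exists_isDiag_gammaLoop hξ
  obtain ⟨h1, -, -, h2⟩ := hrk
  rw [hb.loopFlag_eq] at h1 h2
  refine ⟨m, fun j => ⟨?_, ?_⟩, fun γ => hb.mem_OmegaXi_iff, fun i => ?_⟩
  · by_contra hj
    have h3 : b j ∈ basisFlag b m (-r - 1) := mem_basisFlag.2 fun l hl =>
      b.inner_eq_zero (by rintro rfl; omega)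
    rw [h1, Submodule.mem_bot] at h3
    exact b.orthonormal.ne_zero j h3
  · by_contra hj
    have h3 : b j ∈ basisFlag b m k := h2 ▸ Submodule.mem_top
    have h4 := mem_basisFlag.1 h3 j (by omega)
    rw [b.inner_eq_one] at h4
    exact one_ne_zero h4
  · rw [flagDim, hb.loopFlag_eq, finrank_basisFlag]

theorem isDimSeq_flagDim (hξ : IsIntegral ξ) (hrk : FlagBounds ξ r k) :
    IsDimSeq n r k (flagDim ξ) := by
  obtain ⟨m, hm, -, hd⟩ := exists_weights hξ hrk
  refine ⟨fun i j hij => ?_, fun i hi => ?_, fun i hi => ?_⟩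
  · rw [hd, hd]
    exact Fintype.card_subtype_mono _ _ fun l hl => hl.trans hij
  · rw [hd, Fintype.card_eq_zero_iff]
    exact ⟨fun j => by have := j.2; have := hm j.1; omega⟩
  · rw [hd, Fintype.card_of_subtype Finset.univ fun j => ?_, Finset.card_univ, Fintype.card_fin]
    have := (hm j).2
    simp
    omega

end Weights

/-! ### Loops and the projections onto their filtrations -/

section Projections

variable {n : ℕ}

/-- The mean of `f` over the `N`-th roots of unity. -/
noncomputable def rootMean {V : Type*} [AddCommGroup V] [Module ℂ V] (N : ℕ) (f : Circle → V) : V :=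
  (N : ℂ)⁻¹ • ∑ t ∈ Finset.range N, f (Circle.exp (2 * Real.pi * t / N))

/-- A geometric sum over a nontrivial `N`-th root of unity. Only finitely many weights occur, so
finite means can replace Fourier integrals, and they commute with differentiation at once. -/
theorem rootMean_zpow {N : ℕ} {l : ℤ} (h : |l| < N) :
    rootMean N (fun w : Circle => (w : ℂ) ^ l) = if l = 0 then 1 else 0 := by
  have hN : (N : ℂ) ≠ 0 := by
    rintro hN
    rw [Nat.cast_eq_zero] at hN
    subst hN
    have := abs_nonneg l
    omega
  split_ifs with hl
  · subst hl
    simp [rootMean, hN]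
  · have e : ∀ t : ℕ, (Circle.exp (2 * Real.pi * t / N) : ℂ) ^ l =
        Complex.exp (l * (2 * Real.pi * Complex.I / N)) ^ t := fun t => by
      rw [Circle.coe_exp, ← Complex.exp_int_mul, ← Complex.exp_nat_mul]
      congr 1
      push_cast
      ring
    simp only [rootMean, e, smul_eq_mul]
    have hq : Complex.exp (l * (2 * Real.pi * Complex.I / N)) ^ N = 1 := by
      rw [← Complex.exp_nat_mul, Complex.exp_eq_one_iff]
      exact ⟨l, by field_simp⟩
    have hq1 : Complex.exp (l * (2 * Real.pi * Complex.I / N)) ≠ 1 := by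
      rw [Ne, Complex.exp_eq_one_iff]
      rintro ⟨t, ht⟩
      have h1 : (l : ℂ) = t * N := by
        have h2 : (2 * Real.pi * Complex.I : ℂ) ≠ 0 := Complex.two_pi_I_ne_zero
        field_simp at ht
        have h3 : (l - t * N : ℂ) * (2 * Real.pi * Complex.I) = 0 := by
          linear_combination (2 * Real.pi * Complex.I) * ht
        exact sub_eq_zero.1 ((mul_eq_zero.1 h3).resolve_right h2)
      have h4 : l = t * N := by exact_mod_cast h1
      have h5 : (N : ℤ) ∣ l := ⟨t, by rw [h4, mul_comm]⟩
      exact absurd (Int.eq_zero_of_abs_lt_dvd h5 h) hl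
    have hz : (∑ t ∈ Finset.range N, Complex.exp (l * (2 * Real.pi * Complex.I / N)) ^ t) = 0 := by
      have h1 := geom_sum_mul (Complex.exp (l * (2 * Real.pi * Complex.I / N))) N
      rw [hq, sub_self] at h1
      exact (mul_eq_zero.1 h1).resolve_right (sub_ne_zero.2 hq1)
    rw [hz, mul_zero]

theorem rootMean_smul_const {V : Type*} [AddCommGroup V] [Module ℂ V] (N : ℕ) (f : Circle → ℂ)
    (v : V) : rootMean N (fun w => f w • v) = rootMean N f • v := by
  rw [rootMean, rootMean, ← Finset.sum_smul, smul_assoc]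

theorem map_rootMean {V W : Type*} [AddCommGroup V] [Module ℂ V] [AddCommGroup W] [Module ℂ W]
    (L : V →ₗ[ℂ] W) (N : ℕ) (f : Circle → V) : L (rootMean N f) = rootMean N fun w => L (f w) := by
  simp [rootMean]

theorem starProjection_basisFlag_apply (b : OrthonormalBasis (Fin n) ℂ (Cn n)) (m : Fin n → ℤ)
    (i : ℤ) (j : Fin n) :
    (basisFlag b m i).starProjection (b j) = if m j ≤ i then b j else 0 := by
  split_ifs with h
  · exact Submodule.starProjection_eq_self_iff.2 (Submodule.subset_span ⟨⟨j, h⟩, rfl⟩)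
  · rw [Submodule.starProjection_apply_eq_zero_iff, Submodule.mem_orthogonal']
    exact fun u hu => mem_basisFlag.1 hu j (by omega)

theorem sum_Ico_zpow_sub (w : ℂ) {a b : ℤ} (h : a ≤ b) :
    ∑ i ∈ Finset.Ico a b, (w ^ (i + 1) - w ^ i) = w ^ b - w ^ a := by
  induction b, h using Int.leInduction with
  | base => simp
  | succ b hab ih =>
    have : Finset.Ico a (b + 1) = insert b (Finset.Ico a b) := by
      ext
      simp
      omega
    rw [this, Finset.sum_insert (by simp), ih]
    ring

/-- Abel summation: on `b j` the sum runs over `m j ≤ i < k` and telescopes to `w ^ k - w ^ m j`. -/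
theorem isDiag_sub_sum (b : OrthonormalBasis (Fin n) ℂ (Cn n)) {m : Fin n → ℤ} {r k : ℤ}
    (hm : ∀ j, -r ≤ m j ∧ m j ≤ k) :
    IsDiag b m fun w => (w : ℂ) ^ k • (1 : Op n) - ∑ i ∈ Finset.Ico (-r) k,
      ((w : ℂ) ^ (i + 1) - (w : ℂ) ^ i) • (basisFlag b m i).starProjection := by
  intro w j
  have e : Finset.filter (fun i => m j ≤ i) (Finset.Ico (-r) k) = Finset.Ico (m j) k := by
    ext i
    have := hm j
    simp
    omega
  have h1 : (∑ i ∈ Finset.Ico (-r) k, ((w : ℂ) ^ (i + 1) - (w : ℂ) ^ i) •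
      (basisFlag b m i).starProjection (b j)) = ((w : ℂ) ^ k - (w : ℂ) ^ m j) • b j := by
    simp only [starProjection_basisFlag_apply, smul_ite, smul_zero]
    rw [← Finset.sum_filter, e, ← Finset.sum_smul, sum_Ico_zpow_sub _ (hm j).2]
  have h2 : (w : ℂ) ^ k • b j - ∑ i ∈ Finset.Ico (-r) k, ((w : ℂ) ^ (i + 1) - (w : ℂ) ^ i) •
      (basisFlag b m i).starProjection (b j) = (w : ℂ) ^ m j • b j := by
    rw [h1, ← sub_smul, sub_sub_cancel]
  simpa using h2

theorem IsDiag.eq {b : OrthonormalBasis (Fin n) ℂ (Cn n)} {m : Fin n → ℤ}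
    {γ γ' : Circle → Op n} (h : IsDiag b m γ) (h' : IsDiag b m γ') : γ = γ' := by
  funext w
  refine ContinuousLinearMap.coe_injective (b.toBasis.ext fun j => ?_)
  have : γ w (b j) = γ' w (b j) := by rw [h, h']
  simpa using this

theorem IsDiag.eq_sub_sum {b : OrthonormalBasis (Fin n) ℂ (Cn n)} {m : Fin n → ℤ}
    {γ : Circle → Op n} (h : IsDiag b m γ) {r k : ℤ} (hm : ∀ j, -r ≤ m j ∧ m j ≤ k) (w : Circle) :
    γ w = (w : ℂ) ^ k • (1 : Op n) - ∑ i ∈ Finset.Ico (-r) k,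
      ((w : ℂ) ^ (i + 1) - (w : ℂ) ^ i) • (loopFlag γ i).starProjection := by
  simp only [h.loopFlag_eq]
  exact congrFun (h.eq (isDiag_sub_sum b hm)) w

theorem IsDiag.mem_unitary {b : OrthonormalBasis (Fin n) ℂ (Cn n)} {m : Fin n → ℤ}
    {γ : Circle → Op n} (h : IsDiag b m γ) (w : Circle) : γ w ∈ unitary (Op n) := by
  have h1 : star (γ w) * γ w = 1 := by
    refine ContinuousLinearMap.coe_injective (b.toBasis.ext fun j => ?_)
    have h2 : star (γ w) (γ w (b j)) = b j := by
      refine ext_inner_orthonormalBasis b fun l => ?_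
      have h3 : inner ℂ (b l) (star (γ w) (γ w (b j))) = inner ℂ (γ w (b l)) (γ w (b j)) :=
        ContinuousLinearMap.adjoint_inner_right _ _ _
      rw [h3, h, h, inner_smul_left, inner_smul_right, b.inner_eq_ite]
      split_ifs with hl
      · subst hl
        rw [mul_one, Complex.conj_mul', norm_zpow, Circle.norm_coe]
        simp
      · simp
    simpa using h2
  have h2 : γ w * γ w⁻¹ = 1 := by
    refine ContinuousLinearMap.coe_injective (b.toBasis.ext fun j => ?_)
    have h3 : γ w (γ w⁻¹ (b j)) = b j := by
      rw [h, map_smul, h, smul_smul, Circle.coe_inv, inv_zpow, inv_mul_cancel₀, one_smul]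
      exact zpow_ne_zero _ (Circle.coe_ne_zero w)
    simpa using h3
  refine ⟨h1, ?_⟩
  rwa [left_inv_eq_right_inv h1 h2]

/-- On the difference of consecutive steps of its filtration, `γ(w)` acts by `wⁱ`. -/
theorem IsDiag.star_apply {b : OrthonormalBasis (Fin n) ℂ (Cn n)} {m : Fin n → ℤ}
    {γ : Circle → Op n} (h : IsDiag b m γ) (w : Circle) {i : ℤ} {v : Cn n}
    (h1 : v ∈ loopFlag γ i) (h2 : v ∈ (loopFlag γ (i - 1))ᗮ) :
    star (γ w) v = ((w : ℂ) ^ i)⁻¹ • v := by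
  rw [h.loopFlag_eq] at h1 h2
  have h3 : γ w v = (w : ℂ) ^ i • v := by
    refine ext_inner_orthonormalBasis b fun j => ?_
    rw [h.inner_apply, inner_smul_right]
    rcases lt_trichotomy (m j) i with hj | hj | hj
    · rw [(Submodule.mem_orthogonal _ _).1 h2 (b j)
        (Submodule.subset_span ⟨⟨j, by omega⟩, rfl⟩), mul_zero, mul_zero]
    · rw [hj]
    · rw [mem_basisFlag.1 h1 j hj, mul_zero, mul_zero]
  have h4 : star (γ w) (γ w v) = v :=
    congrArg (fun A : Op n => A v) (Unitary.star_mul_self_of_mem (h.mem_unitary w))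
  rw [eq_inv_smul_iff₀ (zpow_ne_zero _ (Circle.coe_ne_zero w)), ← map_smul, ← h3, h4]

theorem rootMean_sub {V : Type*} [AddCommGroup V] [Module ℂ V] (N : ℕ) (f g : Circle → V) :
    rootMean N (fun w => f w - g w) = rootMean N f - rootMean N g := by
  simp only [rootMean, Finset.sum_sub_distrib, smul_sub]

theorem rootMean_sum {V ι : Type*} [AddCommGroup V] [Module ℂ V] (N : ℕ) (s : Finset ι)
    (f : ι → Circle → V) :
    rootMean N (fun w => ∑ j ∈ s, f j w) = ∑ j ∈ s, rootMean N (f j) := by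
  simp only [rootMean]
  rw [Finset.sum_comm, Finset.smul_sum]

/-- Means which pick out the weights up to `i`. -/
theorem exists_mean (r k i : ℤ) : ∃ (N : ℕ) (c : Circle → ℂ),
    (∀ l, -r ≤ l → l ≤ k →
      rootMean N (fun w => c w * (w : ℂ) ^ l) = if l ≤ i then 1 else 0) ∧
    (∀ l, -r ≤ l → l ≤ k → i + 1 < l →
      rootMean N (fun w => c w * (w : ℂ) ^ l * ((1 - (w : ℂ)⁻¹) / 2)) = 0) ∧
    ∀ l, -r ≤ l → l ≤ k → i < l →
      rootMean N (fun w => c w * (w : ℂ) ^ l * ((1 - (w : ℂ)) / 2)) = 0 := by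
  -- Larger than every exponent `|l - j|` that occurs below.
  let N : ℕ := 2 * r.natAbs + k.natAbs + i.natAbs + 2
  let c : Circle → ℂ := fun w => ∑ j ∈ Finset.Icc (-r) i, (w : ℂ) ^ (-j)
  -- The range of `l` exceeds that of the weights by one on either side, because multiplication by
  -- `1 - w⁻¹` or `1 - w` shifts exponents by one.
  have key : ∀ l, -r - 1 ≤ l → l ≤ k + 1 → rootMean N (fun w => c w * (w : ℂ) ^ l) =
      if -r ≤ l ∧ l ≤ i then 1 else 0 := by
    intro l h1 h2
    have e : ∀ w : Circle, c w * (w : ℂ) ^ l = ∑ j ∈ Finset.Icc (-r) i, (w : ℂ) ^ (l - j) :=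
      fun w => by
        simp only [c]
        rw [Finset.sum_mul]
        refine Finset.sum_congr rfl fun j _ => ?_
        rw [← zpow_add₀ (Circle.coe_ne_zero w)]
        ring_nf
    simp only [e]
    rw [rootMean_sum, Finset.sum_congr rfl (g := fun j => if l = j then 1 else 0) fun j hj => ?_,
      Finset.sum_ite_eq]
    · simp only [Finset.mem_Icc]
    · rw [Finset.mem_Icc] at hj
      rw [rootMean_zpow (by rw [abs_lt]; omega)]
      simp only [sub_eq_zero]
  refine ⟨N, c, fun l h1 h2 => ?_, fun l h1 h2 h3 => ?_, fun l h1 h2 h3 => ?_⟩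
  · rw [key l (by omega) (by omega)]
    simp only [h1, true_and]
  · have e : ∀ w : Circle, c w * (w : ℂ) ^ l * ((1 - (w : ℂ)⁻¹) / 2) =
        (c w * (w : ℂ) ^ l - c w * (w : ℂ) ^ (l - 1)) • (1 / 2 : ℂ) := fun w => by
      rw [zpow_sub_one₀ (Circle.coe_ne_zero w), smul_eq_mul]
      ring
    simp only [e]
    rw [rootMean_smul_const, rootMean_sub, key l (by omega) (by omega),
      key (l - 1) (by omega) (by omega), if_neg (by omega), if_neg (by omega)]
    simp
  · have e : ∀ w : Circle, c w * (w : ℂ) ^ l * ((1 - (w : ℂ)) / 2) =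
        (c w * (w : ℂ) ^ l - c w * (w : ℂ) ^ (l + 1)) • (1 / 2 : ℂ) := fun w => by
      rw [zpow_add_one₀ (Circle.coe_ne_zero w), smul_eq_mul]
      ring
    simp only [e]
    rw [rootMean_smul_const, rootMean_sub, key l (by omega) (by omega),
      key (l + 1) (by omega) (by omega), if_neg (by omega), if_neg (by omega)]
    simp

/-- On `b j` the mean has eigenvalue `1` or `0` according to whether `m j ≤ i`. The smoothness of
the projections and their derivatives are thereby inherited from the loop. -/
theorem IsDiag.starProjection_eq_rootMean {b : OrthonormalBasis (Fin n) ℂ (Cn n)} {m : Fin n → ℤ}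
    {γ : Circle → Op n} (h : IsDiag b m γ) {N : ℕ} {c : Circle → ℂ} {i : ℤ}
    (hc : ∀ j, rootMean N (fun w => c w * (w : ℂ) ^ m j) = if m j ≤ i then 1 else 0) :
    (loopFlag γ i).starProjection = rootMean N (fun w => c w • γ w) := by
  refine ContinuousLinearMap.coe_injective (b.toBasis.ext fun j => ?_)
  have h1 := map_rootMean (ContinuousLinearMap.apply ℂ (Cn n) (b j)).toLinearMap N
    fun w => c w • γ w
  have h2 : ∀ w, (ContinuousLinearMap.apply ℂ (Cn n) (b j)).toLinearMap (c w • γ w) =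
      (c w * (w : ℂ) ^ m j) • b j := fun w => by
    change c w • γ w (b j) = _
    rw [h, smul_smul]
  simp only [h2] at h1
  rw [rootMean_smul_const, hc] at h1
  simp only [OrthonormalBasis.coe_toBasis]
  refine Eq.trans ?_ h1.symm
  change (loopFlag γ i).starProjection (b j) = _
  rw [h.loopFlag_eq, starProjection_basisFlag_apply]
  split_ifs <;> simp

end Projections

/-! ### Linear algebra of the Wirtinger combinations -/

section WirtingerCombination

variable {V : Type*} [AddCommGroup V] [Module ℂ V] (c : ℂ) (X Y : V)

/-- The combination `(X + cY) / 2`. -/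
noncomputable def halfComb : V := (1 / 2 : ℂ) • (X + c • Y)

theorem halfComb_zero : halfComb c (0 : V) 0 = 0 := by simp [halfComb]

theorem halfComb_add (X' Y' : V) :
    halfComb c (X + X') (Y + Y') = halfComb c X Y + halfComb c X' Y' := by
  simp only [halfComb, smul_add]
  abel

theorem halfComb_sub (X' Y' : V) :
    halfComb c (X - X') (Y - Y') = halfComb c X Y - halfComb c X' Y' := by
  simp only [halfComb, smul_add, smul_sub]
  abel

theorem halfComb_smul (a : ℂ) : halfComb c (a • X) (a • Y) = a • halfComb c X Y := by
  simp only [halfComb, smul_add]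
  rw [smul_comm c a, smul_comm _ a, smul_comm _ a]

theorem halfComb_sum {ι : Type*} (s : Finset ι) (X Y : ι → V) :
    halfComb c (∑ i ∈ s, X i) (∑ i ∈ s, Y i) = ∑ i ∈ s, halfComb c (X i) (Y i) := by
  simp only [halfComb, Finset.smul_sum, ← Finset.sum_add_distrib, smul_add]

theorem star_halfComb [StarAddMonoid V] [StarModule ℂ V] :
    star (halfComb c X Y) = halfComb (starRingEnd ℂ c) (star X) (star Y) := by
  simp [halfComb]

theorem map_halfComb {W : Type*} [AddCommGroup W] [Module ℂ W] (L : V →ₗ[ℂ] W) :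
    L (halfComb c X Y) = halfComb c (L X) (L Y) := by
  simp [halfComb]

theorem halfComb_I_smul : halfComb Complex.I X (Complex.I • X) = 0 := by
  rw [halfComb, smul_smul, Complex.I_mul_I, neg_one_smul, add_neg_cancel, smul_zero]

theorem halfComb_neg_I_smul : halfComb (-Complex.I) X (Complex.I • X) = X := by
  rw [halfComb, smul_smul, neg_mul, Complex.I_mul_I, neg_neg, one_smul, ← two_smul ℂ, smul_smul]
  norm_num

variable {X Y} in
theorem eq_of_halfComb_I_eq_zero (h : halfComb Complex.I X Y = 0) : Y = Complex.I • X := by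
  have h1 : X + Complex.I • Y = 0 := (smul_eq_zero.1 h).resolve_left (by norm_num)
  rw [eq_neg_of_add_eq_zero_left h1, smul_neg, smul_smul, Complex.I_mul_I, neg_one_smul, neg_neg]

/-- If `X` and `Y` are the derivatives along `1` and `√-1`, the two arguments are the derivatives
along `a` and `√-1 a`. This is the factor by which `∂̄` changes under a holomorphic substitution. -/
theorem halfComb_I_mul (a : ℂ) :
    halfComb Complex.I ((a.re : ℂ) • X + (a.im : ℂ) • Y)
      (((-a.im : ℝ) : ℂ) • X + (a.re : ℂ) • Y) = starRingEnd ℂ a • halfComb Complex.I X Y := by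
  have h : starRingEnd ℂ a = a.re - a.im * Complex.I := by
    apply Complex.ext <;> simp
  have e : (a.im + Complex.I * a.re : ℂ) = (a.re - a.im * Complex.I) * Complex.I := by
    linear_combination (a.im : ℂ) * Complex.I_mul_I
  rw [h, halfComb, halfComb]
  push_cast
  trans (1 / 2 : ℂ) • ((a.re - a.im * Complex.I : ℂ) • X + (a.im + Complex.I * a.re : ℂ) • Y)
  · module
  · rw [e]
    module

end WirtingerCombination

/-! ### Wirtinger derivatives of operator-valued functions -/

section Wirtinger

variable {n : ℕ} {f g : ℂ → Op n} {z z₀ : ℂ} (c : ℂ)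

/-- The Wirtinger derivatives: `∂f/∂z` for `c = -√-1` and `∂f/∂z̄` for `c = √-1`. -/
noncomputable def wirt (f : ℂ → Op n) (z : ℂ) : Op n :=
  halfComb c (fderiv ℝ f z 1) (fderiv ℝ f z Complex.I)

theorem wirt_congr (h : f =ᶠ[𝓝 z] g) : wirt c f z = wirt c g z := by
  rw [wirt, wirt, h.fderiv_eq]

theorem wirt_const (A : Op n) : wirt c (fun _ => A) z = 0 := by
  rw [wirt, fderiv_fun_const]
  exact halfComb_zero c

theorem wirt_mul (hf : DifferentiableAt ℝ f z) (hg : DifferentiableAt ℝ g z) :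
    wirt c (fun z => f z * g z) z = wirt c f z * g z + f z * wirt c g z := by
  have h : ∀ v, fderiv ℝ (fun z => f z * g z) z v = f z * fderiv ℝ g z v + fderiv ℝ f z v * g z :=
    fun v => by
      have h1 : HasFDerivAt (fun z => f z * g z) _ z := hf.hasFDerivAt.mul' hg.hasFDerivAt
      rw [h1.fderiv]
      rfl
  rw [wirt, h, h, halfComb_add, add_comm]
  exact congrArg₂ _ (map_halfComb c _ _ (LinearMap.mulRight ℂ (g z))).symm
    (map_halfComb c _ _ (LinearMap.mulLeft ℂ (f z))).symm

theorem wirt_const_smul (hf : DifferentiableAt ℝ f z) (a : ℂ) :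
    wirt c (fun z => a • f z) z = a • wirt c f z := by
  have h : ∀ v, fderiv ℝ (fun z => a • f z) z v = a • fderiv ℝ f z v := fun v => by
    rw [(hf.hasFDerivAt.fun_const_smul a).fderiv]
    rfl
  rw [wirt, h, h]
  exact halfComb_smul c _ _ a

theorem wirt_sum {ι : Type*} (s : Finset ι) {f : ι → ℂ → Op n}
    (hf : ∀ i ∈ s, DifferentiableAt ℝ (f i) z) :
    wirt c (fun z => ∑ i ∈ s, f i z) z = ∑ i ∈ s, wirt c (f i) z := by
  simp only [wirt, fderiv_fun_sum hf, sum_apply]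
  exact halfComb_sum c s _ _

theorem wirt_sub (hf : DifferentiableAt ℝ f z) (hg : DifferentiableAt ℝ g z) :
    wirt c (fun z => f z - g z) z = wirt c f z - wirt c g z := by
  simp only [wirt, fderiv_fun_sub hf hg, sub_apply]
  exact halfComb_sub c _ _ _ _

theorem star_wirt (hf : DifferentiableAt ℝ f z) :
    star (wirt c f z) = wirt (starRingEnd ℂ c) (fun z => star (f z)) z := by
  have h : ∀ v, fderiv ℝ (fun z => star (f z)) z v = star (fderiv ℝ f z v) := fun v => by
    rw [hf.hasFDerivAt.star.fderiv]
    rfl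
  rw [wirt, wirt, h, h]
  exact star_halfComb (V := Op n) c _ _

theorem wirt_I_eq_zero_of_analyticAt (hf : AnalyticAt ℂ f z) : wirt Complex.I f z = 0 := by
  have h := (differentiableAt_complex_iff_differentiableAt_real.1 hf.differentiableAt).2
  rw [wirt, h]
  exact halfComb_I_smul _

theorem differentiableAt_of_wirt_I_eq_zero (hf : DifferentiableAt ℝ f z)
    (h : wirt Complex.I f z = 0) : DifferentiableAt ℂ f z :=
  differentiableAt_complex_iff_differentiableAt_real.2 ⟨hf, eq_of_halfComb_I_eq_zero h⟩

theorem wirt_neg_I_eq_deriv (hf : AnalyticAt ℂ f z) : wirt (-Complex.I) f z = deriv f z := by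
  have h := (differentiableAt_complex_iff_differentiableAt_real.1 hf.differentiableAt).2
  have h1 : fderiv ℝ f z 1 = deriv f z := by
    rw [hf.differentiableAt.fderiv_restrictScalars ℝ]
    exact fderiv_apply_one_eq_deriv
  rw [wirt, h, h1]
  exact halfComb_neg_I_smul _

theorem wirt_I_comp {τ : ℂ → ℂ} (hf : DifferentiableAt ℝ f (τ z)) (hτ : AnalyticAt ℂ τ z) :
    wirt Complex.I (f ∘ τ) z = starRingEnd ℂ (deriv τ z) • wirt Complex.I f (τ z) := by
  have h1 : HasFDerivAt τ ((fderiv ℂ τ z).restrictScalars ℝ) z :=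
    hτ.differentiableAt.hasFDerivAt.restrictScalars ℝ
  have h2 : ∀ v, fderiv ℝ (f ∘ τ) z v = fderiv ℝ f (τ z) (v * deriv τ z) := fun v => by
    rw [(hf.hasFDerivAt.comp z h1).fderiv]
    change fderiv ℝ f (τ z) (fderiv ℂ τ z v) = _
    rw [fderiv_eq_smul_deriv, smul_eq_mul]
  have h3 : ∀ v : ℂ, fderiv ℝ f (τ z) v =
      (v.re : ℂ) • fderiv ℝ f (τ z) 1 + (v.im : ℂ) • fderiv ℝ f (τ z) Complex.I := fun v => by
    have : v = v.re • (1 : ℂ) + v.im • Complex.I := by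
      simp [Complex.re_add_im]
    conv_lhs => rw [this]
    rw [map_add, map_smul, map_smul]
    rfl
  rw [wirt, wirt, h2, h2, h3 (1 * deriv τ z), h3 (Complex.I * deriv τ z), one_mul,
    Complex.I_mul_re, Complex.I_mul_im]
  exact halfComb_I_mul _ _ _

end Wirtinger

/-! ### Holomorphic idempotents from smooth projections, and back -/

section Projections

variable {n : ℕ} {f : ℂ → Op n} {z₀ : ℂ}

/-- A smooth family of projections `f` with `(1 - f) ∂̄f = 0` defines a holomorphic subbundle. -/
theorem holAt_of_wirt (hf : ∀ᶠ z in 𝓝 z₀, DifferentiableAt ℝ f z)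
    (hid : ∀ᶠ z in 𝓝 z₀, f z * f z = f z)
    (hrk : ∀ᶠ z in 𝓝 z₀, Module.finrank ℂ (ran (f z)) = Module.finrank ℂ (ran (f z₀)))
    (hw : ∀ᶠ z in 𝓝 z₀, f z * wirt Complex.I f z = wirt Complex.I f z) :
    HolAt (fun z => ran (f z)) z₀ := by
  set P := f z₀ with hP
  have hPP : P * P = P := hid.self_of_nhds
  let T : ℂ → Op n := fun z => P * f z + (1 - P)
  -- The idempotent with the range of `f z` but with the fixed kernel of `P = f z₀`. Unlike the
  -- projection `f`, it is holomorphic. The operator `T` is invertible near `z₀` as `T z₀ = 1`.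
  let Q : ℂ → Op n := fun z => f z * (Ring.inverse (T z) * P)
  have hTd : ∀ᶠ z in 𝓝 z₀, DifferentiableAt ℝ T z := by
    filter_upwards [hf] with z hz
    exact (hz.const_mul P).add_const _
  have hTu : ∀ᶠ z in 𝓝 z₀, IsUnit (T z) := by
    refine hTd.self_of_nhds.continuousAt.eventually (Units.isOpen.mem_nhds ?_)
    have : T z₀ = 1 := by simp [T, ← hP, hPP]
    change IsUnit (T z₀)
    rw [this]
    exact isUnit_one
  have hQd : ∀ᶠ z in 𝓝 z₀, DifferentiableAt ℝ Q z := by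
    filter_upwards [hf, hTd, hTu] with z h1 h2 h3
    exact h1.mul (((differentiableAt_inverse h3).comp z h2).mul_const P)
  have hPQ : ∀ᶠ z in 𝓝 z₀, P * Q z = P := by
    filter_upwards [hTu] with z hz
    have h1 : P * T z = P * f z := by
      simp only [T]
      rw [mul_add, ← mul_assoc, hPP, mul_sub, mul_one, hPP, sub_self, add_zero]
    simp only [Q]
    rw [← mul_assoc, ← h1, mul_assoc, ← mul_assoc (T z), Ring.mul_inverse_cancel _ hz, one_mul,
      hPP]
  have hfQ : ∀ᶠ z in 𝓝 z₀, f z * Q z = Q z := by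
    filter_upwards [hid] with z hz
    simp only [Q]
    rw [← mul_assoc, hz]
  have hQQ : ∀ᶠ z in 𝓝 z₀, Q z * Q z = Q z := by
    filter_upwards [hPQ] with z hz
    conv_lhs => enter [1]; simp only [Q]
    rw [mul_assoc, mul_assoc, hz]
  have hran : ∀ᶠ z in 𝓝 z₀, ran (Q z) = ran (f z) := by
    filter_upwards [hfQ, hPQ, hrk] with z h1 h2 h3
    refine Submodule.eq_of_le_of_finrank_le ?_ ?_
    · rintro _ ⟨v, rfl⟩
      exact ⟨Q z v, congrArg (fun A : Op n => A v) h1⟩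
    · rw [h3]
      have h4 : ran P ≤ (ran (Q z)).map (P : Cn n →ₗ[ℂ] Cn n) := by
        rintro _ ⟨v, rfl⟩
        exact ⟨Q z v, apply_mem_ran _ _, congrArg (fun A : Op n => A v) h2⟩
      exact (Submodule.finrank_mono h4).trans (Submodule.finrank_map_le _ _)
  have hQf : ∀ᶠ z in 𝓝 z₀, Q z * f z = f z := by
    filter_upwards [hran, hQQ] with z h1 h2
    ext1 v
    exact (mem_ran_of_idem h2).1 (h1 ▸ apply_mem_ran (f z) v)
  -- Differentiating `P Q = P` shows that `∂̄Q` has values in `ker P`; differentiating `f Q = Q`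
  -- shows that it has values in `ran f = ran Q`. These subspaces are complementary.
  have hQw : ∀ᶠ z in 𝓝 z₀, wirt Complex.I Q z = 0 := by
    filter_upwards [hPQ.eventually_nhds, hfQ.eventually_nhds, hQf, hf, hQd, hw, hid]
      with z h1 h2 h3 h4 h5 h6 h7
    have h8 := wirt_congr Complex.I h1
    rw [wirt_mul _ (differentiableAt_const P) h5, wirt_const, zero_mul, zero_add] at h8
    have h9 := wirt_congr Complex.I h2
    change wirt Complex.I (fun z => f z * Q z) z = _ at h9
    rw [wirt_mul _ h4 h5] at h9
    have h10 : f z * wirt Complex.I Q z = wirt Complex.I Q z := by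
      have e1 := congrArg (f z * ·) h9
      simp only [mul_add, ← mul_assoc, h6, h7] at e1
      rw [e1] at h9
      exact h9
    have h11 : Q z * wirt Complex.I Q z = 0 := by
      change f z * (Ring.inverse (T z) * P) * _ = _
      rw [mul_assoc, mul_assoc, h8, mul_zero, mul_zero]
    rw [← h10, ← h3, mul_assoc, h10, h11]
  refine ⟨Q, ⟨?_, hQQ⟩, hran⟩
  rw [Complex.analyticAt_iff_eventually_differentiableAt]
  filter_upwards [hQd, hQw] with z h1 h2
  exact differentiableAt_of_wirt_I_eq_zero h1 h2

theorem starProjection_mul_of_le {K L : Submodule ℂ (Cn n)} (h : K ≤ L) :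
    L.starProjection * K.starProjection = K.starProjection := by
  ext1 v
  exact Submodule.starProjection_eq_self_iff.2 (h (K.starProjection_apply_mem v))

theorem starProjection_mul_of_le' {K L : Submodule ℂ (Cn n)} (h : K ≤ L) :
    K.starProjection * L.starProjection = K.starProjection := by
  have h1 := congrArg star (starProjection_mul_of_le h)
  rwa [star_mul, (isSelfAdjoint_starProjection K).star_eq,
    (isSelfAdjoint_starProjection L).star_eq] at h1

/-- The orthogonal projection onto the range of an idempotent. -/
theorem isUnit_and_starProjection_ran_eq {Q : Op n} (hQ : Q * Q = Q) :
    IsUnit (Q + star Q - 1) ∧ (ran Q).starProjection = Q * Ring.inverse (Q + star Q - 1) := by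
  have h1 : (ran Q).starProjection * Q = Q := by
    ext1 v
    exact Submodule.starProjection_eq_self_iff.2 (apply_mem_ran Q v)
  have h2 : Q * (ran Q).starProjection = (ran Q).starProjection := by
    ext1 v
    exact (mem_ran_of_idem hQ).1 ((ran Q).starProjection_apply_mem v)
  have h3 := congrArg star h2
  rw [star_mul, (isSelfAdjoint_starProjection _).star_eq] at h3
  have h4 : (ran Q).starProjection * (Q + star Q - 1) = Q := by
    rw [mul_sub, mul_add, h1, h3, mul_one, add_sub_cancel_right]
  have hu : IsUnit (Q + star Q - 1) := by
    -- In the kernel `Q v = 0` and hence `star Q v = v`, so `⟪v, v⟫ = ⟪v, Q v⟫ = 0`.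
    have hinj : ∀ v, (Q + star Q - 1) v = 0 → v = 0 := fun v hv => by
      have h5 : Q v = 0 := by
        have := congrArg (fun A : Op n => A v) h4
        change (ran Q).starProjection ((Q + star Q - 1) v) = Q v at this
        rw [← this, hv, map_zero]
      have h6 : star Q v = v := by
        have : Q v + star Q v - v = 0 := hv
        rwa [h5, zero_add, sub_eq_zero] at this
      have h7 : inner ℂ (star Q v) v = inner ℂ v (Q v) := ContinuousLinearMap.adjoint_inner_left _ _ _
      rwa [h5, h6, inner_zero_right, inner_self_eq_zero] at h7
    rw [ContinuousLinearMap.isUnit_iff_isUnit_toLinearMap, LinearMap.isUnit_iff_ker_eq_bot]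
    exact LinearMap.ker_eq_bot'.2 hinj
  refine ⟨hu, ?_⟩
  conv_rhs => rw [← h4]
  rw [mul_assoc, h4, Ring.mul_inverse_cancel _ hu, mul_one]

end Projections

/-! ### Smoothness and derivatives of orthogonal projections -/

section SmoothProjections

variable {n : ℕ} {z₀ : ℂ}

theorem IdemAt.contDiffAt_starProjection {Q : ℂ → Op n} (hQ : IdemAt Q z₀) :
    ContDiffAt ℝ ∞ (fun z => (ran (Q z)).starProjection) z₀ := by
  have hQc : ContDiffAt ℝ ∞ Q z₀ := (hQ.an.contDiffAt (n := ∞)).restrict_scalars ℝ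
  have hRc : ContDiffAt ℝ ∞ (fun z => Q z + star (Q z) - 1) z₀ :=
    (hQc.add ((starL' ℝ : Op n ≃L[ℝ] Op n).contDiff.contDiffAt.comp z₀ hQc)).sub contDiffAt_const
  have hinv : ContDiffAt ℝ ∞ Ring.inverse (Q z₀ + star (Q z₀) - 1) := by
    obtain ⟨u, hu⟩ := (isUnit_and_starProjection_ran_eq hQ.idem.self_of_nhds).1
    rw [← hu]
    exact contDiffAt_ringInverse ℝ u
  refine (hQc.mul (hinv.comp z₀ hRc)).congr_of_eventuallyEq ?_
  filter_upwards [hQ.idem] with z hz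
  exact (isUnit_and_starProjection_ran_eq hz).2

theorem IdemAt.wirt_starProjection {Q : ℂ → Op n} (hQ : IdemAt Q z₀) (c : ℂ) :
    wirt c (fun z => (ran (Q z)).starProjection) z₀ = wirt c Q z₀ * (ran (Q z₀)).starProjection +
      Q z₀ * wirt c (fun z => (ran (Q z)).starProjection) z₀ := by
  rw [← wirt_mul c (hQ.an.differentiableAt.restrictScalars ℝ)
    (hQ.contDiffAt_starProjection.differentiableAt (by simp))]
  refine wirt_congr c ?_
  filter_upwards [hQ.idem] with z hz
  ext1 v
  exact ((mem_ran_of_idem hz).1 ((ran (Q z)).starProjection_apply_mem v)).symm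

theorem starProjection_mul_eq_iff {L : Submodule ℂ (Cn n)} {X : Op n} :
    L.starProjection * X = X ↔ ∀ v, X v ∈ L :=
  ⟨fun h v => h ▸ L.starProjection_apply_mem (X v), fun h => by
    ext1 v
    exact Submodule.starProjection_eq_self_iff.2 (h v)⟩

end SmoothProjections

/-! ### Wirtinger derivatives on the surface -/

section Manifold

variable {n : ℕ} {M : Type*} [TopologicalSpace M] [ChartedSpace ℂ M]

theorem dz_eq_wirt (u : M → Op n) (p : M) :
    dz u p = wirt (-Complex.I) (u ∘ (chartAt ℂ p).symm) (chartAt ℂ p p) := by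
  simp only [dz, wirt, halfComb, neg_smul, sub_eq_add_neg]

theorem dzbar_eq_wirt (u : M → Op n) (p : M) :
    dzbar u p = wirt Complex.I (u ∘ (chartAt ℂ p).symm) (chartAt ℂ p p) := rfl

theorem contMDiff_iff_chart {u : M → Op n} :
    ContMDiff 𝓘(ℝ, ℂ) 𝓘(ℝ, Op n) ∞ u ↔
      ∀ p, ContDiffAt ℝ ∞ (u ∘ (chartAt ℂ p).symm) (chartAt ℂ p p) := by
  refine forall_congr' fun p => ?_
  rw [contMDiffAt_iff]
  simp only [mfld_simps, contDiffWithinAt_univ]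
  refine ⟨fun h => h.2, fun h => ⟨?_, h⟩⟩
  have h1 : ContinuousAt ((u ∘ (chartAt ℂ p).symm) ∘ chartAt ℂ p) p :=
    ContinuousAt.comp h.continuousAt ((chartAt ℂ p).continuousAt (mem_chart_source ℂ p))
  refine h1.congr ?_
  filter_upwards [(chartAt ℂ p).open_source.mem_nhds (mem_chart_source ℂ p)] with q hq
  simp [(chartAt ℂ p).left_inv hq]

variable [IsManifold 𝓘(ℂ, ℂ) ω M]

/-- `dzbar` is taken in a chart depending on the point. In a fixed chart `∂̄` differs from it by a
scalar, which does not affect where its values lie. -/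
theorem wirt_I_chart {u : M → Op n}
    (hu : ∀ q, DifferentiableAt ℝ (u ∘ (chartAt ℂ q).symm) (chartAt ℂ q q)) {p : M} {z : ℂ}
    (hz : z ∈ (chartAt ℂ p).target) :
    DifferentiableAt ℝ (u ∘ (chartAt ℂ p).symm) z ∧
      ∃ a : ℂ, wirt Complex.I (u ∘ (chartAt ℂ p).symm) z = a • dzbar u ((chartAt ℂ p).symm z) := by
  set q := (chartAt ℂ p).symm z with hq
  have h1 := comp_transition u hz (mem_chart_source ℂ q)
  have h2 := analyticAt_transition hz (mem_chart_source ℂ q)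
  have h3 : DifferentiableAt ℝ (u ∘ (chartAt ℂ q).symm)
      ((chartAt ℂ q ∘ (chartAt ℂ p).symm) z) := hu q
  refine ⟨?_, starRingEnd ℂ (deriv (chartAt ℂ q ∘ (chartAt ℂ p).symm) z), ?_⟩
  · exact (h3.comp z (h2.differentiableAt.restrictScalars ℝ)).congr_of_eventuallyEq h1.symm
  · rw [← wirt_congr _ h1, wirt_I_comp h3 h2]
    rfl

/-- The orthogonal projections onto the fibres of `E`. -/
noncomputable def proj (E : Fam n M) (p : M) : Op n := (E p).starProjection

end Manifold

/-! ### From extended solutions to super-horizontal flags -/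

section FromSolutions

variable {n : ℕ} {M : Type*} [TopologicalSpace M] [ChartedSpace ℂ M]

theorem wirt_rootMean {Ψ : Circle → ℂ → Op n} {z : ℂ} (h : ∀ w, DifferentiableAt ℝ (Ψ w) z)
    (N : ℕ) (e : Circle → ℂ) (c : ℂ) :
    DifferentiableAt ℝ (fun z => rootMean N fun w => e w • Ψ w z) z ∧
    wirt c (fun z => rootMean N fun w => e w • Ψ w z) z =
      rootMean N fun w => e w • wirt c (Ψ w) z := by
  have h1 : ∀ w, DifferentiableAt ℝ (fun z => e w • Ψ w z) z := fun w => (h w).fun_const_smul _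
  have h2 : DifferentiableAt ℝ (fun z => ∑ t ∈ Finset.range N,
      e (Circle.exp (2 * Real.pi * t / N)) • Ψ (Circle.exp (2 * Real.pi * t / N)) z) z :=
    DifferentiableAt.fun_sum fun t _ => h1 _
  refine ⟨h2.fun_const_smul _, ?_⟩
  simp only [rootMean]
  rw [wirt_const_smul c h2, wirt_sum c _ fun t _ => h1 _]
  simp only [wirt_const_smul c (h _)]

variable {Φ : M → Circle → Op n} {m : Fin n → ℤ} {r k : ℤ}

/-- The projection is a mean of `e(w) Φ_w`, whose `z`-derivative is the mean of `e(w) Φ_w (1 -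
w⁻¹)/2 α`. Along a basis vector of weight `l > i + 1` this mean picks no power of `w`, so it
vanishes; for `z̄` the same happens for `l > i`. -/
theorem IsExtendedSolution.proj_mul (hΦ : IsExtendedSolution Φ)
    (hd : ∀ p, ∃ b, IsDiag b m (Φ p)) (hm : ∀ j, -r ≤ m j ∧ m j ≤ k) (i : ℤ) (p : M) :
    DifferentiableAt ℝ (proj (fun q => loopFlag (Φ q) i) ∘ (chartAt ℂ p).symm) (chartAt ℂ p p) ∧
    (∀ v, dz (proj fun q => loopFlag (Φ q) i) p v ∈ loopFlag (Φ p) (i + 1)) ∧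
    ∀ v, dzbar (proj fun q => loopFlag (Φ q) i) p v ∈ loopFlag (Φ p) i := by
  obtain ⟨hu, -, hs, hab⟩ := hΦ
  obtain ⟨N, e, h1, h2, h3⟩ := exists_mean r k i
  have hproj : proj (fun q => loopFlag (Φ q) i) = fun q => rootMean N fun w => e w • Φ q w := by
    funext q
    obtain ⟨b, hb⟩ := hd q
    exact hb.starProjection_eq_rootMean fun j => h1 _ (hm j).1 (hm j).2
  have hdiff : ∀ w, DifferentiableAt ℝ ((fun q => Φ q w) ∘ (chartAt ℂ p).symm) (chartAt ℂ p p) :=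
    fun w => (contMDiff_iff_chart.1 (hs w) p).differentiableAt (by simp)
  obtain ⟨b, hb⟩ := hd p
  obtain ⟨α, β, hαβ⟩ := hab p
  have hcancel : ∀ (w : Circle) (X Y : Op n), star (Φ p w) * X = Y → X = Φ p w * Y := by
    rintro w X _ rfl
    rw [← mul_assoc, Unitary.mul_star_self_of_mem (hu p w), one_mul]
  have key : ∀ (f : Circle → ℂ) (X : Op n) (j : Fin n) (v : Cn n),
      inner ℂ (b j) (rootMean N (fun w => e w • (Φ p w * (f w • X))) v) =
        rootMean N (fun w => e w * (w : ℂ) ^ m j * f w) * inner ℂ (b j) (X v) := by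
    intro f X j v
    have h4 := map_rootMean ((innerSL ℂ (b j)).toLinearMap ∘ₗ
      (ContinuousLinearMap.apply ℂ (Cn n) v).toLinearMap) N fun w => e w • (Φ p w * (f w • X))
    refine h4.trans ?_
    rw [← smul_eq_mul, ← rootMean_smul_const]
    congr 1
    funext w
    change inner ℂ (b j) (e w • (Φ p w (f w • X v))) = _
    rw [inner_smul_right, hb.inner_apply, inner_smul_right, smul_eq_mul]
    ring
  refine ⟨?_, fun v => ?_, fun v => ?_⟩
  · rw [hproj]
    exact (wirt_rootMean hdiff N e 0).1
  · have h4 : dz (proj fun q => loopFlag (Φ q) i) p =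
        rootMean N fun w => e w • (Φ p w * (((1 - (w : ℂ)⁻¹) / 2) • α)) := by
      rw [hproj, dz_eq_wirt]
      refine (wirt_rootMean hdiff N e (-Complex.I)).2.trans ?_
      congr 1
      funext w
      rw [← dz_eq_wirt, hcancel w _ _ (hαβ w).1]
    rw [hb.loopFlag_eq, mem_basisFlag]
    intro j hj
    rw [h4, key, h2 _ (hm j).1 (hm j).2 hj, zero_mul]
  · have h4 : dzbar (proj fun q => loopFlag (Φ q) i) p =
        rootMean N fun w => e w • (Φ p w * (((1 - (w : ℂ)) / 2) • β)) := by
      rw [hproj, dzbar_eq_wirt]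
      refine (wirt_rootMean hdiff N e Complex.I).2.trans ?_
      congr 1
      funext w
      rw [← dzbar_eq_wirt, hcancel w _ _ (hαβ w).2]
    rw [hb.loopFlag_eq, mem_basisFlag]
    intro j hj
    rw [h4, key, h3 _ (hm j).1 (hm j).2 hj, zero_mul]

variable [IsManifold 𝓘(ℂ, ℂ) ω M]

theorem IsExtendedSolution.hol (hΦ : IsExtendedSolution Φ)
    (hd : ∀ p, ∃ b, IsDiag b m (Φ p)) (hm : ∀ j, -r ≤ m j ∧ m j ≤ k) (i : ℤ) :
    Hol fun p => loopFlag (Φ p) i := by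
  intro p
  set E : Fam n M := fun p => loopFlag (Φ p) i
  have h1 := fun q => (hΦ.proj_mul hd hm i q).1
  have hran : ∀ q, ran (proj E q) = E q := fun q => ran_starProjection _
  have hfin : ∀ q, Module.finrank ℂ (E q) = Fintype.card {j // m j ≤ i} := fun q => by
    obtain ⟨b, hb⟩ := hd q
    change Module.finrank ℂ (loopFlag (Φ q) i) = _
    rw [hb.loopFlag_eq, finrank_basisFlag]
  have h2 := holAt_of_wirt (f := proj E ∘ (chartAt ℂ p).symm) (z₀ := chartAt ℂ p p)
    (eventually_target.mono fun z hz => (wirt_I_chart h1 hz).1)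
    (Eventually.of_forall fun z => starProjection_mul_self _)
    (Eventually.of_forall fun z => by
      rw [Function.comp_apply, Function.comp_apply, hran, hran, hfin, hfin])
    (eventually_target.mono fun z hz => by
      obtain ⟨a, ha⟩ := (wirt_I_chart h1 hz).2
      rw [ha, mul_smul_comm]
      congr 1
      exact starProjection_mul_eq_iff.2 (hΦ.proj_mul hd hm i _).2.2)
  simp only [Function.comp_apply, hran] at h2
  exact h2

/-- `s' = Q's + Qs'`, and differentiating `Q = πQ` gives `Q' = (∂π)Q + πQ'`. The term with `∂π` is
in `A_{i+1}`, the others are in `A_i`. -/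
theorem IsExtendedSolution.zDeriv_mem (hΦ : IsExtendedSolution Φ)
    (hd : ∀ p, ∃ b, IsDiag b m (Φ p)) (hm : ∀ j, -r ≤ m j ∧ m j ≤ k) {i : ℤ} {p : M}
    {s : M → Cn n} (hs : IsHolSectionNear (fun q => loopFlag (Φ q) i) s p) :
    zDeriv 1 s p ∈ loopFlag (Φ p) (i + 1) := by
  set E : Fam n M := fun p => loopFlag (Φ p) i
  have hmono : E p ≤ loopFlag (Φ p) (i + 1) := by
    obtain ⟨b, hb⟩ := hd p
    change loopFlag (Φ p) i ≤ _
    rw [hb.loopFlag_eq, hb.loopFlag_eq]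
    exact basisFlag_mono b m (by omega)
  obtain ⟨hdiff, hdz, -⟩ := hΦ.proj_mul hd hm i p
  obtain ⟨Q, hQ, hQE⟩ := hΦ.hol hd hm i p
  set z₀ := chartAt ℂ p p
  have h1 := (isHolSectionNear_chart_iff (E := E) (s := s) (mem_chart_target ℂ p)).1
    (by rwa [(chartAt ℂ p).left_inv (mem_chart_source ℂ p)])
  rw [isHolSectionNear_iff] at h1
  have h2 := hQ.deriv_section h1.1 ((h1.2.and hQE).mono fun z hz => hz.2 ▸ hz.1)
  have hE0 : ran (Q z₀) = E p := hQE.self_of_nhds.trans (loc_self p E)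
  have h3 : wirt (-Complex.I) Q z₀ = dz (proj E) p * Q z₀ + proj E p * wirt (-Complex.I) Q z₀ := by
    have h4 := wirt_mul (-Complex.I) hdiff (hQ.an.differentiableAt.restrictScalars ℝ)
    rw [← dz_eq_wirt] at h4
    have h5 : (proj E ∘ (chartAt ℂ p).symm) z₀ = proj E p := by
      simp [z₀, (chartAt ℂ p).left_inv (mem_chart_source ℂ p)]
    rw [h5] at h4
    rw [← h4]
    refine wirt_congr _ ?_
    filter_upwards [hQE] with z hz
    ext1 v
    have h6 : Q z v ∈ loc p E z := hz ▸ apply_mem_ran (Q z) v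
    exact (Submodule.starProjection_eq_self_iff.2 h6).symm
  rw [zDeriv, iteratedDeriv_one, h2, ← wirt_neg_I_eq_deriv hQ.an, h3]
  refine Submodule.add_mem _ (Submodule.add_mem _ (hdz _) (hmono ?_)) (hmono ?_)
  · exact (E p).starProjection_apply_mem _
  · exact hE0 ▸ apply_mem_ran _ _

end FromSolutions

/-! ### From super-horizontal flags to extended solutions -/

section ToSolutions

variable {n : ℕ} {M : Type*} [TopologicalSpace M] [ChartedSpace ℂ M]

theorem Hol.contDiffAt_proj {E : Fam n M} (hE : Hol E) (p : M) :
    ContDiffAt ℝ ∞ (proj E ∘ (chartAt ℂ p).symm) (chartAt ℂ p p) := by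
  obtain ⟨Q, hQ, hQE⟩ := hE p
  refine hQ.contDiffAt_starProjection.congr_of_eventuallyEq ?_
  filter_upwards [hQE] with z hz
  rw [hz]
  rfl

/-- Differentiate `π = Qπ` and use `∂̄Q = 0`. -/
theorem Hol.dzbar_proj_mem {E : Fam n M} (hE : Hol E) (p : M) (v : Cn n) :
    dzbar (proj E) p v ∈ E p := by
  obtain ⟨Q, hQ, hQE⟩ := hE p
  have h1 : wirt Complex.I (fun z => (ran (Q z)).starProjection) (chartAt ℂ p p) =
      dzbar (proj E) p := by
    rw [dzbar_eq_wirt]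
    refine wirt_congr _ ?_
    filter_upwards [hQE] with z hz
    rw [hz]
    rfl
  have h2 := hQ.wirt_starProjection Complex.I
  rw [wirt_I_eq_zero_of_analyticAt hQ.an, zero_mul, zero_add, h1] at h2
  rw [h2, ← loc_self p E, ← hQE.self_of_nhds]
  exact apply_mem_ran _ _

/-- Differentiating `π = Qπ` gives `∂π = Q'π + Q ∂π`. On a vector `x` of the fibre, `Q'x` is the
derivative of the section `z ↦ Q z x`. -/
theorem Hol.dz_proj_mem [IsManifold 𝓘(ℂ, ℂ) ω M] {E F : Fam n M} (hE : Hol E) {p : M} (hEF : E p ≤ F p)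
    (h : ∀ s, IsHolSectionNear E s p → zDeriv 1 s p ∈ F p) (v : Cn n) :
    dz (proj E) p v ∈ F p := by
  obtain ⟨Q, hQ, hQE⟩ := hE p
  set z₀ := chartAt ℂ p p
  have hE0 : ran (Q z₀) = E p := hQE.self_of_nhds.trans (loc_self p E)
  have h1 : wirt (-Complex.I) (fun z => (ran (Q z)).starProjection) z₀ = dz (proj E) p := by
    rw [dz_eq_wirt]
    refine wirt_congr _ ?_
    filter_upwards [hQE] with z hz
    rw [hz]
    rfl
  have h2 := hQ.wirt_starProjection (-Complex.I)
  rw [h1, wirt_neg_I_eq_deriv hQ.an] at h2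
  rw [h2]
  refine Submodule.add_mem _ ?_ (hEF (hE0 ▸ apply_mem_ran _ _))
  set x := (ran (Q z₀)).starProjection v
  have hx : AnalyticAt ℂ (fun z => Q z x) z₀ := hQ.an.clm_apply analyticAt_const
  have h3 := (isHolSectionNear_comp_chart (E := E) (mem_chart_target ℂ p)).2
    (isHolSectionNear_iff.2 ⟨hx, hQE.mono fun z hz => hz ▸ apply_mem_ran _ _⟩)
  rw [(chartAt ℂ p).left_inv (mem_chart_source ℂ p)] at h3
  have h4 := h _ h3
  rw [zDeriv, iteratedDeriv_one,
    (comp_chart_comp_symm (fun z => Q z x) (mem_chart_target ℂ p)).deriv_eq] at h4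
  have h5 : deriv (fun z => Q z x) z₀ = deriv Q z₀ x := by
    have := hQ.an.differentiableAt.hasDerivAt.clm_apply (hasDerivAt_const z₀ x)
    simpa using this.deriv
  rwa [h5] at h4

/-- A loop whose filtration is super-horizontal, in terms of the orthogonal projections, is an
extended solution. -/
theorem isExtendedSolution_of_proj {Φ : M → Circle → Op n} {m : Fin n → ℤ} {r k : ℤ}
    {A : ℤ → Fam n M} (hd : ∀ p, ∃ b, IsDiag b m (Φ p)) (hm : ∀ j, -r ≤ m j ∧ m j ≤ k)
    (hA : ∀ i p, loopFlag (Φ p) i = A i p) (hmono : ∀ i, A i ≤ A (i + 1))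
    (hs : ∀ i p, ContDiffAt ℝ ∞ (proj (A i) ∘ (chartAt ℂ p).symm) (chartAt ℂ p p))
    (hdz : ∀ i p v, dz (proj (A i)) p v ∈ A (i + 1) p)
    (hdzbar : ∀ i p v, dzbar (proj (A i)) p v ∈ A i p) : IsExtendedSolution Φ := by
  have hΦ : ∀ w, (fun p => Φ p w) = fun p => (w : ℂ) ^ k • (1 : Op n) -
      ∑ i ∈ Finset.Ico (-r) k, ((w : ℂ) ^ (i + 1) - (w : ℂ) ^ i) • proj (A i) p := fun w => by
    funext p
    obtain ⟨b, hb⟩ := hd p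
    rw [hb.eq_sub_sum hm w]
    simp only [hA]
    rfl
  have hdiff : ∀ i p, DifferentiableAt ℝ (proj (A i) ∘ (chartAt ℂ p).symm) (chartAt ℂ p p) :=
    fun i p => (hs i p).differentiableAt (by simp)
  have hsa : ∀ i p, star (proj (A i) p) = proj (A i) p := fun i p =>
    (isSelfAdjoint_starProjection _).star_eq
  have hstar : ∀ i p, star (dz (proj (A i)) p) = dzbar (proj (A i)) p := fun i p => by
    rw [dz_eq_wirt, star_wirt _ (hdiff i p), dzbar_eq_wirt]
    simp only [map_neg, Complex.conj_I, neg_neg, Function.comp_apply, hsa]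
    rfl
  have hself : ∀ p i, (proj (A i) ∘ (chartAt ℂ p).symm) (chartAt ℂ p p) = proj (A i) p :=
    fun p i => by simp [(chartAt ℂ p).left_inv (mem_chart_source ℂ p)]
  have hX : ∀ i p, proj (A (i + 1)) p * dz (proj (A i)) p = dz (proj (A i)) p := fun i p =>
    starProjection_mul_eq_iff.2 (hdz i p)
  have hY : ∀ i p, proj (A i) p * dzbar (proj (A i)) p = dzbar (proj (A i)) p := fun i p =>
    starProjection_mul_eq_iff.2 (hdzbar i p)
  -- The adjoint of `π ∂̄π = ∂̄π` is `(∂π) π = ∂π`; comparison with `∂π = (∂π) π + π ∂π` leaves `π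
  -- ∂π = 0`.
  have hX0 : ∀ i p, proj (A i) p * dz (proj (A i)) p = 0 := fun i p => by
    have h1 := congrArg star (hY i p)
    rw [star_mul, ← hstar, star_star, hsa] at h1
    have h2 := wirt_mul (-Complex.I) (hdiff i p) (hdiff i p)
    rw [hself, ← dz_eq_wirt, h1] at h2
    have h3 : wirt (-Complex.I) (fun z => (proj (A i) ∘ (chartAt ℂ p).symm) z *
        (proj (A i) ∘ (chartAt ℂ p).symm) z) (chartAt ℂ p p) = dz (proj (A i)) p := by
      rw [dz_eq_wirt]
      exact wirt_congr _ (Eventually.of_forall fun z => starProjection_mul_self _)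
    rw [h3] at h2
    exact left_eq_add.1 h2
  -- Differentiate `π_{i-1} π_i = π_{i-1}`. The adjoint of `hX` gives `(∂̄π_{i-1}) π_i = ∂̄π_{i-1}`,
  -- so the remaining term vanishes.
  have hY0 : ∀ i p, proj (A (i - 1)) p * dzbar (proj (A i)) p = 0 := fun i p => by
    have h1 := congrArg star (hX (i - 1) p)
    rw [star_mul, hstar, hsa, sub_add_cancel] at h1
    have h2 := wirt_mul Complex.I (hdiff (i - 1) p) (hdiff i p)
    rw [hself, hself, ← dzbar_eq_wirt, ← dzbar_eq_wirt, h1] at h2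
    have h3 : wirt Complex.I (fun z => (proj (A (i - 1)) ∘ (chartAt ℂ p).symm) z *
        (proj (A i) ∘ (chartAt ℂ p).symm) z) (chartAt ℂ p p) = dzbar (proj (A (i - 1))) p := by
      rw [dzbar_eq_wirt]
      refine wirt_congr _ (Eventually.of_forall fun z => starProjection_mul_of_le' ?_)
      have := hmono (i - 1)
      rw [sub_add_cancel] at this
      exact this _
    rw [h3] at h2
    exact left_eq_add.1 h2
  have horth : ∀ i p (X : Op n) v, proj (A i) p * X = 0 → X v ∈ (A i p)ᗮ := fun i p X v h => by
    rw [← Submodule.starProjection_apply_eq_zero_iff]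
    exact congrArg (fun B : Op n => B v) h
  have hder : ∀ (c : ℂ) (w : Circle) p,
      wirt c ((fun q => Φ q w) ∘ (chartAt ℂ p).symm) (chartAt ℂ p p) =
      ∑ i ∈ Finset.Ico (-r) k, ((w : ℂ) ^ i - (w : ℂ) ^ (i + 1)) •
        wirt c (proj (A i) ∘ (chartAt ℂ p).symm) (chartAt ℂ p p) := fun c w p => by
    rw [hΦ]
    have h1 : ∀ i ∈ Finset.Ico (-r) k, DifferentiableAt ℝ
        (fun z => ((w : ℂ) ^ (i + 1) - (w : ℂ) ^ i) • (proj (A i) ∘ (chartAt ℂ p).symm) z)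
        (chartAt ℂ p p) := fun i _ => (hdiff i p).fun_const_smul _
    refine (wirt_sub c (differentiableAt_const _) (DifferentiableAt.fun_sum h1)).trans ?_
    rw [wirt_const, zero_sub, wirt_sum c _ h1, ← Finset.sum_neg_distrib]
    refine Finset.sum_congr rfl fun i _ => ?_
    rw [wirt_const_smul c (hdiff i p), ← neg_sub]
    exact (congrArg Neg.neg (neg_smul (R := ℂ) (M := Op n) _ _)).trans (neg_neg _)
  refine ⟨fun p w => ?_, fun p => ?_, fun w => ?_, fun p => ?_⟩
  · obtain ⟨b, hb⟩ := hd p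
    exact hb.mem_unitary w
  · refine (congrFun (hΦ 1) p).trans ?_
    simp only [Circle.coe_one, one_zpow, sub_self]
    rw [Finset.sum_eq_zero fun i _ => zero_smul ℂ (proj (A i) p), sub_zero]
    exact one_smul ℂ (1 : Op n)
  · rw [contMDiff_iff_chart, hΦ]
    intro p
    refine ContDiffAt.sub contDiffAt_const (ContDiffAt.sum fun i _ => ?_)
    exact (hs i p).const_smul _
  · obtain ⟨b, hb⟩ := hd p
    -- On `∂π_i` the inverse loop acts by `w⁻ⁱ⁻¹` and on `∂̄π_i` by `w⁻ⁱ`. The coefficients `wⁱ -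
    -- wⁱ⁺¹` become `w⁻¹ - 1` and `1 - w`, independent of `i`, which are `-2` and `2` times the
    -- required factors.
    refine ⟨(-2 : ℂ) • ∑ i ∈ Finset.Ico (-r) k, dz (proj (A i)) p,
      (2 : ℂ) • ∑ i ∈ Finset.Ico (-r) k, dzbar (proj (A i)) p, fun w => ?_⟩
    have hw : (w : ℂ) ≠ 0 := Circle.coe_ne_zero w
    constructor
    · have h1 : ∀ i, star (Φ p w) * dz (proj (A i)) p =
          ((w : ℂ) ^ (i + 1))⁻¹ • dz (proj (A i)) p := fun i => by
        ext1 v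
        refine hb.star_apply w (by rw [hA]; exact hdz i p v) ?_
        rw [hA, add_sub_cancel_right]
        exact horth i p _ v (hX0 i p)
      rw [dz_eq_wirt, hder, Finset.mul_sum, Finset.smul_sum, Finset.smul_sum]
      refine Finset.sum_congr rfl fun i _ => ?_
      rw [← dz_eq_wirt, mul_smul_comm, h1, smul_smul, smul_smul]
      congr 1
      rw [zpow_add_one₀ hw]
      have := zpow_ne_zero i hw
      field_simp
      ring
    · have h1 : ∀ i, star (Φ p w) * dzbar (proj (A i)) p =
          ((w : ℂ) ^ i)⁻¹ • dzbar (proj (A i)) p := fun i => by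
        ext1 v
        refine hb.star_apply w (by rw [hA]; exact hdzbar i p v) ?_
        rw [hA]
        exact horth (i - 1) p _ v (hY0 i p)
      rw [dzbar_eq_wirt, hder, Finset.mul_sum, Finset.smul_sum, Finset.smul_sum]
      refine Finset.sum_congr rfl fun i _ => ?_
      rw [← dzbar_eq_wirt, mul_smul_comm, h1, smul_smul, smul_smul]
      congr 1
      rw [zpow_add_one₀ hw]
      have := zpow_ne_zero i hw
      field_simp

end ToSolutions

/-! ### The correspondence between flags and extended solutions -/

section Correspondence

variable {n : ℕ} {M : Type*} [TopologicalSpace M] [ConnectedSpace M] [ChartedSpace ℂ M]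
  [IsManifold 𝓘(ℂ, ℂ) ω M] {m : Fin n → ℤ} {r k : ℤ} {d : ℤ → ℕ}

theorem IsExtendedSolution.isSuperHorizontalFlag {Φ : M → Circle → Op n}
    (hΦ : IsExtendedSolution Φ) (hm : ∀ j, -r ≤ m j ∧ m j ≤ k)
    (hdim : ∀ i, d i = Fintype.card {j // m j ≤ i}) (hd : ∀ p, ∃ b, IsDiag b m (Φ p)) :
    IsSuperHorizontalFlag d r k fun i p => loopFlag (Φ p) i := by
  refine ⟨⟨fun i hi => funext fun p => ?_, fun i hi => funext fun p => ?_⟩, fun i => ?_,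
    fun i p => ?_, fun i p s hs => hΦ.zDeriv_mem hd hm hs⟩
  · obtain ⟨b, hb⟩ := hd p
    have : IsEmpty {j // m j ≤ i} := ⟨fun j => by have := j.2; have := hm j.1; omega⟩
    change loopFlag (Φ p) i = ⊥
    rw [hb.loopFlag_eq, basisFlag, Set.range_eq_empty, Submodule.span_empty]
  · obtain ⟨b, hb⟩ := hd p
    change loopFlag (Φ p) i = ⊤
    rw [hb.loopFlag_eq, eq_top_iff]
    exact fun v _ => mem_basisFlag.2 fun j hj => by have := hm j; omega
  · have hE := hΦ.hol hd hm i
    obtain ⟨p⟩ := (inferInstance : Nonempty M)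
    refine isHolSubbundle_iff.2 ⟨hE, ?_⟩
    obtain ⟨b, hb⟩ := hd p
    rw [← hE.finrank p, hdim, hb.loopFlag_eq, finrank_basisFlag]
  · obtain ⟨b, hb⟩ := hd p
    change loopFlag (Φ p) i ≤ loopFlag (Φ p) (i + 1)
    rw [hb.loopFlag_eq, hb.loopFlag_eq]
    exact basisFlag_mono b m (by omega)

theorem IsSuperHorizontalFlag.existsUnique_isExtendedSolution {A : ℤ → Fam n M}
    (hA : IsSuperHorizontalFlag d r k A) (hm : ∀ j, -r ≤ m j ∧ m j ≤ k)
    (hdim : ∀ i, d i = Fintype.card {j // m j ≤ i}) {Ω : Set (Circle → Op n)}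
    (hΩ : ∀ γ, γ ∈ Ω ↔ ∃ b, IsDiag b m γ) :
    ∃! Φ : M → Circle → Op n, IsExtendedSolution Φ ∧ (∀ p, Φ p ∈ Ω) ∧
      ∀ i p, loopFlag (Φ p) i = A i p := by
  obtain ⟨⟨hbot, htop⟩, hsub, hmono, hder⟩ := hA
  have hHol : ∀ i, Hol (A i) := fun i => (isHolSubbundle_iff.1 (hsub i)).1
  have hb : ∀ p, ∃ b, ∀ i, A i p = basisFlag b m i := fun p => by
    refine exists_basisFlag_eq_of_finrank (F := fun i => A i p) (r := r) (k := k)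
      (monotone_int_of_le_succ fun i => hmono i p) (congrFun (hbot _ (by omega)) p)
      (congrFun (htop k le_rfl) p) fun i => ?_
    rw [(hHol i).finrank p, (isHolSubbundle_iff.1 (hsub i)).2, hdim]
  choose b hb using hb
  -- The bases `b p` are chosen pointwise without any regularity. Smoothness is not lost, since the
  -- formula involves only the projections onto the fibres of the `A i`.
  let Φ : M → Circle → Op n := fun p w => (w : ℂ) ^ k • (1 : Op n) - ∑ i ∈ Finset.Ico (-r) k,
    ((w : ℂ) ^ (i + 1) - (w : ℂ) ^ i) • (basisFlag (b p) m i).starProjection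
  have hΦ : ∀ p, IsDiag (b p) m (Φ p) := fun p => isDiag_sub_sum (b p) hm
  have hflag : ∀ i p, loopFlag (Φ p) i = A i p := fun i p => by
    rw [(hΦ p).loopFlag_eq, hb]
  refine ⟨Φ, ⟨isExtendedSolution_of_proj (fun p => ⟨b p, hΦ p⟩) hm hflag hmono
    (fun i p => (hHol i).contDiffAt_proj p)
    (fun i p => (hHol i).dz_proj_mem (hmono i p) fun s hs => hder i p s hs)
    fun i p => (hHol i).dzbar_proj_mem p, fun p => (hΩ _).2 ⟨b p, hΦ p⟩, hflag⟩, ?_⟩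
  -- Uniqueness is pointwise: a loop in the conjugacy class is recovered from its filtration, so the
  -- differential equation is not used.
  rintro Ψ ⟨-, hΨ, hΨA⟩
  funext p w
  obtain ⟨b', hb'⟩ := (hΩ _).1 (hΨ p)
  rw [hb'.eq_sub_sum hm, (hΦ p).eq_sub_sum hm]
  simp only [hΨA, hflag]

end Correspondence

end SuperHorizontal

theorem mainTheorem4 {M : Type*} [TopologicalSpace M] [T2Space M] [ConnectedSpace M]
    [ChartedSpace ℂ M] [IsManifold 𝓘(ℂ, ℂ) ω M] {n : ℕ} (ξ : Op n) (hξ : IsIntegral ξ)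
    (r k : ℤ) (hrk : FlagBounds ξ r k) :
    (∀ A : ℤ → Fam n M,
      IsSuperHorizontalFlag (flagDim ξ) r k A ↔ Produced (flagDim ξ) r k A) ∧
    (∀ A : ℤ → Fam n M, HasEnds r k A →
      ∀ a b m, Stage (flagDim ξ) r k A a b → IsLastMin (flagDim ξ) a b m →
        Admissible (A a) (A b) (m - a) (b - m) (jump (flagDim ξ) m) (flagDim ξ m) ∧
        ∃ F, StepAt (flagDim ξ) A a b m F) ∧
    (∀ Φ : M → Circle → Op n, IsExtendedSolution Φ → (∀ p, Φ p ∈ OmegaXi ξ) →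
      Produced (flagDim ξ) r k (fun i p => loopFlag (Φ p) i)) ∧
    (∀ A : ℤ → Fam n M, Produced (flagDim ξ) r k A →
      ∃! Φ : M → Circle → Op n, IsExtendedSolution Φ ∧ (∀ p, Φ p ∈ OmegaXi ξ) ∧
        ∀ i p, loopFlag (Φ p) i = A i p) := by
  have hd := isDimSeq_flagDim hξ hrk
  obtain ⟨m, hm, hΩ, hdim⟩ := exists_weights hξ hrk
  refine ⟨fun A => ⟨fun h => h.produced hd, fun h => h.isSuperHorizontalFlag hd⟩,
    fun A hA a b l hst hl => ⟨(hst.inv hd hA).admissible hd.mono hl,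
      (hst.inv hd hA).exists_stepAt hd.mono hl⟩, fun Φ hΦ hmem => ?_, fun A hA => ?_⟩
  · exact (hΦ.isSuperHorizontalFlag hm hdim fun p => (hΩ _).1 (hmem p)).produced hd
  · exact (hA.isSuperHorizontalFlag hd).existsUnique_isExtendedSolution hm hdim hΩ
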